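/- Setting. Let $(M,d)$ be a finite metric space with integral distances, $n$ points and diameter $D$, and let $1\le k\le n$. A request sequence $\rho=(\rho(1),\dots,\rho(T))$ consists of points of $M$. A deterministic online $k$-server algorithm maps each non-empty prefix $\rho(\le t)$ to a configuration of $k$ servers $\mathcal C(t)\in M^k$ with $\rho(t)\in\mathcal C(t)$; its cost is $\sum_{1\le t<T} d(\mathcal C(t),\mathcal C(t+1))$, where the distance of two configurations is the minimum weight of a perfect matching between them. An $m$-barely random algorithm is the uniform distribution over $m\ge 1$ deterministic online algorithms $\mathcal C_1,\dots,\mathcal C_m$, and its cost is the average of their costs. A fractional online algorithm maps each non-empty prefix $\rho(\le t)$ to a measure $z(t)\ge 0$ of total mass $k$ on $M$ with mass exactly $1$ at $\rho(t)$; its cost is $\sum_{1\le t<T}\mathrm{OT}(z(t+1),z(t))$, where $\mathrm{OT}$ is the transport distance. It is $m$-barely fractional if all masses lie in $\frac1m\mathbb N$. A line metric is a finite set of integers with $d(x,y)=|x-y|$. For $\tau\ge 1$, a $\tau$-HST is the path metric on the leaves of a rooted tree with non-negative integral edge weights in which all leaves have the same depth and, for every node $u$ other than the root and every child $v$ of $u$,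 the edge above $u$ has $\tau$ times the weight of the edge above $v$. On a tree with edge weights $w_u$ (the weight of the edge above $u$), $\mathrm{OT}(z,z')=\sum_{u\ne \mathrm{root}}w_u|z_u-z'_u|$, where $z_u$ is the mass in the subtree of $u$; a line is viewed as a path rooted at its first point. Proposition. For the class of all line metrics, and likewise for the class of all $\tau$-HSTs over all $\tau>5$, there are a constant $C$, a polynomial $p$ and a single program such that the following holds for every metric of the class, all $k$ and $m$ as above, and every $m$-barely fractional $k$-server algorithm $z$. There is an $m$-barely random algorithm $\mathcal R=(\mathcal C_1,\dots,\mathcal C_m)$ with $$\mathrm{Cost}(\mathcal R,\rho)\le C\cdot \mathrm{Cost}(z,\rho)\qquad\text{for every request sequence }\rho ,$$ which the program computes online from the outputs of $z$: initially it is given the metric (for an HST, the weighted tree), $k$ and $m$; after each request $\rho(t)$ it is given $\rho(t)$ and $z(t)$ and outputs $\mathcal C_1(t),\dots,\mathcal C_m(t)$. For each request it uses, in addition to the time for computing $z(t)$, at most $p(N,m,\log D)$ steps on a random access machine with unit-cost addition, subtraction and comparison of integers, where $N$ is the number of points of the line, respectively the number of nodes of the tree. Moreover, whenever $z(t)$ has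 mass at most $1$ on every point, the $k$ servers of each $\mathcal C_i(t)$ are at pairwise distinct points. -/

import Mathlib

namespace KServer

/-! ## The k-server problem on a finite metric with integral distances

`P` is the set of points, `d` the distance, and a request sequence is a list of points; the
prefix of requests revealed up to time `t` is `ρ.take t`. -/

/-- A configuration of `k` servers, as a `k`-tuple of points. -/
abbrev Config (P : Type) (k : ℕ) : Type := Fin k → P

/-- Minimum weight of a perfect matching between two configurations. -/
def configDist {P : Type} (d : P → P → ℕ) {k : ℕ} (A B : Config P k) : ℕ :=
  Finset.univ.inf' ⟨(1 : Equiv.Perm (Fin k)), Finset.mem_univ _⟩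
    (fun σ : Equiv.Perm (Fin k) => ∑ j, d (A j) (B (σ j)))

/-- A deterministic online algorithm maps every revealed prefix of requests to a configuration.
Its value on the empty prefix plays no role. -/
abbrev DetAlg (P : Type) (k : ℕ) : Type := List P → Config P k

/-- The current request is always covered by a server. -/
def DetAlg.Serves {P : Type} {k : ℕ} (A : DetAlg P k) : Prop :=
  ∀ (ρ : List P) (r : P), ∃ j, A (ρ ++ [r]) j = r

/-- Movement cost `∑ₜ d(A(t), A(t+1))` over the times `1 ≤ t < T`, `T` the length of `ρ`. -/
def DetAlg.cost {P : Type} {k : ℕ} (d : P → P → ℕ) (A : DetAlg P k) (ρ : List P) : ℕ :=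
  ∑ t ∈ Finset.Ico 1 ρ.length, configDist d (A (ρ.take t)) (A (ρ.take (t + 1)))

/-- Expected cost of the uniform distribution over the `m` deterministic algorithms `R i`
(an `m`-barely random algorithm). -/
noncomputable def barelyRandomCost {P : Type} {k m : ℕ} (d : P → P → ℕ)
    (R : Fin m → DetAlg P k) (ρ : List P) : ℝ :=
  (1 / (m : ℝ)) * ∑ i, ((R i).cost d ρ : ℝ)

/-- A fractional online algorithm maps every revealed prefix of requests to a measure of mass `k`
on the points, with mass exactly `1` at the current request. -/
structure IsFractional {P : Type} [Fintype P] (k : ℕ) (z : List P → P → ℝ) : Prop where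
  nonneg : ∀ ρ, ρ ≠ [] → ∀ p, 0 ≤ z ρ p
  mass : ∀ ρ, ρ ≠ [] → ∑ p, z ρ p = k
  serves : ∀ (ρ : List P) (r : P), z (ρ ++ [r]) r = 1

/-- All the measures only take values in `(1/m) ℕ`. -/
def IsBarelyFractional {P : Type} (m : ℕ) (z : List P → P → ℝ) : Prop :=
  ∀ ρ, ρ ≠ [] → ∀ p, ∃ q : ℕ, z ρ p = (q : ℝ) / (m : ℝ)

/-- Movement cost of a fractional algorithm for the transport distance `ot`. -/
noncomputable def fracCost {P : Type} (ot : (P → ℝ) → (P → ℝ) → ℝ)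
    (z : List P → P → ℝ) (ρ : List P) : ℝ :=
  ∑ t ∈ Finset.Ico 1 ρ.length, ot (z (ρ.take (t + 1))) (z (ρ.take t))

/-- Diameter of the metric. -/
def diam {P : Type} [Fintype P] (d : P → P → ℕ) : ℕ :=
  Finset.univ.sup (fun q : P × P => d q.1 q.2)

/-! ## Line metrics

The points are integers `pos 0 < pos 1 < ⋯ < pos (n-1)`. -/

def lineDist {n : ℕ} (pos : Fin n → ℤ) (u v : Fin n) : ℕ := (pos u - pos v).natAbs

/-- The line is a path rooted at its first point: the edge above `u` joins `u - 1` to `u`, and the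
mass below it is the mass at the points `v ≥ u`. The transport distance is the sum over the edges
of the length times the change of the mass below. -/
noncomputable def lineOT {n : ℕ} (pos : Fin n → ℤ) (x y : Fin n → ℝ) : ℝ :=
  ∑ u : Fin n, if 0 < (u : ℕ) then
    ((pos u - pos ⟨(u : ℕ) - 1, lt_of_le_of_lt (Nat.sub_le _ _) u.isLt⟩ : ℤ) : ℝ) *
      |(∑ v ∈ Finset.Ici u, x v) - ∑ v ∈ Finset.Ici u, y v|
  else 0

/-! ## Rooted weighted trees and HSTs -/

/-- A rooted tree on the nodes `0, …, N-1`, given by its parent map (with the convention that the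
root is its own parent), with integral weights: `weight u` is the weight of the edge between `u`
and its parent, and `weight root` is never used. -/
structure WTree (N : ℕ) where
  root : Fin N
  parent : Fin N → Fin N
  weight : Fin N → ℕ
  parent_root : parent root = root
  reaches_root : ∀ u, ∃ i : ℕ, parent^[i] u = root

namespace WTree

variable {N : ℕ}

def IsChild (T : WTree N) (c u : Fin N) : Prop := c ≠ T.root ∧ T.parent c = u

def IsLeaf (T : WTree N) (u : Fin N) : Prop := ∀ c, ¬ T.IsChild c u

/-- The points of the metric space: the leaves. -/
abbrev Leaf (T : WTree N) : Type := {u : Fin N // T.IsLeaf u}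

noncomputable instance (T : WTree N) : Fintype T.Leaf := Fintype.ofFinite _

/-- `v` lies in the subtree rooted at `u`. -/
def Below (T : WTree N) (v u : Fin N) : Prop := ∃ i : ℕ, T.parent^[i] v = u

/-- Number of edges between `u` and the root. -/
noncomputable def depth (T : WTree N) (u : Fin N) : ℕ :=
  sInf {i : ℕ | T.parent^[i] u = T.root}

open Classical in
/-- Sum of the edge weights on the path between `a` and `b`: the edge above `u` is on this path
exactly when one of `a`, `b` is below `u` and the other is not. -/
noncomputable def dist (T : WTree N) (a b : T.Leaf) : ℕ :=
  ∑ u : Fin N, if u ≠ T.root ∧ ¬ (T.Below a u ↔ T.Below b u) then T.weight u else 0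

open Classical in
/-- The mass that the leaf measure `x` has in the subtree rooted at `u`. -/
noncomputable def massBelow (T : WTree N) (x : T.Leaf → ℝ) (u : Fin N) : ℝ :=
  ∑ a : T.Leaf, if T.Below a u then x a else 0

open Classical in
/-- The transport distance between two leaf measures. -/
noncomputable def OT (T : WTree N) (x y : T.Leaf → ℝ) : ℝ :=
  ∑ u : Fin N, if u ≠ T.root then
    (T.weight u : ℝ) * |T.massBelow x u - T.massBelow y u| else 0

/-- The tree is a `τ`-HST: the weight of an edge is `τ` times the weight of the edges just below
it, and all leaves are at the same depth. -/
structure IsHST (T : WTree N) (τ : ℝ) : Prop where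
  ratio : ∀ u, u ≠ T.root → ∀ c, T.IsChild c u → (T.weight u : ℝ) = τ * (T.weight c : ℝ)
  same_depth : ∀ a b, T.IsLeaf a → T.IsLeaf b → T.depth a = T.depth b

end WTree

/-! ## A machine model with a step count

A random access machine over the integers, presented as a while-language. The memory consists of
the registers `var x` and of the two-dimensional arrays `arr a`. The only arithmetic operations are
addition and subtraction, so that one step adds at most one bit to the size of the numbers in the
memory, and counting unit steps agrees with Turing machine time up to a polynomial in the size of
the input. -/

structure Mem where
  var : ℕ → ℤ
  arr : ℕ → ℕ → ℕ → ℤ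

def Mem.setVar (s : Mem) (x : ℕ) (v : ℤ) : Mem :=
  { s with var := fun y => if y = x then v else s.var y }

def Mem.setArr (s : Mem) (a i j : ℕ) (v : ℤ) : Mem :=
  { s with arr := fun b p q => if b = a ∧ p = i ∧ q = j then v else s.arr b p q }

inductive Expr where
  | const : ℤ → Expr
  | var : ℕ → Expr
  | get : ℕ → Expr → Expr → Expr
  | add : Expr → Expr → Expr
  | sub : Expr → Expr → Expr

/-- Array indices are natural numbers; a negative index is read as `0`. -/
def Expr.eval (s : Mem) : Expr → ℤ
  | .const v => v
  | .var x => s.var x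
  | .get a e f => s.arr a (e.eval s).toNat (f.eval s).toNat
  | .add e f => e.eval s + f.eval s
  | .sub e f => e.eval s - f.eval s

/-- Number of steps for evaluating an expression. -/
def Expr.cost : Expr → ℕ
  | .const _ => 1
  | .var _ => 1
  | .get _ e f => e.cost + f.cost + 1
  | .add e f => e.cost + f.cost + 1
  | .sub e f => e.cost + f.cost + 1

inductive Test where
  | le : Expr → Expr → Test
  | eq : Expr → Expr → Test
  | not : Test → Test
  | and : Test → Test → Test

def Test.holds (s : Mem) : Test → Prop
  | .le e f => e.eval s ≤ f.eval s
  | .eq e f => e.eval s = f.eval s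
  | .not b => ¬ b.holds s
  | .and b c => b.holds s ∧ c.holds s

def Test.cost : Test → ℕ
  | .le e f => e.cost + f.cost + 1
  | .eq e f => e.cost + f.cost + 1
  | .not b => b.cost + 1
  | .and b c => b.cost + c.cost + 1

inductive Prog where
  | skip : Prog
  | setVar : ℕ → Expr → Prog
  | setArr : ℕ → Expr → Expr → Expr → Prog
  | seq : Prog → Prog → Prog
  | ite : Test → Prog → Prog → Prog
  | loop : Test → Prog → Prog

/-- `Exec c s t s'`: started in memory `s`, the program `c` halts after exactly `t` steps in
memory `s'`. Here `loop b c` is the loop "while `b` do `c`". -/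
inductive Exec : Prog → Mem → ℕ → Mem → Prop where
  | skip (s : Mem) : Exec .skip s 1 s
  | setVar (x : ℕ) (e : Expr) (s : Mem) :
      Exec (.setVar x e) s (e.cost + 1) (s.setVar x (e.eval s))
  | setArr (a : ℕ) (e f g : Expr) (s : Mem) :
      Exec (.setArr a e f g) s (e.cost + f.cost + g.cost + 1)
        (s.setArr a (e.eval s).toNat (f.eval s).toNat (g.eval s))
  | seq {c c' : Prog} {s s' s'' : Mem} {t t' : ℕ} :
      Exec c s t s' → Exec c' s' t' s'' → Exec (.seq c c') s (t + t' + 1) s''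
  | ite_true {b : Test} {c c' : Prog} {s s' : Mem} {t : ℕ} :
      b.holds s → Exec c s t s' → Exec (.ite b c c') s (b.cost + t + 1) s'
  | ite_false {b : Test} {c c' : Prog} {s s' : Mem} {t : ℕ} :
      ¬ b.holds s → Exec c' s t s' → Exec (.ite b c c') s (b.cost + t + 1) s'
  | loop_false {b : Test} {c : Prog} {s : Mem} :
      ¬ b.holds s → Exec (.loop b c) s (b.cost + 1) s
  | loop_true {b : Test} {c : Prog} {s s' s'' : Mem} {t t' : ℕ} :
      b.holds s → Exec c s t s' → Exec (.loop b c) s' t' s'' →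
        Exec (.loop b c) s (b.cost + t + t' + 1) s''

/-! ## Online conversion of a barely fractional algorithm -/

/-- Initial memory for a line metric: `n`, `k`, `m`, and the positions of the points. -/
def lineInit {n : ℕ} (k m : ℕ) (pos : Fin n → ℤ) : Mem where
  var x := if x = 0 then n else if x = 1 then k else if x = 2 then m else 0
  arr a i j := if h : a = 0 ∧ i = 0 ∧ j < n then pos ⟨j, h.2.2⟩ else 0

/-- Initial memory for a tree: the number of nodes, `k`, `m`, the root, and the arrays of parents
and of weights. -/
def treeInit {N : ℕ} (k m : ℕ) (T : WTree N) : Mem where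
  var x := if x = 0 then N else if x = 1 then k else if x = 2 then m
    else if x = 3 then ((T.root : ℕ) : ℤ) else 0
  arr a i j := if h : a = 0 ∧ j < N then
      if i = 0 then ((T.parent ⟨j, h.2⟩ : ℕ) : ℤ)
      else if i = 1 then (T.weight ⟨j, h.2⟩ : ℤ) else 0
    else 0

/-- Hand the next input to the converting program: the request `r`, in register `4`, and the
measure `x` that the fractional algorithm has just output, in row `0` of array `1`, as the integers
`m * x p`. The rest of the memory is untouched. The points are named by the numbers `code p`. -/
noncomputable def feed {P : Type} [Fintype P] (code : P → ℕ) (m : ℕ) (r : P) (x : P → ℝ)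
    (s : Mem) : Mem where
  var y := if y = 4 then (code r : ℤ) else s.var y
  arr a i j := if a = 1 ∧ i = 0 then
      ∑ p, (if code p = j then (⌊(m : ℝ) * x p⌋₊ : ℤ) else 0)
    else s.arr a i j

/-- The program `c`, started on the memory `init` and activated once after each request, computes
online the configurations of the algorithms `R 0, …, R (m-1)` from the outputs of the
fractional algorithm `z`, and every activation takes at most `B` steps: `M ρ` is the memory after
the requests `ρ`, and after the requests `ρ ++ [r]` the entry `(i, j)` of array `2` is the position
of the `j`-th server of `R i`. These steps are all that is done in addition to
the computation of `z (ρ ++ [r])` itself. -/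
def ConvertsOnline {P : Type} [Fintype P] {k m : ℕ} (c : Prog) (init : Mem) (code : P → ℕ)
    (z : List P → P → ℝ) (R : Fin m → DetAlg P k) (B : ℕ) : Prop :=
  ∃ M : List P → Mem, M [] = init ∧ ∀ (ρ : List P) (r : P),
    (∃ t ≤ B, Exec c (feed code m r (z (ρ ++ [r])) (M ρ)) t (M (ρ ++ [r]))) ∧
    ∀ (i : Fin m) (j : Fin k), (M (ρ ++ [r])).arr 2 i j = (code (R i (ρ ++ [r]) j) : ℤ)

end KServer

namespace KServer

/-! ### Program logic -/

namespace Prog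

def writesVar : Prog → ℕ → Bool
  | skip, _ => false
  | setVar x _, y => Nat.beq x y
  | setArr _ _ _ _, _ => false
  | seq c c', y => c.writesVar y || c'.writesVar y
  | ite _ c c', y => c.writesVar y || c'.writesVar y
  | loop _ c, y => c.writesVar y

def writesArr : Prog → ℕ → Bool
  | skip, _ => false
  | setVar _ _, _ => false
  | setArr a _ _ _, b => Nat.beq a b
  | seq c c', y => c.writesArr y || c'.writesArr y
  | ite _ c c', y => c.writesArr y || c'.writesArr y
  | loop _ c, y => c.writesArr y

/-- A bound for the number of steps when no loop makes more than `X` rounds. -/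
def bound (X : ℕ) : Prog → ℕ
  | skip => 1
  | setVar _ e => e.cost + 1
  | setArr _ e f g => e.cost + f.cost + g.cost + 1
  | seq c c' => c.bound X + c'.bound X + 1
  | ite b c c' => b.cost + (c.bound X + c'.bound X) + 1
  | loop b c => (X + 1) * (b.cost + c.bound X + 1)

/-- Run `c` with the register `x` counting from `0` up to the value of `e`. -/
def forTo (x : ℕ) (e : Expr) (c : Prog) : Prog :=
  seq (setVar x (.const 0))
    (loop (.not (.le e (.var x))) (seq c (setVar x (.add (.var x) (.const 1)))))

theorem bound_le_pow (c : Prog) : ∃ e : ℕ, ∀ X, c.bound X ≤ e * (X + 1) ^ e := by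
  have up : ∀ {a b : ℕ} (X : ℕ), a ≤ b → a * (X + 1) ^ a ≤ b * (X + 1) ^ b := fun X h =>
    Nat.mul_le_mul h (Nat.pow_le_pow_right (Nat.succ_pos X) h)
  have one : ∀ X e : ℕ, 1 ≤ (X + 1) ^ e := fun X e => Nat.one_le_pow _ _ (Nat.succ_pos X)
  have const : ∀ a : ℕ, ∃ e : ℕ, ∀ X : ℕ, a ≤ e * (X + 1) ^ e := fun a =>
    ⟨a, fun X => Nat.le_mul_of_pos_right a (one X a)⟩
  have add : ∀ {p q : ℕ → ℕ}, (∃ e : ℕ, ∀ X, p X ≤ e * (X + 1) ^ e) →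
      (∃ e : ℕ, ∀ X, q X ≤ e * (X + 1) ^ e) →
      ∃ e : ℕ, ∀ X, p X + q X ≤ e * (X + 1) ^ e := by
    rintro p q ⟨e, he⟩ ⟨f, hf⟩
    refine ⟨e + f, fun X => ?_⟩
    have h1 : (X + 1) ^ e ≤ (X + 1) ^ (e + f) :=
      Nat.pow_le_pow_right (Nat.succ_pos X) (Nat.le_add_right _ _)
    have h2 : (X + 1) ^ f ≤ (X + 1) ^ (e + f) :=
      Nat.pow_le_pow_right (Nat.succ_pos X) (Nat.le_add_left _ _)
    rw [add_mul]
    exact Nat.add_le_add ((he X).trans (Nat.mul_le_mul_left _ h1))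
      ((hf X).trans (Nat.mul_le_mul_left _ h2))
  induction c with
  | skip => exact const 1
  | setVar x e => exact const _
  | setArr a e f g => exact const _
  | seq c c' h h' => exact add (add h h') (const 1)
  | ite b c c' h h' => exact add (add (const _) (add h h')) (const 1)
  | loop b c h =>
    obtain ⟨e, he⟩ := add (add (const b.cost) h) (const 1)
    refine ⟨e + 1, fun X => ?_⟩
    calc (X + 1) * (b.cost + c.bound X + 1) ≤ (X + 1) * (e * (X + 1) ^ e) :=
          Nat.mul_le_mul_left _ (he X)
      _ = e * (X + 1) ^ (e + 1) := by ring
      _ ≤ (e + 1) * (X + 1) ^ (e + 1) := Nat.mul_le_mul_right _ (Nat.le_succ e)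

/-- The bound is polynomial in `Y` when the number of rounds is quadratic in `Y`. -/
theorem bound_sq_le_pow (c : Prog) : ∃ e : ℕ, ∀ Y, 1 ≤ Y → c.bound (2 * Y ^ 2) ≤ e * Y ^ e := by
  obtain ⟨e, he⟩ := c.bound_le_pow
  refine ⟨e * 3 ^ e + 2 * e, fun Y hY => (he _).trans ?_⟩
  have h1 : 2 * Y ^ 2 + 1 ≤ 3 * Y ^ 2 := by nlinarith
  calc e * (2 * Y ^ 2 + 1) ^ e ≤ e * (3 * Y ^ 2) ^ e :=
        Nat.mul_le_mul_left _ (Nat.pow_le_pow_left h1 e)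
    _ = e * 3 ^ e * Y ^ (2 * e) := by rw [mul_pow, ← pow_mul, mul_assoc]
    _ ≤ (e * 3 ^ e + 2 * e) * Y ^ (e * 3 ^ e + 2 * e) :=
        Nat.mul_le_mul (Nat.le_add_right _ _) (Nat.pow_le_pow_right hY (Nat.le_add_left _ _))

end Prog

/-- The memories `s` and `s'` agree on everything that `c` does not write to. -/
structure Frame (c : Prog) (s s' : Mem) : Prop where
  var : ∀ x, c.writesVar x = false → s'.var x = s.var x
  arr : ∀ a, c.writesArr a = false → s'.arr a = s.arr a

theorem Frame.refl (c : Prog) (s : Mem) : Frame c s s := ⟨fun _ _ => rfl, fun _ _ => rfl⟩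

theorem Frame.trans {c : Prog} {s s' s'' : Mem} (h : Frame c s s') (h' : Frame c s' s'') :
    Frame c s s'' :=
  ⟨fun x hx => (h'.var x hx).trans (h.var x hx), fun a ha => (h'.arr a ha).trans (h.arr a ha)⟩

theorem Frame.mono {c c' : Prog} {s s' : Mem} (h : Frame c s s')
    (hv : ∀ x, c'.writesVar x = false → c.writesVar x = false)
    (ha : ∀ x, c'.writesArr x = false → c.writesArr x = false) : Frame c' s s' :=
  ⟨fun x hx => h.var x (hv x hx), fun a hx => h.arr a (ha a hx)⟩

@[simp] theorem Mem.setVar_arr (s : Mem) (x : ℕ) (v : ℤ) : (s.setVar x v).arr = s.arr := rfl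

@[simp] theorem Mem.setArr_var (s : Mem) (a i j : ℕ) (v : ℤ) : (s.setArr a i j v).var = s.var := rfl

@[simp] theorem Mem.setVar_var_same (s : Mem) (x : ℕ) (v : ℤ) : (s.setVar x v).var x = v :=
  if_pos rfl

theorem Mem.setVar_var_of_ne (s : Mem) {x y : ℕ} (v : ℤ) (h : y ≠ x) :
    (s.setVar x v).var y = s.var y := if_neg h

theorem Exec.frame {c : Prog} {s s' : Mem} {t : ℕ} (h : Exec c s t s') : Frame c s s' := by
  induction h with
  | skip s => exact Frame.refl _ _
  | setVar x e s =>
    refine ⟨fun y hy => Mem.setVar_var_of_ne _ _ ?_, fun _ _ => rfl⟩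
    rintro rfl
    simp [Prog.writesVar] at hy
  | setArr a e f g s =>
    refine ⟨fun _ _ => rfl, fun b hb => ?_⟩
    have : b ≠ a := by
      rintro rfl
      simp [Prog.writesArr] at hb
    funext p q
    simp [Mem.setArr, this]
  | seq _ _ h h' =>
    exact (h.mono (fun x hx => by simp_all [Prog.writesVar])
      (fun x hx => by simp_all [Prog.writesArr])).trans
      (h'.mono (fun x hx => by simp_all [Prog.writesVar])
      (fun x hx => by simp_all [Prog.writesArr]))
  | ite_true _ _ h =>
    exact h.mono (fun x hx => by simp_all [Prog.writesVar])
      (fun x hx => by simp_all [Prog.writesArr])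
  | ite_false _ _ h =>
    exact h.mono (fun x hx => by simp_all [Prog.writesVar])
      (fun x hx => by simp_all [Prog.writesArr])
  | loop_false _ => exact Frame.refl _ _
  | @loop_true b c _ _ _ _ _ _ _ _ h h' =>
    exact (h.mono (c' := .loop b c) (fun _ h => h) (fun _ h => h)).trans h'

/-- Started in `s`, the program `c` halts in a memory satisfying `Q`, in at most the time that it
takes when no loop makes more than `X` rounds. -/
def Runs (X : ℕ) (c : Prog) (Q : Mem → Prop) (s : Mem) : Prop :=
  ∃ t ≤ c.bound X, ∃ s', Exec c s t s' ∧ Q s'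

namespace Runs

variable {X : ℕ} {c c' : Prog} {s : Mem} {Q Q' : Mem → Prop}

theorem mono (h : Runs X c Q s) (hQ : ∀ s', Frame c s s' → Q s' → Q' s') : Runs X c Q' s := by
  obtain ⟨t, ht, s', he, hq⟩ := h
  exact ⟨t, ht, s', he, hQ s' he.frame hq⟩

theorem skip (h : Q s) : Runs X .skip Q s := ⟨1, le_rfl, s, .skip s, h⟩

theorem setVar {x : ℕ} {e : Expr} (h : Q (s.setVar x (e.eval s))) : Runs X (.setVar x e) Q s :=
  ⟨_, le_rfl, _, .setVar x e s, h⟩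

theorem setArr {a : ℕ} {e f g : Expr}
    (h : Q (s.setArr a (e.eval s).toNat (f.eval s).toNat (g.eval s))) :
    Runs X (.setArr a e f g) Q s :=
  ⟨_, le_rfl, _, .setArr a e f g s, h⟩

theorem seq (h : Runs X c (Runs X c' Q) s) : Runs X (.seq c c') Q s := by
  obtain ⟨t, ht, s', he, t', ht', s'', he', hq⟩ := h
  exact ⟨_, by simp only [Prog.bound]; omega, s'', .seq he he', hq⟩

theorem ite {b : Test} (h : b.holds s → Runs X c Q s) (h' : ¬ b.holds s → Runs X c' Q s) :
    Runs X (.ite b c c') Q s := by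
  by_cases hb : b.holds s
  · obtain ⟨t, ht, s', he, hq⟩ := h hb
    exact ⟨_, by simp only [Prog.bound]; omega, s', .ite_true hb he, hq⟩
  · obtain ⟨t, ht, s', he, hq⟩ := h' hb
    exact ⟨_, by simp only [Prog.bound]; omega, s', .ite_false hb he, hq⟩

theorem forTo {x : ℕ} {e : Expr} (I : ℕ → Mem → Prop) (n : ℕ) (hn : n ≤ X)
    (hx : c.writesVar x = false) (hI : ∀ i s' v, I i s' → I i (Mem.setVar s' x v))
    (he : ∀ i s', i ≤ n → Frame (.forTo x e c) s s' → s'.var x = i → I i s' →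
      (e.eval s').toNat = n)
    (h0 : I 0 s)
    (hs : ∀ i s', i < n → Frame (.forTo x e c) s s' → s'.var x = i → I i s' →
      Runs X c (I (i + 1)) s')
    (hQ : ∀ s', Frame (.forTo x e c) s s' → s'.var x = n → I n s' → Q s') :
    Runs X (.forTo x e c) Q s := by
  set F : Prog := .forTo x e c with hF
  have hwx : F.writesVar x = true := by simp [hF, Prog.forTo, Prog.writesVar]
  have setx : ∀ (s' : Mem) (v : ℤ), Frame F s' (s'.setVar x v) := fun s' v =>
    ⟨fun y hy => Mem.setVar_var_of_ne _ _ (by rintro rfl; simp [hwx] at hy), fun _ _ => rfl⟩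
  have main : ∀ r i s', i + r = n → Frame F s s' → s'.var x = i → I i s' →
      ∃ t ≤ (r + 1) * ((Test.not (.le e (.var x))).cost + (Prog.seq c (.setVar x
          (.add (.var x) (.const 1)))).bound X + 1),
        ∃ s'', Exec (.loop (.not (.le e (.var x))) (.seq c (.setVar x
          (.add (.var x) (.const 1))))) s' t s'' ∧ Q s'' := by
    intro r
    induction r with
    | zero =>
      intro i s' hi hf hv hI'
      have hi : i = n := by omega
      subst hi
      have h1 := he i s' le_rfl hf hv hI'
      have h2 : ¬ (Test.not (.le e (.var x))).holds s' := by
        simp only [Test.holds, Expr.eval, not_not, hv]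
        omega
      exact ⟨_, by omega, s', .loop_false h2, hQ s' hf hv hI'⟩
    | succ r ih =>
      intro i s' hi hf hv hI'
      have h1 := he i s' (by omega) hf hv hI'
      have h2 : (Test.not (.le e (.var x))).holds s' := by
        simp only [Test.holds, Expr.eval, hv]
        omega
      obtain ⟨t, ht, s1, he1, hI1⟩ := hs i s' (by omega) hf hv hI'
      have hf1 : Frame F s' s1 := he1.frame.mono
        (fun y hy => by simp_all [Prog.forTo, Prog.writesVar])
        (fun y hy => by simp_all [Prog.forTo, Prog.writesArr])
      have hv1 : s1.var x = i := (he1.frame.var x hx).trans hv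
      have hstep : Exec (.setVar x (.add (.var x) (.const 1))) s1 _
          (s1.setVar x (s1.var x + 1)) := Exec.setVar x (.add (.var x) (.const 1)) s1
      obtain ⟨t2, ht2, s2, he2, hq2⟩ := ih (i + 1) (s1.setVar x (s1.var x + 1)) (by omega)
        ((hf.trans hf1).trans (setx _ _)) (by simp [hv1]) (hI _ _ _ hI1)
      refine ⟨_, ?_, s2, .loop_true h2 (.seq he1 hstep) he2, hq2⟩
      rw [add_mul (r + 1) 1, one_mul]
      simp only [Prog.bound] at ht2 ⊢
      omega
  obtain ⟨t, ht, s', he', hq⟩ := main n 0 (s.setVar x 0) (by omega) (setx _ _) (by simp)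
    (hI _ _ _ h0)
  refine ⟨_, ?_, s', .seq (.setVar x (.const 0) s) he', hq⟩
  have h3 := ht.trans (Nat.mul_le_mul_right _ (Nat.succ_le_succ hn))
  simp only [hF, Prog.forTo, Prog.bound] at h3 ⊢
  exact Nat.succ_le_succ (Nat.add_le_add le_rfl h3)

end Runs

/-! ### Online computations from invariants -/

theorem exists_trace {P : Type} [Fintype P] (c : Prog) (init : Mem) (code : P → ℕ) (m : ℕ)
    (z : List P → P → ℝ) (B : ℕ) (Inv : List P → Mem → Prop)
    (Step : List P → P → Mem → Mem → Prop) (h0 : Inv [] init)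
    (hs : ∀ ρ r s, Inv ρ s → ∃ t ≤ B, ∃ s', Exec c (feed code m r (z (ρ ++ [r])) s) t s' ∧
      Inv (ρ ++ [r]) s' ∧ Step ρ r s s') :
    ∃ M : List P → Mem, M [] = init ∧ (∀ ρ, Inv ρ (M ρ)) ∧ ∀ ρ r,
      (∃ t ≤ B, Exec c (feed code m r (z (ρ ++ [r])) (M ρ)) t (M (ρ ++ [r]))) ∧
      Step ρ r (M ρ) (M (ρ ++ [r])) := by
  choose! t ht next hexec hinv hstep using hs
  let M : List P → Mem := fun ρ =>
    List.rec (motive := fun _ => Mem) init (fun r l s => next l.reverse r s) ρ.reverse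
  have hM : ∀ ρ r, M (ρ ++ [r]) = next ρ r (M ρ) := by
    intro ρ r
    simp only [M]
    rw [List.reverse_append, List.reverse_singleton, List.singleton_append]
    simp
  have hI : ∀ ρ, Inv ρ (M ρ) := by
    intro ρ
    induction ρ using List.reverseRecOn with
    | nil => exact h0
    | append_singleton ρ r ih => rw [hM]; exact hinv _ _ _ ih
  refine ⟨M, rfl, hI, fun ρ r => ?_⟩
  rw [hM]
  exact ⟨⟨_, ht _ _ _ (hI ρ), hexec _ _ _ (hI ρ)⟩, hstep _ _ _ (hI ρ)⟩

/-- A program that maintains an invariant, with the configurations in array `2`, yields a barely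
random algorithm. -/
theorem exists_barelyRandom {P : Type} [Fintype P] {k m : ℕ} (d : P → P → ℕ)
    (ot : (P → ℝ) → (P → ℝ) → ℝ) (C : ℝ) (c : Prog) (init : Mem) (code : P → ℕ)
    (hcode : Function.Injective code) (hP : 0 < k → Nonempty P)
    (z : List P → P → ℝ) (B : ℕ) (Inv : List P → Mem → Prop)
    (Step : List P → P → Mem → Mem → Prop) (h0 : Inv [] init)
    (hs : ∀ ρ r s, Inv ρ s → ∃ t ≤ B, ∃ s', Exec c (feed code m r (z (ρ ++ [r])) s) t s' ∧
      Inv (ρ ++ [r]) s' ∧ Step ρ r s s')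
    (hout : ∀ ρ s, ρ ≠ [] → Inv ρ s → ∀ (i : Fin m) (j : Fin k), ∃ p, s.arr 2 i j = code p)
    (hserve : ∀ ρ r s, Inv (ρ ++ [r]) s → ∀ i : Fin m, ∃ j : Fin k, s.arr 2 i j = code r)
    (hinj : ∀ ρ s, ρ ≠ [] → Inv ρ s → (∀ p, z ρ p ≤ 1) → ∀ i : Fin m,
      Function.Injective fun j : Fin k => s.arr 2 i j)
    (hcost : ∀ ρ r s s', ρ ≠ [] → Inv ρ s → Inv (ρ ++ [r]) s' → Step ρ r s s' →
      ∀ A A' : Fin m → Config P k, (∀ (i : Fin m) (j : Fin k), s.arr 2 i j = code (A i j)) →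
        (∀ (i : Fin m) (j : Fin k), s'.arr 2 i j = code (A' i j)) →
        (1 / (m : ℝ)) * ∑ i, (configDist d (A i) (A' i) : ℝ) ≤ C * ot (z (ρ ++ [r])) (z ρ)) :
    ∃ R : Fin m → DetAlg P k,
      (∀ i, (R i).Serves) ∧
      (∀ ρ, ρ ≠ [] → (∀ p, z ρ p ≤ 1) → ∀ i, Function.Injective (R i ρ)) ∧
      (∀ ρ, barelyRandomCost d R ρ ≤ C * fracCost ot z ρ) ∧
      ConvertsOnline c init code z R B := by
  obtain ⟨M, hM0, hI, hM⟩ := exists_trace c init code m z B Inv Step h0 hs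
  have hex : ∀ (i : Fin m) (ρ : List P) (j : Fin k), ∃ p, ρ ≠ [] →
      (M ρ).arr 2 i j = code p := by
    intro i ρ j
    by_cases hρ : ρ = []
    · obtain ⟨p⟩ := hP (Fin.pos j)
      exact ⟨p, fun h => absurd hρ h⟩
    · obtain ⟨p, hp⟩ := hout ρ _ hρ (hI ρ) i j
      exact ⟨p, fun _ => hp⟩
  choose R hR using hex
  have hne : ∀ (ρ : List P) (r : P), ρ ++ [r] ≠ [] := fun ρ r => by simp
  refine ⟨R, fun i ρ r => ?_, fun ρ hρ hz i j j' hjj => ?_, fun ρ => ?_,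
    M, hM0, fun ρ r => ⟨(hM ρ r).1, fun i j => hR i _ j (hne ρ r)⟩⟩
  · obtain ⟨j, hj⟩ := hserve ρ r _ (hI _) i
    refine ⟨j, hcode ?_⟩
    rw [hR i _ j (hne ρ r)] at hj
    exact_mod_cast hj
  · apply hinj ρ _ hρ (hI ρ) hz i
    simp only [hR i ρ _ hρ, hjj]
  · have hstep : ∀ t ∈ Finset.Ico 1 ρ.length,
        (1 / (m : ℝ)) * ∑ i, (configDist d (R i (ρ.take t)) (R i (ρ.take (t + 1))) : ℝ) ≤
          C * ot (z (ρ.take (t + 1))) (z (ρ.take t)) := by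
      intro t ht
      obtain ⟨h1, h2⟩ := Finset.mem_Ico.1 ht
      have h3 : ρ.take (t + 1) = ρ.take t ++ [ρ[t]] := by simp
      have h4 : ρ.take t ≠ [] := by
        intro h
        have := congrArg List.length h
        rw [List.length_take, List.length_nil] at this
        omega
      rw [h3]
      exact hcost _ _ _ _ h4 (hI _) (hI _) (hM _ _).2 _ _ (fun i j => hR i _ j h4)
        (fun i j => hR i _ j (hne _ _))
    calc barelyRandomCost d R ρ
        = ∑ t ∈ Finset.Ico 1 ρ.length, (1 / (m : ℝ)) *
            ∑ i, (configDist d (R i (ρ.take t)) (R i (ρ.take (t + 1))) : ℝ) := by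
          simp only [barelyRandomCost, DetAlg.cost, Nat.cast_sum]
          rw [Finset.sum_comm, Finset.mul_sum]
      _ ≤ ∑ t ∈ Finset.Ico 1 ρ.length, C * ot (z (ρ.take (t + 1))) (z (ρ.take t)) :=
          Finset.sum_le_sum hstep
      _ = C * fracCost ot z ρ := by rw [fracCost, Finset.mul_sum]

/-! ### Sequences with prescribed multiplicities -/

/-- The sequence `x` consists of `a 0` zeros, followed by `a 1` ones, and so on. -/
def Lists (n : ℕ) (a : ℕ → ℕ) (x : ℕ → ℤ) : Prop :=
  ∀ p < n, ∀ l, ∑ q ∈ Finset.range p, a q ≤ l → l < ∑ q ∈ Finset.range (p + 1), a q → x l = p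

theorem exists_block {a : ℕ → ℕ} {n l : ℕ} (h : l < ∑ q ∈ Finset.range n, a q) :
    ∃ p < n, ∑ q ∈ Finset.range p, a q ≤ l ∧ l < ∑ q ∈ Finset.range (p + 1), a q := by
  induction n with
  | zero => simp at h
  | succ n ih =>
    by_cases h' : l < ∑ q ∈ Finset.range n, a q
    · obtain ⟨p, hp, h1⟩ := ih h'
      exact ⟨p, by omega, h1⟩
    · exact ⟨n, by omega, by omega, h⟩

theorem prefix_mono (a : ℕ → ℕ) : Monotone fun p => ∑ q ∈ Finset.range p, a q :=
  fun _ _ h => Finset.sum_le_sum_of_subset (Finset.range_mono h)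

theorem block_unique {a : ℕ → ℕ} {p q l : ℕ} (h1 : ∑ q ∈ Finset.range p, a q ≤ l)
    (h2 : l < ∑ q ∈ Finset.range (p + 1), a q) (h3 : ∑ q ∈ Finset.range q, a q ≤ l)
    (h4 : l < ∑ q ∈ Finset.range (q + 1), a q) : p = q := by
  rcases lt_trichotomy p q with h | h | h
  · have := prefix_mono a (show p + 1 ≤ q from h)
    simp only at this
    omega
  · exact h
  · have := prefix_mono a (show q + 1 ≤ p from h)
    simp only at this
    omega

theorem Lists.exists_eq {n : ℕ} {a : ℕ → ℕ} {x : ℕ → ℤ} (h : Lists n a x) {l : ℕ}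
    (hl : l < ∑ q ∈ Finset.range n, a q) : ∃ p < n, 0 < a p ∧ x l = p := by
  obtain ⟨p, hp, h1, h2⟩ := exists_block hl
  refine ⟨p, hp, ?_, h p hp l h1 h2⟩
  rw [Finset.sum_range_succ] at h2
  omega

theorem Lists.le_iff {n : ℕ} {a : ℕ → ℕ} {x : ℕ → ℤ} (h : Lists n a x) {l u : ℕ}
    (hl : l < ∑ q ∈ Finset.range n, a q) : (u : ℤ) ≤ x l ↔ ∑ q ∈ Finset.range u, a q ≤ l := by
  obtain ⟨p, hp, h1, h2⟩ := exists_block hl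
  rw [h p hp l h1 h2, Nat.cast_le]
  constructor
  · intro hu
    exact (prefix_mono a hu).trans h1
  · intro hu
    by_contra hc
    have := prefix_mono a (show p + 1 ≤ u by omega)
    simp only at this
    omega

theorem Lists.card_eq {n k : ℕ} {a : ℕ → ℕ} {x : ℕ → ℤ} (h : Lists n a x)
    (hk : ∑ q ∈ Finset.range n, a q = k) {p : ℕ} (hp : p < n) :
    (Finset.univ.filter fun j : Fin k => x j = p).card = a p := by
  have h1 : (Finset.univ.filter fun j : Fin k => x j = p).card =
      (Finset.Ico (∑ q ∈ Finset.range p, a q) (∑ q ∈ Finset.range (p + 1), a q)).card := by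
    refine Finset.card_bij (fun j _ => (j : ℕ)) ?_ (fun _ _ _ _ h => Fin.ext h) ?_
    · intro j hj
      obtain ⟨q, hq, h1, h2⟩ := exists_block (a := a) (n := n) (l := j) (by rw [hk]; exact j.2)
      have h3 := h q hq j h1 h2
      have h4 : q = p := by
        have := (Finset.mem_filter.1 hj).2
        omega
      subst h4
      exact Finset.mem_Ico.2 ⟨h1, h2⟩
    · intro l hl
      obtain ⟨h1, h2⟩ := Finset.mem_Ico.1 hl
      have h3 := prefix_mono a (show p + 1 ≤ n from hp)
      simp only at h3
      exact ⟨⟨l, by omega⟩, by simpa using h p hp l h1 h2, rfl⟩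
  rw [h1, Nat.card_Ico, Finset.sum_range_succ]
  omega

/-! ### Masses of a barely fractional algorithm -/

theorem feed_mass {P : Type} [Fintype P] {code : P → ℕ} (hcode : Function.Injective code) (m : ℕ)
    (x : P → ℝ) (p : P) :
    (∑ q, (if code q = code p then (⌊(m : ℝ) * x q⌋₊ : ℤ) else 0)) = ⌊(m : ℝ) * x p⌋₊ := by
  classical
  rw [Finset.sum_eq_single p]
  · simp
  · intro q _ hq
    exact if_neg fun h => hq (hcode h)
  · simp

theorem IsBarelyFractional.floor_eq {P : Type} {m : ℕ} (hm : 0 < m) {z : List P → P → ℝ}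
    (hz : IsBarelyFractional m z) {ρ : List P} (hρ : ρ ≠ []) (p : P) :
    ((⌊(m : ℝ) * z ρ p⌋₊ : ℕ) : ℝ) = m * z ρ p := by
  obtain ⟨q, hq⟩ := hz ρ hρ p
  have : (m : ℝ) * z ρ p = q := by
    rw [hq]
    field_simp
  rw [this, Nat.floor_natCast]

/-! ### Line metrics -/

open Prog in
def linePlace : Prog :=
  seq (setArr 2 (.var 8) (.var 9) (.var 6))
    (seq (setVar 8 (.add (.var 8) (.const 1)))
      (ite (.eq (.var 8) (.var 2))
        (seq (setVar 8 (.const 0)) (setVar 9 (.add (.var 9) (.const 1)))) skip))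

open Prog in
/-- Deal the units of mass out from left to right to the `m` configurations in turn. -/
def lineProg : Prog :=
  seq (setVar 8 (.const 0)) (seq (setVar 9 (.const 0))
    (forTo 6 (.var 0) (forTo 7 (.get 1 (.const 0) (.var 6)) linePlace)))

/-- The first `L` units of mass have been dealt out. -/
def Dealt (n m : ℕ) (a : ℕ → ℕ) (L : ℕ) (s : Mem) : Prop :=
  s.var 8 = (L % m : ℕ) ∧ s.var 9 = (L / m : ℕ) ∧
    ∀ q < n, ∀ l, ∑ p ∈ Finset.range q, a p ≤ l → l < ∑ p ∈ Finset.range (q + 1), a p → l < L →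
      s.arr 2 (l % m) (l / m) = q

theorem linePlace_runs {X n m p L : ℕ} {a : ℕ → ℕ} {s : Mem} (hm : 0 < m)
    (h2 : s.var 2 = m) (h6 : s.var 6 = p) (hL : ∑ q ∈ Finset.range p, a q ≤ L)
    (hL' : L < ∑ q ∈ Finset.range (p + 1), a q) (h : Dealt n m a L s) :
    Runs X linePlace (Dealt n m a (L + 1)) s := by
  obtain ⟨h8, h9, harr⟩ := h
  have key : ∀ q < n, ∀ l, ∑ p ∈ Finset.range q, a p ≤ l →
      l < ∑ p ∈ Finset.range (q + 1), a p → l < L + 1 →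
      (s.setArr 2 (L % m) (L / m) p).arr 2 (l % m) (l / m) = q := by
    intro q hq l h1 h2 h3
    by_cases hl : l = L
    · subst hl
      rw [block_unique h1 h2 hL hL']
      simp [Mem.setArr]
    · have : ¬ (l % m = L % m ∧ l / m = L / m) := by
        rintro ⟨h4, h5⟩
        apply hl
        rw [← Nat.div_add_mod l m, ← Nat.div_add_mod L m, h4, h5]
      simp only [Mem.setArr, true_and, this, if_false]
      exact harr q hq l h1 h2 (by omega)
  have hmod := Nat.mod_lt L hm
  have hdiv := Nat.div_add_mod L m
  refine Runs.seq (Runs.setArr ?_)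
  simp only [Expr.eval, h8, h9, h6, Int.toNat_natCast]
  refine Runs.seq (Runs.setVar (Runs.ite (fun hb => ?_) fun hb => ?_))
  · simp only [Test.holds, Expr.eval, Mem.setVar, Mem.setArr_var, h8, h2] at hb
    norm_num at hb
    have h3 : (L + 1) / m = L / m + 1 ∧ (L + 1) % m = 0 := by
      refine (Nat.div_mod_unique hm).2 ⟨?_, hm⟩
      rw [mul_add]
      omega
    refine Runs.seq (Runs.setVar (Runs.setVar ⟨?_, ?_, key⟩))
    · simp [Mem.setVar, Expr.eval, h3]
    · simp [Mem.setVar, Expr.eval, h3, h9]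
  · simp only [Test.holds, Expr.eval, Mem.setVar, Mem.setArr_var, h8, h2] at hb
    norm_num at hb
    have h3 : (L + 1) / m = L / m ∧ (L + 1) % m = L % m + 1 := by
      refine (Nat.div_mod_unique hm).2 ⟨by omega, by omega⟩
    refine Runs.skip ⟨?_, ?_, key⟩
    · simp [Mem.setVar, Expr.eval, h3, h8]
    · simp [Mem.setVar, h3, h9]

theorem lineProg_runs {X n m : ℕ} {a : ℕ → ℕ} {s : Mem} (hm : 0 < m) (h0 : s.var 0 = n)
    (h2 : s.var 2 = m) (ha : ∀ p < n, s.arr 1 0 p = a p) (hn : n ≤ X) (haX : ∀ p < n, a p ≤ X) :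
    Runs X lineProg (fun s' => Lists n a fun l => s'.arr 2 (l % m) (l / m)) s := by
  refine Runs.seq (Runs.setVar (Runs.seq (Runs.setVar ?_)))
  refine Runs.forTo (fun p => Dealt n m a (∑ q ∈ Finset.range p, a q)) n hn rfl
    (fun _ _ _ h => h) (fun p s' _ hf _ _ => ?_) ?_ (fun p s' hp hf h6 hD => ?_)
    (fun s' hf _ hD q hq l h1 h2 => ?_)
  · simp only [Expr.eval, hf.var 0 rfl]
    simp [Mem.setVar, h0]
  · simp [Dealt, Mem.setVar, Expr.eval]
  · have h0' : ∀ p < n, s'.arr 1 0 p = a p := fun p hp => by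
      rw [hf.arr 1 rfl]; exact ha p hp
    have h2' : s'.var 2 = m := by rw [hf.var 2 rfl]; exact h2
    refine Runs.forTo (fun c => Dealt n m a (∑ q ∈ Finset.range p, a q + c)) (a p) (haX p hp) rfl
      (fun _ _ _ h => h) (fun c s'' _ hf' _ _ => ?_) hD (fun c s'' hc hf' _ hD' => ?_)
      (fun s'' _ _ hD' => ?_)
    · simp [Expr.eval, hf'.var 6 rfl, hf'.arr 1 rfl, h6, h0' p hp]
    · refine linePlace_runs hm ((hf'.var 2 rfl).trans h2') ((hf'.var 6 rfl).trans h6)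
        (Nat.le_add_right _ _) ?_ hD'
      rw [Finset.sum_range_succ]
      exact Nat.add_lt_add_left hc _
    · rwa [Finset.sum_range_succ]
  · exact hD.2.2 q hq l h1 h2 (h2.trans_le (prefix_mono a (show q + 1 ≤ n from hq)))

theorem configDist_le_sum {P : Type} (d : P → P → ℕ) {k : ℕ} (A B : Config P k) :
    configDist d A B ≤ ∑ j, d (A j) (B j) :=
  Finset.inf'_le (f := fun σ : Equiv.Perm (Fin k) => ∑ j, d (A j) (B (σ j)))
    (Finset.mem_univ (1 : Equiv.Perm (Fin k)))

/-- The length of the edge of the line that ends in the point `u`. -/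
def lineGap {n : ℕ} (pos : Fin n → ℤ) (u : Fin n) : ℤ :=
  if 0 < (u : ℕ) then pos u - pos ⟨(u : ℕ) - 1, lt_of_le_of_lt (Nat.sub_le _ _) u.isLt⟩ else 0

theorem lineOT_eq {n : ℕ} (pos : Fin n → ℤ) (x y : Fin n → ℝ) :
    lineOT pos x y = ∑ u, (lineGap pos u : ℝ) *
      |(∑ v ∈ Finset.Ici u, x v) - ∑ v ∈ Finset.Ici u, y v| := by
  refine Finset.sum_congr rfl fun u _ => ?_
  unfold lineGap
  split_ifs <;> simp

theorem lineGap_nonneg {n : ℕ} {pos : Fin n → ℤ} (hpos : StrictMono pos) (u : Fin n) :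
    0 ≤ lineGap pos u := by
  unfold lineGap
  split_ifs
  · rw [sub_nonneg]
    exact hpos.monotone (Fin.mk_le_of_le_val (Nat.sub_le _ _))
  · exact le_rfl

theorem pos_eq_sum_lineGap {n : ℕ} (pos : Fin n → ℤ) (v : Fin n) :
    pos v = pos ⟨0, v.pos⟩ + ∑ u, if u ≤ v then lineGap pos u else 0 := by
  obtain ⟨v, hv⟩ := v
  induction v with
  | zero =>
    have : ∀ u : Fin n, (if u ≤ (⟨0, hv⟩ : Fin n) then lineGap pos u else 0) = 0 := by
      intro u
      split_ifs with h
      · have h0 : (u : ℕ) = 0 := Nat.le_zero.1 h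
        simp [lineGap, h0]
      · rfl
    simp [this]
  | succ v ih =>
    have h1 : ∀ u : Fin n, (if u ≤ (⟨v + 1, hv⟩ : Fin n) then lineGap pos u else 0) =
        (if u ≤ (⟨v, by omega⟩ : Fin n) then lineGap pos u else 0) +
          if u = (⟨v + 1, hv⟩ : Fin n) then lineGap pos u else 0 := by
      intro u
      simp only [Fin.le_def, Fin.ext_iff]
      split_ifs <;> omega
    simp only [h1, Finset.sum_add_distrib, Finset.sum_ite_eq', Finset.mem_univ, if_true]
    have h2 := ih (by omega)
    have h3 : lineGap pos ⟨v + 1, hv⟩ = pos ⟨v + 1, hv⟩ - pos ⟨v, by omega⟩ := by simp [lineGap]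
    rw [h3]
    linarith

theorem lineDist_eq {n : ℕ} {pos : Fin n → ℤ} (hpos : StrictMono pos) (v w : Fin n) :
    (lineDist pos v w : ℤ) = ∑ u, if (u ≤ v ↔ u ≤ w) then 0 else lineGap pos u := by
  have key : ∀ v w : Fin n, v ≤ w →
      pos w - pos v = ∑ u, if (u ≤ v ↔ u ≤ w) then 0 else lineGap pos u := by
    intro v w h
    rw [pos_eq_sum_lineGap pos v, pos_eq_sum_lineGap pos w, add_sub_add_left_eq_sub,
      ← Finset.sum_sub_distrib]
    refine Finset.sum_congr rfl fun u _ => ?_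
    by_cases h1 : u ≤ v
    · simp [h1, h1.trans h]
    · by_cases h2 : u ≤ w <;> simp [h1, h2]
  unfold lineDist
  rcases le_total v w with h | h
  · rw [← key v w h, Int.natCast_natAbs, abs_sub_comm,
      abs_of_nonneg (sub_nonneg.2 (hpos.monotone h))]
  · simp_rw [iff_comm (a := _ ≤ v)]
    rw [← key w v h, Int.natCast_natAbs, abs_of_nonneg (sub_nonneg.2 (hpos.monotone h))]

theorem card_not_iff_le (L f g : ℕ) :
    ((Finset.range L).filter fun l => ¬ (f ≤ l ↔ g ≤ l)).card ≤ ((f : ℤ) - g).natAbs := by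
  have key : ∀ f g : ℕ, f ≤ g →
      ((Finset.range L).filter fun l => ¬ (f ≤ l ↔ g ≤ l)).card ≤ g - f := by
    intro f g h
    rw [← Nat.card_Ico]
    refine Finset.card_le_card fun l hl => ?_
    have := (Finset.mem_filter.1 hl).2
    rw [Finset.mem_Ico]
    by_contra hc
    exact this ⟨fun _ => by omega, fun _ => by omega⟩
  rcases le_total f g with h | h
  · exact (key f g h).trans (by omega)
  · simp_rw [iff_comm (a := f ≤ _)]
    exact (key g f h).trans (by omega)

/-- Moving the units of mass in order costs no more than the transport distance. -/
theorem sum_lineDist_le {n L : ℕ} {pos : Fin n → ℤ} (hpos : StrictMono pos) {a b : ℕ → ℕ}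
    (x y : ℕ → Fin n) (hx : Lists n a fun l => (x l : ℕ)) (hy : Lists n b fun l => (y l : ℕ))
    (ha : ∑ q ∈ Finset.range n, a q = L) (hb : ∑ q ∈ Finset.range n, b q = L) :
    ∑ l ∈ Finset.range L, (lineDist pos (x l) (y l) : ℤ) ≤
      ∑ u : Fin n, lineGap pos u *
        |(∑ q ∈ Finset.range u, (a q : ℤ)) - ∑ q ∈ Finset.range u, (b q : ℤ)| := by
  simp_rw [lineDist_eq hpos]
  rw [Finset.sum_comm]
  refine Finset.sum_le_sum fun u _ => ?_
  have h1 : ∀ l ∈ Finset.range L, (if (u ≤ x l ↔ u ≤ y l) then 0 else lineGap pos u) =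
      if ¬ (∑ q ∈ Finset.range u, a q ≤ l ↔ ∑ q ∈ Finset.range u, b q ≤ l)
        then lineGap pos u else 0 := by
    intro l hl
    have hl := Finset.mem_range.1 hl
    have h2 := hx.le_iff (u := u) (ha ▸ hl)
    have h3 := hy.le_iff (u := u) (hb ▸ hl)
    rw [Nat.cast_le] at h2 h3
    simp only [Fin.le_def, h2, h3, ite_not]
  rw [Finset.sum_congr rfl h1, ← Finset.sum_filter, Finset.sum_const, nsmul_eq_mul, mul_comm]
  refine mul_le_mul_of_nonneg_left ?_ (lineGap_nonneg hpos u)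
  have := card_not_iff_le L (∑ q ∈ Finset.range u, a q) (∑ q ∈ Finset.range u, b q)
  rw [← Nat.cast_sum, ← Nat.cast_sum, ← Int.natCast_natAbs]
  exact_mod_cast this

theorem range_sum_add_Ici_sum {n : ℕ} (a : ℕ → ℝ) (u : Fin n) :
    ∑ q ∈ Finset.range u, a q + ∑ v ∈ Finset.Ici u, a v = ∑ v : Fin n, a v := by
  have h1 : ∑ q ∈ Finset.range u, a q = ∑ v : Fin n, if (v : ℕ) < u then a v else 0 := by
    rw [Fin.sum_univ_eq_sum_range (fun q => if q < (u : ℕ) then a q else 0),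
      ← Finset.sum_filter]
    refine Finset.sum_congr ?_ fun _ _ => rfl
    ext q
    have := u.2
    simp only [Finset.mem_range, Finset.mem_filter]
    omega
  have h2 : ∑ v ∈ Finset.Ici u, a v = ∑ v : Fin n, if u ≤ v then a v else 0 := by
    rw [← Finset.sum_filter]
    refine Finset.sum_congr ?_ fun _ _ => rfl
    ext v
    simp
  rw [h1, h2, ← Finset.sum_add_distrib]
  refine Finset.sum_congr rfl fun v _ => ?_
  by_cases h : u ≤ v
  · simp [h, not_lt.2 h]
  · simp [h, not_le.1 h]

/-- The units of mass `1 / m` at the point with number `q`. -/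
noncomputable def lineUnits {n : ℕ} (m : ℕ) (x : Fin n → ℝ) (q : ℕ) : ℕ :=
  if h : q < n then ⌊(m : ℝ) * x ⟨q, h⟩⌋₊ else 0

theorem lineUnits_val {n : ℕ} (m : ℕ) (x : Fin n → ℝ) (v : Fin n) :
    lineUnits m x v = ⌊(m : ℝ) * x v⌋₊ := by simp [lineUnits]

theorem sum_fin_prod_eq {k m : ℕ} (f : ℕ → ℕ → ℕ) :
    ∑ i : Fin m, ∑ j : Fin k, f i j = ∑ l ∈ Finset.range (k * m), f (l % m) (l / m) := by
  rw [Finset.sum_comm, ← Fintype.sum_prod_type', ← Fin.sum_univ_eq_sum_range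
    (fun l => f (l % m) (l / m))]
  refine Fintype.sum_equiv finProdFinEquiv _ _ ?_
  rintro ⟨j, i⟩
  have h := (Nat.div_mod_unique (a := (i : ℕ) + m * j) (Fin.pos i)).2 ⟨rfl, i.2⟩
  simp [finProdFinEquiv, h.1, h.2]

theorem line_conversion :
    ∃ (c : Prog) (C : ℝ) (e : ℕ),
      ∀ (n k m : ℕ) (pos : Fin n → ℤ), StrictMono pos → k ≤ n → 0 < m →
      ∀ z : List (Fin n) → Fin n → ℝ, IsFractional k z → IsBarelyFractional m z →
      ∃ R : Fin m → DetAlg (Fin n) k,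
        (∀ i, (R i).Serves) ∧
        (∀ ρ, ρ ≠ [] → (∀ p, z ρ p ≤ 1) → ∀ i, Function.Injective (R i ρ)) ∧
        (∀ ρ, barelyRandomCost (lineDist pos) R ρ ≤ C * fracCost (lineOT pos) z ρ) ∧
        ConvertsOnline c (lineInit k m pos) (fun p : Fin n => (p : ℕ)) z R
          (e * (n + m + Nat.log 2 (diam (lineDist pos)) + 1) ^ e) := by
  obtain ⟨e, he⟩ := lineProg.bound_sq_le_pow
  refine ⟨lineProg, 1, e, fun n k m pos hpos hkn hm z hz hzm => ?_⟩
  set Y := n + m + Nat.log 2 (diam (lineDist pos)) + 1 with hY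
  have hm' : (0 : ℝ) < m := Nat.cast_pos.2 hm
  have hu : ∀ ρ, ρ ≠ [] → ∀ v : Fin n, (lineUnits m (z ρ) v : ℝ) = m * z ρ v := fun ρ hρ v => by
    rw [lineUnits_val, hzm.floor_eq hm hρ]
  have hsum : ∀ ρ, ρ ≠ [] → ∑ q ∈ Finset.range n, lineUnits m (z ρ) q = k * m := by
    intro ρ hρ
    rw [← Fin.sum_univ_eq_sum_range]
    have h := hz.mass ρ hρ
    have : (∑ v : Fin n, (lineUnits m (z ρ) v : ℝ)) = k * m := by
      simp_rw [hu ρ hρ]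
      rw [← Finset.mul_sum, h, mul_comm]
    exact_mod_cast this
  have hle : ∀ ρ, ρ ≠ [] → ∀ p < n, lineUnits m (z ρ) p ≤ k * m := fun ρ hρ p hp => by
    rw [← hsum ρ hρ]
    exact Finset.single_le_sum (f := lineUnits m (z ρ)) (fun _ _ => Nat.zero_le _)
      (Finset.mem_range.2 hp)
  have hone : ∀ ρ (r : Fin n), lineUnits m (z (ρ ++ [r])) r = m := fun ρ r => by
    have := hu (ρ ++ [r]) (by simp) r
    rw [hz.serves, mul_one] at this
    exact_mod_cast this
  have hnX : n ≤ 2 * Y ^ 2 := by nlinarith [Nat.zero_le (Nat.log 2 (diam (lineDist pos)))]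
  have hkX : k * m ≤ 2 * Y ^ 2 := by
    have h1 : n ≤ Y := by omega
    have h2 : m ≤ Y := by omega
    calc k * m ≤ Y * Y := Nat.mul_le_mul (hkn.trans h1) h2
      _ ≤ 2 * Y ^ 2 := by nlinarith
  refine exists_barelyRandom (lineDist pos) (lineOT pos) 1 lineProg (lineInit k m pos) _
    Fin.val_injective (fun hk => ⟨⟨0, hk.trans_le hkn⟩⟩) z _
    (fun ρ s => s.var 0 = n ∧ s.var 2 = m ∧ (ρ ≠ [] →
      Lists n (lineUnits m (z ρ)) fun l => s.arr 2 (l % m) (l / m)))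
    (fun _ _ _ _ => True) ⟨rfl, rfl, fun h => absurd rfl h⟩ ?_ ?_ ?_ ?_ ?_
  · rintro ρ r s ⟨h0, h2, -⟩
    have hne : ρ ++ [r] ≠ [] := by simp
    obtain ⟨t, ht, s', hex, hl⟩ := lineProg_runs (X := 2 * Y ^ 2) (n := n) (m := m)
      (a := lineUnits m (z (ρ ++ [r])))
      (s := feed (fun p : Fin n => (p : ℕ)) m r (z (ρ ++ [r])) s) hm h0 h2
      (fun p hp => (feed_mass Fin.val_injective m (z (ρ ++ [r])) ⟨p, hp⟩).trans
        (by simp [lineUnits, hp])) hnX (fun p hp => (hle _ hne p hp).trans hkX)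
    exact ⟨t, ht.trans (he Y (by omega)), s', hex,
      ⟨(hex.frame.var 0 rfl).trans h0, (hex.frame.var 2 rfl).trans h2, fun _ => hl⟩, trivial⟩
  · rintro ρ s hρ ⟨-, -, hl⟩ i j
    have hlt : (i : ℕ) + m * j < k * m := (finProdFinEquiv (j, i)).2
    obtain ⟨p, hp, -, h⟩ := (hl hρ).exists_eq (hsum ρ hρ ▸ hlt)
    have hdm := (Nat.div_mod_unique (a := (i : ℕ) + m * j) hm).2 ⟨rfl, i.2⟩
    simp only [hdm.1, hdm.2] at h
    exact ⟨⟨p, hp⟩, h⟩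
  · rintro ρ r s ⟨-, -, hl⟩ i
    have hne : ρ ++ [r] ≠ [] := by simp
    have hF := Finset.sum_range_succ (lineUnits m (z (ρ ++ [r]))) r
    rw [hone] at hF
    set F := ∑ q ∈ Finset.range r, lineUnits m (z (ρ ++ [r])) q with hFdef
    obtain ⟨l, hl1, hl2, hl3⟩ : ∃ l, F ≤ l ∧ l < F + m ∧ l % m = i := by
      have hdm := Nat.div_add_mod F m
      have hlt := Nat.mod_lt F hm
      by_cases h : F % m ≤ i
      · refine ⟨m * (F / m) + i, by omega, by omega, ?_⟩
        rw [Nat.mul_add_mod, Nat.mod_eq_of_lt i.2]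
      · refine ⟨m * (F / m + 1) + i, by rw [mul_add]; omega, by rw [mul_add]; omega, ?_⟩
        rw [Nat.mul_add_mod, Nat.mod_eq_of_lt i.2]
    have hlk : l < k * m := by
      rw [← hsum _ hne]
      exact (hl2.trans_eq hF.symm).trans_le (prefix_mono _ (show (r : ℕ) + 1 ≤ n from r.2))
    refine ⟨⟨l / m, Nat.div_lt_of_lt_mul (by rwa [mul_comm])⟩, ?_⟩
    have := hl hne r r.2 l hl1 (by omega)
    simpa only [hl3] using this
  · rintro ρ s hρ ⟨-, -, hl⟩ hz1 i j j' hjj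
    have hdm : ∀ j : Fin k, ((i : ℕ) + m * j) / m = j ∧ ((i : ℕ) + m * j) % m = i := fun j =>
      (Nat.div_mod_unique hm).2 ⟨rfl, i.2⟩
    have hlt : ∀ j : Fin k, (i : ℕ) + m * j < k * m := fun j => (finProdFinEquiv (j, i)).2
    have hblock : ∀ j : Fin k, ∃ p < n, ∑ q ∈ Finset.range p, lineUnits m (z ρ) q ≤ i + m * j ∧
        i + m * j < ∑ q ∈ Finset.range p, lineUnits m (z ρ) q + m ∧ s.arr 2 i j = p := by
      intro j
      obtain ⟨p, hp, h1, h2⟩ := exists_block (hsum ρ hρ ▸ hlt j)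
      have h3 := hl hρ p hp _ h1 h2
      simp only [(hdm j).1, (hdm j).2] at h3
      refine ⟨p, hp, h1, h2.trans_le ?_, h3⟩
      rw [Finset.sum_range_succ]
      have h4 := hu ρ hρ ⟨p, hp⟩
      have h5 : (lineUnits m (z ρ) p : ℝ) ≤ m := by
        rw [h4]
        exact mul_le_of_le_one_right hm'.le (hz1 _)
      exact Nat.add_le_add_left (Nat.cast_le.1 h5) _
    obtain ⟨p, hp, h1, h2, h3⟩ := hblock j
    obtain ⟨p', hp', h1', h2', h3'⟩ := hblock j'
    have hpp : p = p' := by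
      simp only at hjj
      rw [h3, h3'] at hjj
      exact_mod_cast hjj
    subst hpp
    have h4 : m * (j : ℕ) < m * (j' + 1) := by rw [mul_add]; omega
    have h5 : m * (j' : ℕ) < m * (j + 1) := by rw [mul_add]; omega
    have h6 := lt_of_mul_lt_mul_left h4 (Nat.zero_le m)
    have h7 := lt_of_mul_lt_mul_left h5 (Nat.zero_le m)
    exact Fin.ext (by omega)
  · rintro ρ r s s' hρ ⟨-, -, hl⟩ ⟨-, -, hl'⟩ - A A' hA hA'
    have hne : ρ ++ [r] ≠ [] := by simp
    have seq : ∀ A : Fin m → Config (Fin n) k, ∃ x : ℕ → ℕ → Fin n,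
        ∀ (i : Fin m) (j : Fin k), x i j = A i j := fun A =>
      ⟨fun i j => if h : i < m ∧ j < k then A ⟨i, h.1⟩ ⟨j, h.2⟩ else r, fun i j => by simp⟩
    obtain ⟨x, hx⟩ := seq A
    obtain ⟨x', hx'⟩ := seq A'
    have lists : ∀ (s : Mem) (A : Fin m → Config (Fin n) k) (x : ℕ → ℕ → Fin n) (a : ℕ → ℕ),
        (∀ (i : Fin m) (j : Fin k), x i j = A i j) →
        (∀ (i : Fin m) (j : Fin k), s.arr 2 i j = ((A i j : ℕ) : ℤ)) →
        ∑ q ∈ Finset.range n, a q = k * m →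
        (Lists n a fun l => s.arr 2 (l % m) (l / m)) →
        Lists n a fun l => (x (l % m) (l / m) : ℕ) := by
      intro s A x a hx hA ha h p hp l h1 h2
      have hlk : l < k * m := ha ▸ h2.trans_le (prefix_mono _ (show p + 1 ≤ n from hp))
      have h3 := h p hp l h1 h2
      have h4 := hA ⟨l % m, Nat.mod_lt l hm⟩ ⟨l / m, Nat.div_lt_of_lt_mul (by rwa [mul_comm])⟩
      rw [← hx] at h4
      exact h4.symm.trans h3
    have hsle := sum_lineDist_le hpos (fun l => x (l % m) (l / m)) (fun l => x' (l % m) (l / m))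
      (lists s A x _ hx hA (hsum ρ hρ) (hl hρ)) (lists s' A' x' _ hx' hA' (hsum _ hne) (hl' hne))
      (hsum ρ hρ) (hsum _ hne)
    have h1 : ∑ i, configDist (lineDist pos) (A i) (A' i) ≤
        ∑ l ∈ Finset.range (k * m), lineDist pos (x (l % m) (l / m)) (x' (l % m) (l / m)) := by
      rw [← sum_fin_prod_eq fun i j => lineDist pos (x i j) (x' i j)]
      refine Finset.sum_le_sum fun i _ => ?_
      simp_rw [hx, hx']
      exact configDist_le_sum _ _ _
    have h2 : (∑ i, (configDist (lineDist pos) (A i) (A' i) : ℝ)) ≤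
        ∑ u : Fin n, (lineGap pos u : ℝ) * |(∑ q ∈ Finset.range u, (lineUnits m (z ρ) q : ℝ)) -
          ∑ q ∈ Finset.range u, (lineUnits m (z (ρ ++ [r])) q : ℝ)| := by
      have h3 := (Nat.cast_le (α := ℤ)).2 h1
      rw [Nat.cast_sum, Nat.cast_sum] at h3
      have h4 := (Int.cast_le (R := ℝ)).2 (h3.trans hsle)
      push_cast at h4
      exact h4
    have h3 : ∀ u : Fin n, |(∑ q ∈ Finset.range u, (lineUnits m (z ρ) q : ℝ)) -
          ∑ q ∈ Finset.range u, (lineUnits m (z (ρ ++ [r])) q : ℝ)| =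
        m * |(∑ v ∈ Finset.Ici u, z (ρ ++ [r]) v) - ∑ v ∈ Finset.Ici u, z ρ v| := by
      intro u
      have h4 := range_sum_add_Ici_sum (fun q => (lineUnits m (z ρ) q : ℝ)) u
      have h5 := range_sum_add_Ici_sum (fun q => (lineUnits m (z (ρ ++ [r])) q : ℝ)) u
      simp_rw [hu ρ hρ, ← Finset.mul_sum, hz.mass ρ hρ] at h4
      simp_rw [hu _ hne, ← Finset.mul_sum, hz.mass _ hne] at h5
      rw [← abs_of_pos hm', ← abs_mul]
      congr 1
      linarith
    rw [lineOT_eq, one_mul, one_div, inv_mul_le_iff₀ hm']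
    refine h2.trans (le_of_eq ?_)
    rw [Finset.mul_sum]
    refine Finset.sum_congr rfl fun u _ => ?_
    rw [h3]
    ring

/-! ### Matchings on trees -/

namespace WTree

variable {N : ℕ} (T : WTree N)

theorem Below.total {T : WTree N} {a u v : Fin N} (hu : T.Below a u) (hv : T.Below a v) :
    T.Below u v ∨ T.Below v u := by
  obtain ⟨i, rfl⟩ := hu
  obtain ⟨j, rfl⟩ := hv
  rcases le_total i j with h | h
  · left
    exact ⟨j - i, by rw [← Function.iterate_add_apply, Nat.sub_add_cancel h]⟩
  · right
    exact ⟨i - j, by rw [← Function.iterate_add_apply, Nat.sub_add_cancel h]⟩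

theorem Below.trans {T : WTree N} {a u v : Fin N} (hu : T.Below a u) (hv : T.Below u v) :
    T.Below a v := by
  obtain ⟨i, rfl⟩ := hu
  obtain ⟨j, rfl⟩ := hv
  exact ⟨j + i, by rw [Function.iterate_add_apply]⟩

theorem dist_uncross {a a' b b' : T.Leaf} {u : Fin N} (hu : u ≠ T.root) (hw : 0 < T.weight u)
    (ha : T.Below a u) (hb : ¬ T.Below b u) (ha' : ¬ T.Below a' u) (hb' : T.Below b' u) :
    T.dist a b' + T.dist a' b < T.dist a b + T.dist a' b' := by
  classical
  unfold dist
  rw [← Finset.sum_add_distrib, ← Finset.sum_add_distrib]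
  refine Finset.sum_lt_sum (fun v _ => ?_) ⟨u, Finset.mem_univ u, ?_⟩
  · by_cases hv : v = T.root
    · simp [hv]
    · have h1 : T.Below a v → T.Below v u ∨ T.Below u v := fun h => h.total ha
      have h2 : T.Below b' v → T.Below v u ∨ T.Below u v := fun h => h.total hb'
      have h3 : T.Below v u → ¬ T.Below b v := fun h h' => hb (h'.trans h)
      have h4 : T.Below v u → ¬ T.Below a' v := fun h h' => ha' (h'.trans h)
      have h5 : T.Below u v → T.Below a v := fun h => ha.trans h
      have h6 : T.Below u v → T.Below b' v := fun h => hb'.trans h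
      by_cases p1 : T.Below a v <;> by_cases p2 : T.Below b v <;>
        by_cases p3 : T.Below a' v <;> by_cases p4 : T.Below b' v <;>
        simp [p1, p2, p3, p4, hv] <;> tauto
  · simp [hu, ha, hb, ha', hb', hw]

open Classical in
/-- Number of servers below the node `u`. -/
noncomputable def count {k : ℕ} (A : Config T.Leaf k) (u : Fin N) : ℕ :=
  (Finset.univ.filter fun j => T.Below (A j) u).card

theorem configDist_le {k : ℕ} (A B : Config T.Leaf k) :
    (configDist T.dist A B : ℤ) ≤ ∑ u, if u ≠ T.root then
      (T.weight u : ℤ) * |(T.count A u : ℤ) - T.count B u| else 0 := by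
  classical
  obtain ⟨σ, -, hσ⟩ := Finset.exists_mem_eq_inf' ⟨(1 : Equiv.Perm (Fin k)), Finset.mem_univ _⟩
    (fun σ : Equiv.Perm (Fin k) => ∑ j, T.dist (A j) (B (σ j)))
  have hmin : ∀ σ' : Equiv.Perm (Fin k), ∑ j, T.dist (A j) (B (σ j)) ≤
      ∑ j, T.dist (A j) (B (σ' j)) := fun σ' => by
    rw [← hσ]
    exact Finset.inf'_le (f := fun σ : Equiv.Perm (Fin k) => ∑ j, T.dist (A j) (B (σ j)))
      (Finset.mem_univ σ')
  have hone : ∀ u, u ≠ T.root → 0 < T.weight u →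
      ∀ j j', T.Below (A j) u → ¬ T.Below (B (σ j)) u → ¬ T.Below (A j') u →
        ¬ T.Below (B (σ j')) u := by
    intro u hu hw j j' h1 h2 h3 h4
    have hne : j' ≠ j := by rintro rfl; exact h3 h1
    have hlt := T.dist_uncross hu hw h1 h2 h3 h4
    have hle := hmin (σ * Equiv.swap j j')
    have hj : j ∈ Finset.univ := Finset.mem_univ j
    have hj' : j' ∈ Finset.univ.erase j := by simp [hne]
    rw [← Finset.add_sum_erase _ _ hj, ← Finset.add_sum_erase _ _ hj',
      ← Finset.add_sum_erase _ (fun x => T.dist (A x) (B ((σ * Equiv.swap j j') x))) hj,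
      ← Finset.add_sum_erase _ (fun x => T.dist (A x) (B ((σ * Equiv.swap j j') x))) hj'] at hle
    have hrest : ∑ x ∈ (Finset.univ.erase j).erase j',
        T.dist (A x) (B ((σ * Equiv.swap j j') x)) =
        ∑ x ∈ (Finset.univ.erase j).erase j', T.dist (A x) (B (σ x)) := by
      refine Finset.sum_congr rfl fun x hx => ?_
      have h5 := Finset.mem_erase.1 hx
      have h6 := Finset.mem_erase.1 h5.2
      rw [Equiv.Perm.mul_apply, Equiv.swap_apply_of_ne_of_ne h6.1 h5.1]
    rw [hrest] at hle
    simp only [Equiv.Perm.mul_apply, Equiv.swap_apply_left, Equiv.swap_apply_right] at hle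
    omega
  have hcost : (configDist T.dist A B : ℤ) = ∑ u, if u ≠ T.root then
      (T.weight u : ℤ) * ∑ j, |(if T.Below (A j) u then 1 else 0) -
        (if T.Below (B (σ j)) u then (1 : ℤ) else 0)| else 0 := by
    rw [configDist, hσ]
    unfold dist
    rw [Finset.sum_comm]
    push_cast
    refine Finset.sum_congr rfl fun u _ => ?_
    by_cases hu : u = T.root
    · simp [hu]
    · rw [if_pos hu, Finset.mul_sum]
      refine Finset.sum_congr rfl fun j _ => ?_
      by_cases h1 : T.Below (A j) u <;> by_cases h2 : T.Below (B (σ j)) u <;> simp [h1, h2, hu]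
  rw [hcost]
  refine Finset.sum_le_sum fun u _ => ?_
  by_cases hu : u = T.root
  · simp [hu]
  rw [if_pos hu, if_pos hu]
  rcases Nat.eq_zero_or_pos (T.weight u) with hw | hw
  · simp [hw]
  refine mul_le_mul_of_nonneg_left ?_ (Int.natCast_nonneg _)
  have hA : (T.count A u : ℤ) = ∑ j, if T.Below (A j) u then 1 else 0 := by
    simp [count]
  have hB : (T.count B u : ℤ) = ∑ j, if T.Below (B (σ j)) u then 1 else 0 := by
    rw [Equiv.sum_comp σ (fun j => if T.Below (B j) u then (1 : ℤ) else 0)]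
    simp [count]
  rw [hA, hB, ← Finset.sum_sub_distrib]
  by_cases hex : ∃ j, T.Below (A j) u ∧ ¬ T.Below (B (σ j)) u
  · obtain ⟨j, h1, h2⟩ := hex
    refine le_trans (le_of_eq (Finset.sum_congr rfl fun j' _ => ?_)) (le_abs_self _)
    have := hone u hu hw j j' h1 h2
    by_cases h3 : T.Below (A j') u <;> by_cases h4 : T.Below (B (σ j')) u <;> simp_all
  · refine le_trans (le_of_eq ?_) (neg_le_abs _)
    rw [← Finset.sum_neg_distrib]
    refine Finset.sum_congr rfl fun j' _ => ?_
    have := not_exists.1 hex j'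
    by_cases h3 : T.Below (A j') u <;> by_cases h4 : T.Below (B (σ j')) u <;> simp_all

end WTree

/-! ### Rooted trees on an initial segment of the natural numbers -/

structure IsTree (n r : ℕ) (g : ℕ → ℕ) : Prop where
  root_lt : r < n
  map_root : g r = r
  map_lt : ∀ v < n, g v < n
  reaches : ∀ v < n, ∃ i, g^[i] v = r

def kids (n r : ℕ) (g : ℕ → ℕ) (p : ℕ) : Finset ℕ :=
  (Finset.range n).filter fun v => v ≠ r ∧ g v = p

theorem mem_kids {n r : ℕ} {g : ℕ → ℕ} {p v : ℕ} :
    v ∈ kids n r g p ↔ v < n ∧ v ≠ r ∧ g v = p := by simp [kids]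

noncomputable def level (r : ℕ) (g : ℕ → ℕ) (v : ℕ) : ℕ := sInf {i | g^[i] v = r}

open Classical in
/-- The mass in the subtree of `p`. -/
noncomputable def mass {M : Type*} [AddCommMonoid M] (n : ℕ) (g : ℕ → ℕ) (y : ℕ → M) (p : ℕ) : M :=
  ∑ u ∈ Finset.range n, if ∃ i, g^[i] u = p then y u else 0

theorem level_root (r : ℕ) (g : ℕ → ℕ) : level r g r = 0 := Nat.sInf_eq_zero.2 (Or.inl rfl)

namespace IsTree

variable {n r : ℕ} {g : ℕ → ℕ} (hg : IsTree n r g)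

include hg

theorem iterate_root (i : ℕ) : g^[i] r = r := Function.iterate_fixed hg.map_root i

theorem iterate_lt {v : ℕ} (hv : v < n) (i : ℕ) : g^[i] v < n := by
  induction i with
  | zero => exact hv
  | succ i ih => rw [Function.iterate_succ_apply']; exact hg.map_lt _ ih

theorem iterate_level {v : ℕ} (hv : v < n) : g^[level r g v] v = r :=
  Nat.sInf_mem (s := {i | g^[i] v = r}) (hg.reaches v hv)

theorem level_succ {v : ℕ} (hv : v < n) (hr : v ≠ r) : level r g v = level r g (g v) + 1 := by
  apply le_antisymm
  · refine Nat.sInf_le ?_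
    have := hg.iterate_level (hg.map_lt v hv)
    rwa [← Function.iterate_succ_apply] at this
  · have h := hg.iterate_level hv
    cases hl : level r g v with
    | zero => rw [hl] at h; exact absurd h hr
    | succ l =>
      rw [hl, Function.iterate_succ_apply] at h
      exact Nat.succ_le_succ (Nat.sInf_le h)

theorem level_iterate {v : ℕ} (hv : v < n) (i : ℕ) : level r g (g^[i] v) = level r g v - i := by
  induction i with
  | zero => rfl
  | succ i ih =>
    rw [Function.iterate_succ_apply']
    by_cases h : g^[i] v = r
    · rw [h, level_root r g] at ih
      rw [h, hg.map_root, level_root r g]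
      omega
    · have := hg.level_succ (hg.iterate_lt hv i) h
      omega

theorem level_pos {v : ℕ} (hv : v < n) (hr : v ≠ r) : 0 < level r g v := by
  rw [hg.level_succ hv hr]
  exact Nat.succ_pos _

theorem level_lt {v : ℕ} (hv : v < n) : level r g v < n := by
  have : (Finset.range (level r g v + 1)).card ≤ (Finset.range n).card := by
    refine Finset.card_le_card_of_injOn (fun i => g^[i] v)
      (fun i _ => Finset.mem_coe.2 (Finset.mem_range.2 (hg.iterate_lt hv i))) ?_
    intro i hi j hj hij
    have hi := Finset.mem_range.1 (Finset.mem_coe.1 hi)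
    have hj := Finset.mem_range.1 (Finset.mem_coe.1 hj)
    have := congrArg (level r g) hij
    simp only [hg.level_iterate hv] at this
    omega
  simpa using this

theorem iterate_eq_root {v i : ℕ} (hv : v < n) (hi : level r g v ≤ i) : g^[i] v = r := by
  obtain ⟨j, rfl⟩ := Nat.exists_eq_add_of_le' hi
  rw [Function.iterate_add_apply, hg.iterate_level hv, hg.iterate_root]

theorem below_iff {u c : ℕ} (hu : u < n) (hc : c ≠ r) :
    (∃ i, g^[i] u = c) ↔ g^[level r g u - level r g c] u = c := by
  refine ⟨?_, fun h => ⟨_, h⟩⟩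
  rintro ⟨i, rfl⟩
  have h := hg.level_iterate hu i
  have h' := hg.level_pos (hg.iterate_lt hu i) hc
  congr 1
  rw [h] at h' ⊢
  omega

theorem level_kid {p c : ℕ} (hc : c ∈ kids n r g p) : level r g c = level r g p + 1 := by
  obtain ⟨h1, h2, h3⟩ := mem_kids.1 hc
  rw [hg.level_succ h1 h2, h3]

theorem not_mem_kids_self {p : ℕ} : p ∉ kids n r g p := fun h => by
  have := hg.level_kid h
  omega

theorem mass_root {M : Type*} [AddCommMonoid M] (y : ℕ → M) :
    mass n g y r = ∑ u ∈ Finset.range n, y u :=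
  Finset.sum_congr rfl fun u hu => if_pos (hg.reaches u (Finset.mem_range.1 hu))

theorem mass_eq {M : Type*} [AddCommMonoid M] (y : ℕ → M) {p : ℕ} (hp : p < n) :
    mass n g y p = y p + ∑ c ∈ kids n r g p, mass n g y c := by
  classical
  unfold mass
  rw [Finset.sum_comm]
  have hy : y p = ∑ u ∈ Finset.range n, if u = p then y u else 0 := by simp [hp]
  rw [hy, ← Finset.sum_add_distrib]
  refine Finset.sum_congr rfl fun u hu => ?_
  have hu := Finset.mem_range.1 hu
  by_cases hup : u = p
  · subst hup
    rw [if_pos ⟨0, rfl⟩, if_pos rfl, Finset.sum_eq_zero, add_zero]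
    intro c hc
    refine if_neg ?_
    rintro ⟨i, hi⟩
    have h1 := hg.level_iterate hu i
    rw [hi, hg.level_kid hc] at h1
    omega
  · rw [if_neg hup, zero_add]
    by_cases h : ∃ i, g^[i] u = p
    · rw [if_pos h]
      have hspec := Nat.find_spec h
      have hmin := fun i => Nat.find_min (H := h) (m := i)
      obtain ⟨i, hi⟩ : ∃ i, Nat.find h = i + 1 := by
        refine Nat.exists_eq_succ_of_ne_zero fun h0 => ?_
        rw [h0] at hspec
        exact hup hspec
      rw [hi, Function.iterate_succ_apply'] at hspec
      have hc : g^[i] u ∈ kids n r g p := by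
        refine mem_kids.2 ⟨hg.iterate_lt hu i, fun hr => ?_, hspec⟩
        rw [hr, hg.map_root] at hspec
        exact hmin i (by omega) (hr.trans hspec)
      rw [Finset.sum_eq_single_of_mem _ hc, if_pos ⟨i, rfl⟩]
      intro c hc' hne
      refine if_neg fun hb => hne ?_
      obtain ⟨-, hc2, -⟩ := mem_kids.1 hc'
      obtain ⟨-, hc3, -⟩ := mem_kids.1 hc
      rw [hg.below_iff hu hc2, hg.level_kid hc', ← hg.level_kid hc] at hb
      rw [← hb, ← (hg.below_iff hu hc3).1 ⟨i, rfl⟩, hg.level_iterate hu]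
      congr 1
      rw [hg.level_iterate hu]
      omega
    · rw [if_neg h]
      refine (Finset.sum_eq_zero fun c hc => if_neg ?_).symm
      rintro ⟨i, hi⟩
      refine h ⟨i + 1, ?_⟩
      rw [Function.iterate_succ_apply', hi, (mem_kids.1 hc).2.2]

theorem eq_mass {M : Type*} [AddCommMonoid M] {y φ : ℕ → M}
    (h : ∀ p < n, φ p = y p + ∑ c ∈ kids n r g p, φ c) {p : ℕ} (hp : p < n) :
    φ p = mass n g y p := by
  have key : ∀ d p, p < n → n ≤ level r g p + d → φ p = mass n g y p := by
    intro d
    induction d with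
    | zero => intro p hp hd; exact absurd (hg.level_lt hp) (by omega)
    | succ d ih =>
      intro p hp hd
      rw [h p hp, hg.mass_eq y hp]
      refine congrArg _ (Finset.sum_congr rfl fun c hc => ih c (mem_kids.1 hc).1 ?_)
      rw [hg.level_kid hc]
      omega
  exact key n p hp (by omega)

theorem sum_parent_mul (f Δ : ℕ → ℝ) :
    ∑ u ∈ (Finset.range n).erase r, f (g u) * Δ u =
      ∑ p ∈ Finset.range n, f p * ∑ c ∈ kids n r g p, Δ c := by
  rw [← Finset.sum_fiberwise_of_maps_to (s := (Finset.range n).erase r) (t := Finset.range n)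
    (g := g) (fun u hu => Finset.mem_range.2
      (hg.map_lt u (Finset.mem_range.1 (Finset.mem_erase.1 hu).2)))]
  refine Finset.sum_congr rfl fun p _ => ?_
  have h1 : ((Finset.range n).erase r).filter (fun u => g u = p) = kids n r g p := by
    ext u
    simp only [Finset.mem_filter, Finset.mem_erase, Finset.mem_range, mem_kids]
    tauto
  rw [h1, Finset.mul_sum]
  exact Finset.sum_congr rfl fun c hc => by rw [(mem_kids.1 hc).2.2]

/-- If the changes `Δ` of the children exceed those of the parent by at most twice the changes `δ`
and the edge weights `f ∘ g` decrease geometrically, then the weighted sum of `Δ` is at most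
a constant times that of `δ`. -/
theorem sum_change_le {f Δ δ : ℕ → ℝ} (hf : ∀ p < n, 0 ≤ f p)
    (hf2 : ∀ p < n, p ≠ r → 2 * f p ≤ f (g p)) (hΔ : ∀ p < n, 0 ≤ Δ p) (hr : Δ r = 0)
    (h : ∀ p < n, ∑ c ∈ kids n r g p, Δ c ≤ Δ p + 2 * ∑ c ∈ kids n r g p, δ c) :
    ∑ u ∈ (Finset.range n).erase r, f (g u) * Δ u ≤
      4 * ∑ u ∈ (Finset.range n).erase r, f (g u) * δ u := by
  have h1 : ∑ u ∈ (Finset.range n).erase r, f (g u) * Δ u ≤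
      ∑ p ∈ Finset.range n, (f p * Δ p + 2 * (f p * ∑ c ∈ kids n r g p, δ c)) := by
    rw [hg.sum_parent_mul]
    refine Finset.sum_le_sum fun p hp => ?_
    have hp := Finset.mem_range.1 hp
    have := mul_le_mul_of_nonneg_left (h p hp) (hf p hp)
    linarith
  have h2 : ∑ p ∈ Finset.range n, f p * Δ p ≤
      (1 / 2) * ∑ u ∈ (Finset.range n).erase r, f (g u) * Δ u := by
    rw [← Finset.add_sum_erase _ _ (Finset.mem_range.2 hg.root_lt), hr, mul_zero, zero_add,
      Finset.mul_sum]
    refine Finset.sum_le_sum fun p hp => ?_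
    obtain ⟨hpr, hp⟩ := Finset.mem_erase.1 hp
    have hp := Finset.mem_range.1 hp
    have := mul_le_mul_of_nonneg_right (hf2 p hp hpr) (hΔ p hp)
    linarith
  rw [Finset.sum_add_distrib, ← Finset.mul_sum, ← hg.sum_parent_mul f δ] at h1
  linarith

end IsTree

/-! ### Grouping the children of the root by weight -/

/-- The tree `g` on `2 * N` nodes arises from `T` by grouping the children of the root into classes
of comparable weight. The class with heaviest element `h` has the new node `N + h`; the node of a
class hangs below the node of the previous class, and unused new nodes hang below the root. -/
structure Refines {N : ℕ} (T : WTree N) (g : ℕ → ℕ) : Prop where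
  map_root : g T.root = T.root
  inner : ∀ v : Fin N, v ≠ T.root → T.parent v ≠ T.root → g v = T.parent v
  top : ∀ v : Fin N, T.IsChild v T.root → ∃ h : Fin N, T.IsChild h T.root ∧ g v = N + h ∧
    g h = N + h ∧ T.weight v ≤ T.weight h ∧ T.weight h ≤ 2 * T.weight v
  virt : ∀ h : Fin N, g (N + h) = T.root ∨ ∃ h' : Fin N, T.IsChild h' T.root ∧
    g (N + h) = N + h' ∧ g h' = N + h' ∧ 2 * T.weight h < T.weight h'
  uniq : ∀ h h' : Fin N, g h = N + h → g h' = N + h' → g (N + h) = g (N + h') → h = h'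

/-- A measure on the leaves, as a function on the numbers of the nodes. -/
noncomputable def leafMass {M : Type*} [AddCommMonoid M] {N : ℕ} (T : WTree N) (x : T.Leaf → M)
    (j : ℕ) : M :=
  ∑ p : T.Leaf, if (p.1 : ℕ) = j then x p else 0

section LeafMass

variable {M : Type*} [AddCommMonoid M] {N : ℕ} {T : WTree N}

theorem leafMass_leaf (x : T.Leaf → M) (a : T.Leaf) : leafMass T x a.1 = x a := by
  unfold leafMass
  rw [Finset.sum_eq_single a]
  · simp
  · intro b _ hb
    exact if_neg fun h => hb (Subtype.ext (Fin.ext h))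
  · simp

theorem leafMass_eq_zero (x : T.Leaf → M) {j : ℕ} (h : ∀ a : T.Leaf, (a.1 : ℕ) ≠ j) :
    leafMass T x j = 0 :=
  Finset.sum_eq_zero fun a _ => if_neg (h a)

theorem sum_leafMass (x : T.Leaf → M) {n : ℕ} (hn : N ≤ n) :
    ∑ j ∈ Finset.range n, leafMass T x j = ∑ a, x a := by
  unfold leafMass
  rw [Finset.sum_comm]
  refine Finset.sum_congr rfl fun a _ => ?_
  rw [Finset.sum_ite_eq, if_pos (Finset.mem_range.2 (a.1.2.trans_le hn))]

end LeafMass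

namespace WTree

variable {N : ℕ} (T : WTree N)

theorem iterate_root (i : ℕ) : T.parent^[i] T.root = T.root :=
  Function.iterate_fixed T.parent_root i

end WTree

namespace Refines

variable {N : ℕ} {T : WTree N} {g : ℕ → ℕ} (hR : Refines T g)

theorem val_ne (v : Fin N) (h : Fin N) : (v : ℕ) ≠ N + h := by omega

include hR

theorem used_of_kid {h : Fin N} {c : ℕ} (hc : c ∈ kids (2 * N) T.root g (N + h)) :
    g h = N + h := by
  obtain ⟨h1, h2, h3⟩ := mem_kids.1 hc
  rcases lt_or_ge c N with hcN | hcN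
  · have hcr : (⟨c, hcN⟩ : Fin N) ≠ T.root := fun h => h2 (congrArg Fin.val h)
    by_cases hp : T.parent ⟨c, hcN⟩ = T.root
    · obtain ⟨h', -, h4, h5, -⟩ := hR.top ⟨c, hcN⟩ ⟨hcr, hp⟩
      have : h' = h := Fin.ext (by simp only at h4; omega)
      rwa [this] at h5
    · have := hR.inner ⟨c, hcN⟩ hcr hp
      simp only at this
      omega
  · rcases hR.virt ⟨c - N, by omega⟩ with h4 | ⟨h', -, h4, h5, -⟩
    · simp only [Nat.add_sub_cancel' hcN] at h4
      omega
    · simp only [Nat.add_sub_cancel' hcN] at h4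
      have : h' = h := Fin.ext (by omega)
      rwa [this] at h5

theorem isTree : IsTree (2 * N) T.root g := by
  have hvirt : ∀ d (h : Fin N), ∑ u, T.weight u ≤ T.weight h + d → ∃ i, g^[i] (N + h) = T.root := by
    intro d
    induction d with
    | zero =>
      intro h hd
      rcases hR.virt h with h1 | ⟨h', -, -, -, h1⟩
      · exact ⟨1, h1⟩
      · have := Finset.single_le_sum (f := T.weight) (fun _ _ => Nat.zero_le _)
          (Finset.mem_univ h')
        omega
    | succ d ih =>
      intro h hd
      rcases hR.virt h with h1 | ⟨h', -, h1, -, h2⟩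
      · exact ⟨1, h1⟩
      · obtain ⟨i, hi⟩ := ih h' (by omega)
        exact ⟨i + 1, by rw [Function.iterate_succ_apply, h1, hi]⟩
  have hvirt' : ∀ h : Fin N, ∃ i, g^[i] (N + h) = T.root := fun h =>
    hvirt _ h (Nat.le_add_left _ _)
  have hreal : ∀ i (v : Fin N), T.parent^[i] v = T.root → ∃ i, g^[i] v = T.root := by
    intro i
    induction i with
    | zero => intro v hv; exact ⟨0, congrArg Fin.val hv⟩
    | succ i ih =>
      intro v hv
      by_cases hvr : v = T.root
      · exact ⟨0, congrArg Fin.val hvr⟩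
      by_cases hp : T.parent v = T.root
      · obtain ⟨h, -, h1, -⟩ := hR.top v ⟨hvr, hp⟩
        obtain ⟨j, hj⟩ := hvirt' h
        exact ⟨j + 1, by rw [Function.iterate_succ_apply, h1, hj]⟩
      · obtain ⟨j, hj⟩ := ih (T.parent v) (by rwa [← Function.iterate_succ_apply])
        exact ⟨j + 1, by rw [Function.iterate_succ_apply, hR.inner v hvr hp, hj]⟩
  refine ⟨by omega, hR.map_root, fun v hv => ?_, fun v hv => ?_⟩
  · rcases lt_or_ge v N with h | h
    · by_cases hvr : (⟨v, h⟩ : Fin N) = T.root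
      · have : v = T.root := congrArg Fin.val hvr
        rw [this, hR.map_root]
        omega
      by_cases hp : T.parent ⟨v, h⟩ = T.root
      · obtain ⟨h', -, h1, -⟩ := hR.top _ ⟨hvr, hp⟩
        simp only at h1
        omega
      · have := hR.inner _ hvr hp
        simp only at this
        omega
    · rcases hR.virt ⟨v - N, by omega⟩ with h1 | ⟨h', -, h1, -⟩ <;>
        simp only [Nat.add_sub_cancel' h] at h1 <;> omega
  · rcases lt_or_ge v N with h | h
    · obtain ⟨i, hi⟩ := T.reaches_root ⟨v, h⟩
      exact hreal i ⟨v, h⟩ hi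
    · have := hvirt' ⟨v - N, by omega⟩
      simpa only [Nat.add_sub_cancel' h] using this

theorem below_iff {w u : Fin N} (hu : u ≠ T.root) :
    (∃ i, g^[i] w = u) ↔ T.Below w u := by
  have hvirt : ∀ i (h : Fin N), g^[i] (N + h) ≠ u := by
    intro i
    induction i with
    | zero => intro h h1; exact val_ne u h h1.symm
    | succ i ih =>
      intro h h1
      rw [Function.iterate_succ_apply] at h1
      rcases hR.virt h with h2 | ⟨h', -, h2, -⟩
      · rw [h2, hR.isTree.iterate_root] at h1
        exact hu (Fin.ext h1.symm)
      · rw [h2] at h1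
        exact ih h' h1
  constructor
  · rintro ⟨i, hi⟩
    induction i generalizing w with
    | zero => exact ⟨0, Fin.ext hi⟩
    | succ i ih =>
      rw [Function.iterate_succ_apply] at hi
      by_cases hw : w = T.root
      · rw [hw, hR.map_root, hR.isTree.iterate_root] at hi
        exact absurd (Fin.ext hi.symm) hu
      by_cases hp : T.parent w = T.root
      · obtain ⟨h, -, h1, -⟩ := hR.top w ⟨hw, hp⟩
        rw [h1] at hi
        exact absurd hi (hvirt i h)
      · rw [hR.inner w hw hp] at hi
        obtain ⟨j, hj⟩ := ih hi
        exact ⟨j + 1, by rw [Function.iterate_succ_apply, hj]⟩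
  · rintro ⟨i, hi⟩
    induction i generalizing w with
    | zero => exact ⟨0, congrArg Fin.val hi⟩
    | succ i ih =>
      rw [Function.iterate_succ_apply] at hi
      have hp : T.parent w ≠ T.root := fun h => by
        rw [h, T.iterate_root] at hi
        exact hu hi.symm
      have hw : w ≠ T.root := fun h => hp (by rw [h, T.parent_root])
      obtain ⟨j, hj⟩ := ih hi
      exact ⟨j + 1, by rw [Function.iterate_succ_apply, hR.inner w hw hp, hj]⟩

open Classical in
theorem mass_leafMass {M : Type*} [AddCommMonoid M] (x : T.Leaf → M) {u : Fin N}
    (hu : u ≠ T.root) :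
    mass (2 * N) g (leafMass T x) u = ∑ a : T.Leaf, if T.Below a.1 u then x a else 0 := by
  have h1 : ∀ w ∈ Finset.range (2 * N), (if ∃ i, g^[i] w = u then leafMass T x w else 0) =
      ∑ a : T.Leaf, if (a.1 : ℕ) = w then (if ∃ i, g^[i] a.1 = u then x a else 0) else 0 := by
    intro w _
    unfold leafMass
    split_ifs with h
    · refine Finset.sum_congr rfl fun a _ => ?_
      split_ifs with h2 h3
      · rfl
      · rw [h2] at h3; exact absurd h h3
      · rfl
    · refine (Finset.sum_eq_zero fun a _ => ?_).symm
      split_ifs with h2 h3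
      · rw [h2] at h3; exact absurd h3 h
      · rfl
      · rfl
  unfold mass
  rw [Finset.sum_congr rfl h1, Finset.sum_comm]
  refine Finset.sum_congr rfl fun a _ => ?_
  have : (a.1 : ℕ) < 2 * N := by omega
  rw [Finset.sum_ite_eq, if_pos (Finset.mem_range.2 this)]
  simp only [hR.below_iff hu]

theorem kids_leaf {a : Fin N} (ha : T.IsLeaf a) (har : a ≠ T.root) :
    kids (2 * N) T.root g a = ∅ := by
  refine Finset.eq_empty_of_forall_notMem fun c hc => ?_
  obtain ⟨h1, h2, h3⟩ := mem_kids.1 hc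
  rcases lt_or_ge c N with hcN | hcN
  · have hcr : (⟨c, hcN⟩ : Fin N) ≠ T.root := fun h => h2 (congrArg Fin.val h)
    by_cases hp : T.parent ⟨c, hcN⟩ = T.root
    · obtain ⟨h', -, h4, -⟩ := hR.top ⟨c, hcN⟩ ⟨hcr, hp⟩
      simp only at h4
      omega
    · have := hR.inner ⟨c, hcN⟩ hcr hp
      simp only at this
      exact ha ⟨c, hcN⟩ ⟨hcr, Fin.ext (by omega)⟩
  · rcases hR.virt ⟨c - N, by omega⟩ with h4 | ⟨h', -, h4, -⟩ <;>
      simp only [Nat.add_sub_cancel' hcN] at h4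
    · exact har (Fin.ext (by omega))
    · omega

/-- Twice the total weight at the root, and otherwise the common length of the edges below a node
(up to a factor of two in the case of the new nodes). -/
noncomputable def edgeScale (T : WTree N) (τ : ℝ) (p : ℕ) : ℝ :=
  if h : p < N then
    if p = T.root then 2 * ∑ u, (T.weight u : ℝ) else (T.weight ⟨p, h⟩ : ℝ) / τ
  else if h : p - N < N then (T.weight ⟨p - N, h⟩ : ℝ) else 0

omit hR in
theorem edgeScale_virt (T : WTree N) (τ : ℝ) (h : Fin N) : edgeScale T τ (N + h) = T.weight h := by
  simp [edgeScale]

omit hR in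
theorem edgeScale_inner (T : WTree N) (τ : ℝ) {u : Fin N} (hu : u ≠ T.root) :
    edgeScale T τ u = T.weight u / τ := by
  simp [edgeScale, Fin.val_inj, hu]

omit hR in
theorem edgeScale_nonneg (T : WTree N) {τ : ℝ} (hτ : 0 < τ) (p : ℕ) : 0 ≤ edgeScale T τ p := by
  unfold edgeScale
  split_ifs <;> positivity

theorem weight_le_edgeScale {τ : ℝ} (hτ : 0 < τ) (hT : T.IsHST τ) {u : Fin N}
    (hu : u ≠ T.root) :
    (T.weight u : ℝ) ≤ edgeScale T τ (g u) ∧ edgeScale T τ (g u) ≤ 2 * T.weight u := by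
  by_cases hp : T.parent u = T.root
  · obtain ⟨h, -, h1, -, h2, h3⟩ := hR.top u ⟨hu, hp⟩
    rw [h1, edgeScale_virt]
    exact ⟨by exact_mod_cast h2, by exact_mod_cast h3⟩
  · rw [hR.inner u hu hp, edgeScale_inner T τ hp, hT.ratio _ hp u ⟨hu, rfl⟩,
      mul_div_cancel_left₀ _ hτ.ne']
    have : (0 : ℝ) ≤ T.weight u := Nat.cast_nonneg _
    exact ⟨le_rfl, by linarith⟩

theorem two_mul_edgeScale_le {τ : ℝ} (hτ : 2 ≤ τ) (hT : T.IsHST τ) {p : ℕ} (hp : p < 2 * N)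
    (hpr : p ≠ T.root) : 2 * edgeScale T τ p ≤ edgeScale T τ (g p) := by
  have hτ0 : 0 < τ := by linarith
  rcases lt_or_ge p N with h | h
  · have hpr' : (⟨p, h⟩ : Fin N) ≠ T.root := fun h => hpr (congrArg Fin.val h)
    refine le_trans ?_ (hR.weight_le_edgeScale hτ0 hT hpr').1
    have h1 := edgeScale_inner T τ hpr'
    simp only at h1
    rw [h1, mul_div_assoc', div_le_iff₀ hτ0, mul_comm]
    exact mul_le_mul_of_nonneg_left hτ (Nat.cast_nonneg _)
  · obtain ⟨q, hq⟩ : ∃ q : Fin N, p = N + q := ⟨⟨p - N, by omega⟩, by simp only; omega⟩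
    rw [hq, edgeScale_virt]
    rcases hR.virt q with h1 | ⟨h', -, h1, -, h2⟩
    · rw [h1, edgeScale, dif_pos T.root.2, if_pos rfl]
      have := Finset.single_le_sum (f := fun u => (T.weight u : ℝ)) (fun _ _ => Nat.cast_nonneg _)
        (Finset.mem_univ q)
      linarith
    · rw [h1, edgeScale_virt]
      exact_mod_cast h2.le

/-- In the measure `e` of total mass `0`, the new nodes have a weighted mass bounded by that of the
original ones. -/
theorem sum_edgeScale_mass_le {τ : ℝ} (hτ : 2 ≤ τ) (hT : T.IsHST τ) (hroot : ¬ T.IsLeaf T.root)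
    (e : T.Leaf → ℝ) (he : ∑ a, e a = 0) :
    ∑ u ∈ (Finset.range (2 * N)).erase T.root,
        edgeScale T τ (g u) * |mass (2 * N) g (leafMass T e) u| ≤
      3 * ∑ u ∈ (Finset.range (2 * N)).erase T.root,
        edgeScale T τ (g u) * (if u < N then |mass (2 * N) g (leafMass T e) u| else 0) := by
  have hg := hR.isTree
  have hτ0 : 0 < τ := by linarith
  set f := edgeScale T τ with hf
  have hf0 : ∀ p, 0 ≤ f p := edgeScale_nonneg T hτ0
  set ψ := mass (2 * N) g (leafMass T e) with hψ
  have hψr : ψ T.root = 0 := by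
    rw [hψ, hg.mass_root, sum_leafMass e (by omega), he]
  set X := ∑ u ∈ (Finset.range (2 * N)).erase T.root, f (g u) * (if u < N then 0 else |ψ u|)
    with hX
  set Y := ∑ u ∈ (Finset.range (2 * N)).erase T.root, f (g u) * (if u < N then |ψ u| else 0)
    with hY
  have hsplit : ∑ u ∈ (Finset.range (2 * N)).erase T.root, f (g u) * |ψ u| = X + Y := by
    rw [hX, hY, ← Finset.sum_add_distrib]
    refine Finset.sum_congr rfl fun u _ => ?_
    split_ifs <;> ring
  have hzero : ∀ h : Fin N, g h ≠ N + h → ψ (N + h) = 0 := by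
    intro h hh
    rw [hψ, hg.mass_eq _ (by omega), leafMass_eq_zero _ (fun a => val_ne a.1 h), zero_add]
    refine Finset.sum_eq_zero fun c hc => absurd (hR.used_of_kid hc) hh
  have hone : ∀ p < 2 * N, (p = T.root ∨ N ≤ p) →
      ∑ c ∈ kids (2 * N) T.root g p, (if c < N then 0 else |ψ c|) ≤
        |ψ p| + ∑ c ∈ kids (2 * N) T.root g p, (if c < N then |ψ c| else 0) := by
    intro p hp hp'
    have hp0 : leafMass T e p = 0 := by
      refine leafMass_eq_zero e fun a ha => ?_
      rcases hp' with h | h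
      · exact hroot (by have := a.2; rwa [Fin.ext (ha.trans h)] at this)
      · omega
    have h1 : ψ p = ∑ c ∈ kids (2 * N) T.root g p, ψ c := by
      rw [hψ, hg.mass_eq _ hp, hp0, zero_add]
    have h2 : ∑ c ∈ kids (2 * N) T.root g p, (if c < N then 0 else |ψ c|) =
        |∑ c ∈ kids (2 * N) T.root g p, (if c < N then 0 else ψ c)| := by
      by_cases hex : ∃ c ∈ kids (2 * N) T.root g p, (if c < N then 0 else ψ c) ≠ 0
      · obtain ⟨c, hc, hne⟩ := hex
        have hcN : N ≤ c := by
          by_contra h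
          exact hne (if_pos (not_le.1 h))
        have huniq : ∀ c' ∈ kids (2 * N) T.root g p, c' ≠ c → (if c' < N then 0 else ψ c') = 0 := by
          intro c' hc' hne'
          by_contra h
          have hcN' : N ≤ c' := by
            by_contra h'
            exact h (if_pos (not_le.1 h'))
          rw [if_neg (by omega)] at h hne
          obtain ⟨k1, k2, k3⟩ := mem_kids.1 hc
          obtain ⟨k1', k2', k3'⟩ := mem_kids.1 hc'
          obtain ⟨q, rfl⟩ : ∃ q : Fin N, c = N + q := ⟨⟨c - N, by omega⟩, by simp only; omega⟩
          obtain ⟨q', rfl⟩ : ∃ q : Fin N, c' = N + q := ⟨⟨c' - N, by omega⟩, by simp only; omega⟩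
          have u1 : g q = N + q := by
            by_contra hh
            exact hne (hzero q hh)
          have u2 : g q' = N + q' := by
            by_contra hh
            exact h (hzero q' hh)
          have := hR.uniq q q' u1 u2 (k3.trans k3'.symm)
          exact hne' (by rw [this])
        rw [Finset.sum_eq_single_of_mem c hc huniq, Finset.sum_eq_single_of_mem c hc]
        · rw [if_neg (by omega), if_neg (by omega)]
        · intro c' hc' hne'
          have := huniq c' hc' hne'
          split_ifs at this ⊢ with h3
          · rfl
          · rw [this, abs_zero]
      · push Not at hex
        rw [Finset.sum_eq_zero hex, abs_zero]
        refine Finset.sum_eq_zero fun c hc => ?_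
        have := hex c hc
        split_ifs at this ⊢ with h3
        · rfl
        · rw [this, abs_zero]
    have h3 : ∑ c ∈ kids (2 * N) T.root g p, (if c < N then 0 else ψ c) =
        ψ p - ∑ c ∈ kids (2 * N) T.root g p, (if c < N then ψ c else 0) := by
      rw [h1, ← Finset.sum_sub_distrib]
      refine Finset.sum_congr rfl fun c _ => ?_
      split_ifs <;> ring
    rw [h2, h3]
    refine (abs_sub _ _).trans (add_le_add_right ((Finset.abs_sum_le_sum_abs _ _).trans
      (le_of_eq (Finset.sum_congr rfl fun c _ => ?_))) _)
    split_ifs <;> simp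
  have hXle : X ≤ ∑ p ∈ (Finset.range (2 * N)).erase T.root,
      (f p * (if p < N then 0 else |ψ p|)) + Y := by
    have h1 : X ≤ ∑ p ∈ Finset.range (2 * N), (f p * (if p < N then 0 else |ψ p|) +
        f p * ∑ c ∈ kids (2 * N) T.root g p, (if c < N then |ψ c| else 0)) := by
      rw [hX, hg.sum_parent_mul f]
      refine Finset.sum_le_sum fun p hp => ?_
      rw [← mul_add]
      refine mul_le_mul_of_nonneg_left ?_ (hf0 p)
      by_cases hpr : p = T.root ∨ N ≤ p
      · refine (hone p (Finset.mem_range.1 hp) hpr).trans (add_le_add_left ?_ _)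
        rcases hpr with h | h
        · simp [h, hψr]
        · rw [if_neg (by omega)]
      · push Not at hpr
        rw [Finset.sum_eq_zero]
        · refine add_nonneg ?_ (Finset.sum_nonneg fun _ _ => ?_) <;> split_ifs <;> positivity
        · intro c hc
          refine if_pos ?_
          by_contra hcN
          obtain ⟨k1, k2, k3⟩ := mem_kids.1 hc
          rcases hR.virt ⟨c - N, by omega⟩ with h4 | ⟨h', -, h4, -⟩ <;>
            simp only [Nat.add_sub_cancel' (not_lt.1 hcN)] at h4 <;> omega
    rw [Finset.sum_add_distrib, ← hg.sum_parent_mul f] at h1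
    refine h1.trans (add_le_add_left (le_of_eq ?_) _)
    rw [← Finset.add_sum_erase _ _ (Finset.mem_range.2 hg.root_lt), if_pos T.root.2, mul_zero,
      zero_add]
  have hhalf : ∑ p ∈ (Finset.range (2 * N)).erase T.root,
      (f p * (if p < N then 0 else |ψ p|)) ≤ 1 / 2 * X := by
    rw [hX, Finset.mul_sum]
    refine Finset.sum_le_sum fun p hp => ?_
    obtain ⟨h1, h2⟩ := Finset.mem_erase.1 hp
    have h3 := hR.two_mul_edgeScale_le hτ hT (Finset.mem_range.1 h2) h1
    have h4 : 0 ≤ (if p < N then 0 else |ψ p|) := by split_ifs <;> positivity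
    have := mul_le_mul_of_nonneg_right h3 h4
    linarith
  rw [hsplit]
  linarith

theorem sum_erase_root_eq (F : ℕ → ℝ) :
    ∑ u ∈ (Finset.range (2 * N)).erase T.root, (if u < N then F u else 0) =
      ∑ u : Fin N, if u ≠ T.root then F u else 0 := by
  have h0 : (T.root : ℕ) < 2 * N := hR.isTree.root_lt
  have h1 : ∑ u : Fin N, (if u ≠ T.root then F u else 0) =
      ∑ u ∈ Finset.range N, if u ≠ T.root then F u else 0 := by
    rw [← Fin.sum_univ_eq_sum_range (fun u => if u ≠ T.root then F u else 0)]
    refine Finset.sum_congr rfl fun u _ => ?_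
    simp only [ne_eq, Fin.ext_iff]
  rw [h1, ← Finset.sum_filter, ← Finset.sum_filter]
  refine Finset.sum_congr ?_ fun _ _ => rfl
  ext u
  simp only [Finset.mem_filter, Finset.mem_erase, Finset.mem_range]
  omega

open Classical in
theorem sum_weight_change_le {τ : ℝ} (hτ : 2 ≤ τ) (hT : T.IsHST τ)
    (hroot : ¬ T.IsLeaf T.root) (e : T.Leaf → ℝ) (he : ∑ a, e a = 0) {Δ : ℕ → ℝ}
    (hΔ : ∀ p, 0 ≤ Δ p) (hΔr : Δ T.root = 0)
    (h : ∀ p < 2 * N, ∑ c ∈ kids (2 * N) T.root g p, Δ c ≤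
      Δ p + 2 * ∑ c ∈ kids (2 * N) T.root g p, |mass (2 * N) g (leafMass T e) c|) :
    ∑ u : Fin N, (if u ≠ T.root then (T.weight u : ℝ) * Δ u else 0) ≤
      24 * ∑ u : Fin N, if u ≠ T.root then (T.weight u : ℝ) *
        |∑ a : T.Leaf, if T.Below a.1 u then e a else 0| else 0 := by
  have hτ0 : 0 < τ := by linarith
  have hf0 := edgeScale_nonneg T hτ0
  have h1 := hR.isTree.sum_change_le (f := edgeScale T τ) (fun p _ => hf0 p)
    (fun p hp hpr => hR.two_mul_edgeScale_le hτ hT hp hpr) (fun p _ => hΔ p) hΔr h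
  have h2 := hR.sum_edgeScale_mass_le hτ hT hroot e he
  have h3 : ∑ u : Fin N, (if u ≠ T.root then (T.weight u : ℝ) * Δ u else 0) ≤
      ∑ u ∈ (Finset.range (2 * N)).erase T.root, edgeScale T τ (g u) * Δ u := by
    calc _ ≤ ∑ u : Fin N, (if u ≠ T.root then edgeScale T τ (g u) * Δ u else 0) := by
          refine Finset.sum_le_sum fun u _ => ?_
          split_ifs with hu
          · exact mul_le_mul_of_nonneg_right (hR.weight_le_edgeScale hτ0 hT hu).1 (hΔ u)
          · exact le_rfl
      _ = ∑ u ∈ (Finset.range (2 * N)).erase T.root,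
            (if u < N then edgeScale T τ (g u) * Δ u else 0) :=
          (hR.sum_erase_root_eq fun u => edgeScale T τ (g u) * Δ u).symm
      _ ≤ _ := by
          refine Finset.sum_le_sum fun u _ => ?_
          split_ifs
          · exact le_rfl
          · exact mul_nonneg (hf0 _) (hΔ u)
  have h4 : ∑ u ∈ (Finset.range (2 * N)).erase T.root,
        edgeScale T τ (g u) * (if u < N then |mass (2 * N) g (leafMass T e) u| else 0) ≤
      2 * ∑ u : Fin N, if u ≠ T.root then (T.weight u : ℝ) *
        |∑ a : T.Leaf, if T.Below a.1 u then e a else 0| else 0 := by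
    simp only [mul_ite, mul_zero]
    rw [hR.sum_erase_root_eq fun u => edgeScale T τ (g u) * |mass (2 * N) g (leafMass T e) u|,
      Finset.mul_sum]
    refine Finset.sum_le_sum fun u _ => ?_
    split_ifs with hu
    · rw [hR.mass_leafMass e hu, ← mul_assoc]
      exact mul_le_mul_of_nonneg_right (hR.weight_le_edgeScale hτ0 hT hu).2 (abs_nonneg _)
    · simp
  linarith

end Refines

/-! ### Rebalancing the children of a node -/

/-- Any two of the first `m` values differ by at most `1`. -/
def Balanced (m : ℕ) (a : ℕ → ℤ) : Prop := ∀ i < m, ∀ i' < m, a i ≤ a i' + 1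

/-- Column `v` has been changed by at most `c` in total. -/
structure ColumnChange (m v c : ℕ) (S : ℤ) (A A' : ℕ → ℕ → ℤ) : Prop where
  other : ∀ i w, w ≠ v → A' i w = A i w
  balanced : Balanced m fun i => A' i v
  sum : ∑ i ∈ Finset.range m, A' i v = S
  change : ∑ i ∈ Finset.range m, |A' i v - A i v| ≤ c

theorem ColumnChange.step {m v c b : ℕ} {S σ : ℤ} {A A' : ℕ → ℕ → ℤ}
    (h : ColumnChange m v c S A A') (hb : b < m) (hσ : |σ| ≤ 1)
    (hbal : ∀ i < m, σ * A' b v ≤ σ * A' i v) {A'' : ℕ → ℕ → ℤ}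
    (hA : ∀ i w, A'' i w = if i = b ∧ w = v then A' b v + σ else A' i w) :
    ColumnChange m v (c + 1) (S + σ) A A'' := by
  have hv : ∀ i, A'' i v = A' i v + if i = b then σ else 0 := fun i => by
    rw [hA]
    by_cases hi : i = b <;> simp [hi]
  refine ⟨fun i w hw => ?_, fun i hi i' hi' => ?_, ?_, ?_⟩
  · rw [hA, if_neg (fun h' => hw h'.2), h.other i w hw]
  · have h1 := h.balanced i hi i' hi'
    have h2 := hbal i hi
    have h3 := hbal i' hi'
    have h4 := abs_le.1 hσ
    simp only at h1
    simp only [hv]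
    have h5 : σ = -1 ∨ σ = 0 ∨ σ = 1 := by omega
    rcases h5 with rfl | rfl | rfl <;> split_ifs <;> subst_vars <;> omega
  · simp only [hv, Finset.sum_add_distrib, h.sum, Finset.sum_ite_eq', Finset.mem_range, hb, if_true]
  · have h1 : ∀ i ∈ Finset.range m, |A'' i v - A i v| ≤ |A' i v - A i v| + if i = b then 1 else 0 := by
      intro i _
      rw [hv, add_sub_right_comm]
      refine (abs_add_le _ _).trans (add_le_add_right ?_ _)
      split_ifs
      · exact hσ
      · simp
    refine (Finset.sum_le_sum h1).trans ?_
    rw [Finset.sum_add_distrib, Finset.sum_ite_eq', if_pos (Finset.mem_range.2 hb)]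
    push_cast
    linarith [h.change]

/-- Matrices `A` whose columns in `K` are balanced with sums `t`, and whose row sums `S` over `K`
are being brought to the values `B` by exchanges, starting from the matrix `A₀`. -/
structure Exchange (m : ℕ) (K : Finset ℕ) (t B : ℕ → ℤ) (A₀ : ℕ → ℕ → ℤ) (E : ℤ)
    (A : ℕ → ℕ → ℤ) (S : ℕ → ℤ) : Prop where
  other : ∀ i, ∀ v, v ∉ K → A i v = A₀ i v
  balanced : ∀ v ∈ K, Balanced m fun i => A i v
  sum : ∀ v ∈ K, ∑ i ∈ Finset.range m, A i v = t v
  row : ∀ i < m, S i = ∑ v ∈ K, A i v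
  change : ∑ v ∈ K, ∑ i ∈ Finset.range m, |A i v - A₀ i v| +
    ∑ i ∈ Finset.range m, |S i - B i| ≤ E

theorem Exchange.step {m : ℕ} {K : Finset ℕ} {t B : ℕ → ℤ} {A₀ : ℕ → ℕ → ℤ} {E : ℤ}
    {A A' : ℕ → ℕ → ℤ} {S S' : ℕ → ℤ} (h : Exchange m K t B A₀ E A S) {a b v : ℕ} (ha : a < m)
    (hb : b < m) (hv : v ∈ K) (hSa : B a < S a) (hSb : S b < B b) (hA : A b v < A a v)
    (hA' : ∀ i w, A' i w = A i w + if w = v then (if i = b then 1 else 0) - (if i = a then 1 else 0)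
      else 0)
    (hS' : ∀ i, S' i = S i + ((if i = b then 1 else 0) - (if i = a then 1 else 0))) :
    Exchange m K t B A₀ E A' S' := by
  have hab : a ≠ b := by rintro rfl; omega
  have hbal := h.balanced v hv a ha b hb
  simp only at hbal
  refine ⟨fun i w hw => ?_, fun w hw i hi i' hi' => ?_, fun w hw => ?_, fun i hi => ?_, ?_⟩
  · rw [hA', if_neg (by rintro rfl; exact hw hv), add_zero, h.other i w hw]
  · simp only [hA']
    have h1 := h.balanced w hw i hi i' hi'
    simp only at h1
    by_cases hwv : w = v
    · subst hwv
      have h2 := h.balanced w hv i hi b hb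
      have h3 := h.balanced w hv a ha i' hi'
      simp only at h2 h3
      rw [if_pos rfl, if_pos rfl]
      split_ifs <;> subst_vars <;> omega
    · rw [if_neg hwv, if_neg hwv]
      omega
  · simp only [hA', Finset.sum_add_distrib, h.sum w hw]
    by_cases hwv : w = v
    · simp [hwv, ha, hb, Finset.sum_sub_distrib]
    · simp [hwv]
  · simp only [hS', hA', Finset.sum_add_distrib, h.row i hi, Finset.sum_ite_eq', hv, if_true]
  · have h1 : ∑ w ∈ K, ∑ i ∈ Finset.range m, |A' i w - A₀ i w| ≤
        ∑ w ∈ K, (∑ i ∈ Finset.range m, |A i w - A₀ i w| + if w = v then 2 else 0) := by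
      refine Finset.sum_le_sum fun w _ => ?_
      by_cases hwv : w = v
      · rw [if_pos hwv]
        have : (2 : ℤ) = ∑ i ∈ Finset.range m, ((if i = b then 1 else 0) + if i = a then 1 else 0) := by
          simp [Finset.sum_add_distrib, ha, hb]
        rw [this, ← Finset.sum_add_distrib]
        refine Finset.sum_le_sum fun i _ => ?_
        rw [hA', if_pos hwv, add_sub_right_comm]
        refine (abs_add_le _ _).trans (add_le_add_right ?_ _)
        split_ifs <;> simp
      · rw [if_neg hwv, add_zero]
        refine le_of_eq (Finset.sum_congr rfl fun i _ => ?_)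
        rw [hA', if_neg hwv, add_zero]
    have h2 : ∑ i ∈ Finset.range m, |S' i - B i| = ∑ i ∈ Finset.range m, (|S i - B i| -
        ((if i = b then 1 else 0) + if i = a then 1 else 0)) := by
      refine Finset.sum_congr rfl fun i _ => ?_
      rw [hS']
      by_cases hib : i = b
      · subst hib
        rw [if_pos rfl, if_neg (Ne.symm hab), abs_of_nonpos (by omega), abs_of_neg (by omega)]
        ring
      by_cases hia : i = a
      · subst hia
        rw [if_neg hib, if_pos rfl, abs_of_nonneg (by omega), abs_of_pos (by omega)]
        simp
        ring
      simp [hib, hia]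
    rw [Finset.sum_add_distrib, Finset.sum_ite_eq', if_pos hv] at h1
    rw [Finset.sum_sub_distrib, Finset.sum_add_distrib, Finset.sum_ite_eq', Finset.sum_ite_eq',
      if_pos (Finset.mem_range.2 hb), if_pos (Finset.mem_range.2 ha)] at h2
    linarith [h.change]

/-! The registers `0` to `6` hold the number of nodes, `k`, `m`, the root, the request, a flag, and
the number of nodes of the refined tree. Array `3` holds the numbers of servers, with a row for each
configuration and a column for each node; row `0` of the arrays `4`, `5`, `6`, `7` holds the parents,
the row sums over the children of a node, the masses below the nodes, and the levels. -/

section Programs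

open Prog

def colSum : Prog :=
  seq (setVar 14 (.const 0))
    (forTo 17 (.var 2) (setVar 14 (.add (.var 14) (.get 3 (.var 17) (.var 13)))))

def argMin : Prog :=
  seq (setVar 18 (.const 0)) (forTo 17 (.var 2)
    (ite (.le (.get 3 (.var 18) (.var 13)) (.get 3 (.var 17) (.var 13))) skip
      (setVar 18 (.var 17))))

def argMax : Prog :=
  seq (setVar 18 (.const 0)) (forTo 17 (.var 2)
    (ite (.le (.get 3 (.var 17) (.var 13)) (.get 3 (.var 18) (.var 13))) skip
      (setVar 18 (.var 17))))

def raiseColumn : Prog :=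
  seq (setVar 15 (.sub (.get 6 (.const 0) (.var 13)) (.var 14)))
    (forTo 16 (.var 15) (seq argMin
      (setArr 3 (.var 18) (.var 13) (.add (.get 3 (.var 18) (.var 13)) (.const 1)))))

def lowerColumn : Prog :=
  seq (setVar 15 (.sub (.var 14) (.get 6 (.const 0) (.var 13))))
    (forTo 16 (.var 15) (seq argMax
      (setArr 3 (.var 18) (.var 13) (.sub (.get 3 (.var 18) (.var 13)) (.const 1)))))

def fillColumn : Prog := seq colSum (seq raiseColumn lowerColumn)

def isKid : Test :=
  .and (.not (.eq (.var 13) (.var 3))) (.eq (.get 4 (.const 0) (.var 13)) (.var 12))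

def fillColumns : Prog := forTo 13 (.var 6) (ite isKid fillColumn skip)

def rowSums : Prog :=
  forTo 19 (.var 2) (seq (setArr 5 (.const 0) (.var 19) (.const 0))
    (forTo 13 (.var 6) (ite isKid
      (setArr 5 (.const 0) (.var 19)
        (.add (.get 5 (.const 0) (.var 19)) (.get 3 (.var 19) (.var 13)))) skip)))

def canExchange : Test :=
  .and isKid (.and (.not (.le (.get 5 (.const 0) (.var 19)) (.get 3 (.var 19) (.var 12))))
    (.and (.not (.le (.get 3 (.var 20) (.var 12)) (.get 5 (.const 0) (.var 20))))
      (.not (.le (.get 3 (.var 19) (.var 13)) (.get 3 (.var 20) (.var 13))))))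

def exchangeUnit : Prog :=
  seq (setArr 3 (.var 19) (.var 13) (.sub (.get 3 (.var 19) (.var 13)) (.const 1)))
    (seq (setArr 3 (.var 20) (.var 13) (.add (.get 3 (.var 20) (.var 13)) (.const 1)))
      (seq (setArr 5 (.const 0) (.var 19) (.sub (.get 5 (.const 0) (.var 19)) (.const 1)))
        (setArr 5 (.const 0) (.var 20) (.add (.get 5 (.const 0) (.var 20)) (.const 1)))))

def exchangeUnits : Prog :=
  forTo 19 (.var 2) (forTo 20 (.var 2) (forTo 13 (.var 6) (ite canExchange exchangeUnit skip)))

def rebalance : Prog := seq fillColumns (seq rowSums exchangeUnits)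

end Programs

section Specs

variable {X m v : ℕ} {s : Mem}

theorem colSum_runs (h2 : s.var 2 = m) (h13 : s.var 13 = v) (hm : m ≤ X) :
    Runs X colSum (fun s' => s'.var 14 = ∑ i ∈ Finset.range m, s.arr 3 i v) s := by
  refine Runs.seq (Runs.setVar ?_)
  refine Runs.forTo (fun i s' => s'.var 14 = ∑ i ∈ Finset.range i, s.arr 3 i v) m hm rfl
    (fun _ _ _ h => h) (fun i s' _ hf _ _ => ?_) ?_ (fun i s' hi hf h17 h => ?_)
    (fun s' _ _ h => h)
  · have := hf.var 2 rfl
    simp only [Expr.eval, this]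
    simp [Mem.setVar, h2]
  · simp [Expr.eval]
  · have h13' : s'.var 13 = v := (hf.var 13 rfl).trans h13
    have h3 : s'.arr 3 = s.arr 3 := hf.arr 3 rfl
    refine Runs.setVar ?_
    simp [Expr.eval, h, h17, h13', h3, Finset.sum_range_succ]

theorem argMin_runs (h2 : s.var 2 = m) (h13 : s.var 13 = v) (hm0 : 0 < m) (hm : m ≤ X) :
    Runs X argMin (fun s' => ∃ b < m, s'.var 18 = (b : ℕ) ∧
      ∀ i < m, s.arr 3 b v ≤ s.arr 3 i v) s := by
  refine Runs.seq (Runs.setVar ?_)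
  refine Runs.forTo (fun i s' => ∃ b < m, s'.var 18 = (b : ℕ) ∧
      ∀ j < i, s.arr 3 b v ≤ s.arr 3 j v) m hm rfl
    (fun _ _ _ h => h) (fun i s' _ hf _ _ => ?_) ?_ (fun i s' hi hf h17 h => ?_)
    (fun s' _ _ h => h)
  · have := hf.var 2 rfl
    simp only [Expr.eval, this]
    simp [Mem.setVar, h2]
  · exact ⟨0, hm0, by simp [Expr.eval], by simp⟩
  · have h13' : s'.var 13 = v := (hf.var 13 rfl).trans h13
    have h3 : s'.arr 3 = s.arr 3 := hf.arr 3 rfl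
    obtain ⟨b, hb, h18, hmin⟩ := h
    refine Runs.ite (fun ht => Runs.skip ⟨b, hb, h18, fun j hj => ?_⟩)
      (fun ht => Runs.setVar ⟨i, hi, by simp [Expr.eval, h17], fun j hj => ?_⟩) <;>
    simp only [Test.holds, Expr.eval, h18, h17, h13', h3, Int.toNat_natCast] at ht <;>
    rcases Nat.lt_succ_iff_lt_or_eq.1 hj with hj | rfl
    · exact hmin j hj
    · exact ht
    · exact (not_le.1 ht).le.trans (hmin j hj)
    · exact le_rfl

theorem argMax_runs (h2 : s.var 2 = m) (h13 : s.var 13 = v) (hm0 : 0 < m) (hm : m ≤ X) :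
    Runs X argMax (fun s' => ∃ b < m, s'.var 18 = (b : ℕ) ∧
      ∀ i < m, s.arr 3 i v ≤ s.arr 3 b v) s := by
  refine Runs.seq (Runs.setVar ?_)
  refine Runs.forTo (fun i s' => ∃ b < m, s'.var 18 = (b : ℕ) ∧
      ∀ j < i, s.arr 3 j v ≤ s.arr 3 b v) m hm rfl
    (fun _ _ _ h => h) (fun i s' _ hf _ _ => ?_) ?_ (fun i s' hi hf h17 h => ?_)
    (fun s' _ _ h => h)
  · have := hf.var 2 rfl
    simp only [Expr.eval, this]
    simp [Mem.setVar, h2]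
  · exact ⟨0, hm0, by simp [Expr.eval], by simp⟩
  · have h13' : s'.var 13 = v := (hf.var 13 rfl).trans h13
    have h3 : s'.arr 3 = s.arr 3 := hf.arr 3 rfl
    obtain ⟨b, hb, h18, hmax⟩ := h
    refine Runs.ite (fun ht => Runs.skip ⟨b, hb, h18, fun j hj => ?_⟩)
      (fun ht => Runs.setVar ⟨i, hi, by simp [Expr.eval, h17], fun j hj => ?_⟩) <;>
    simp only [Test.holds, Expr.eval, h18, h17, h13', h3, Int.toNat_natCast] at ht <;>
    rcases Nat.lt_succ_iff_lt_or_eq.1 hj with hj | rfl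
    · exact hmax j hj
    · exact ht
    · exact (hmax j hj).trans (not_le.1 ht).le
    · exact le_rfl

theorem raiseColumn_runs (h2 : s.var 2 = m) (h13 : s.var 13 = v) (hm0 : 0 < m) (hm : m ≤ X)
    (hX : (s.arr 6 0 v - s.var 14).toNat ≤ X) (hbal : Balanced m fun i => s.arr 3 i v) :
    Runs X raiseColumn (fun s' => ColumnChange m v (s.arr 6 0 v - s.var 14).toNat
      (∑ i ∈ Finset.range m, s.arr 3 i v + (s.arr 6 0 v - s.var 14).toNat)
      (s.arr 3) (s'.arr 3)) s := by
  refine Runs.seq (Runs.setVar ?_)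
  refine Runs.forTo (fun c s' => ColumnChange m v c (∑ i ∈ Finset.range m, s.arr 3 i v + c)
      (s.arr 3) (s'.arr 3)) _ hX rfl
    (fun _ _ _ h => h) (fun i s' _ hf _ _ => ?_) ?_ (fun c s' hc hf h16 h => ?_)
    (fun s' _ _ h => h)
  · have := hf.var 15 rfl
    simp only [Expr.eval, this]
    simp [h13]
  · exact ⟨fun _ _ _ => rfl, hbal, by simp, by simp⟩
  · refine Runs.seq (Runs.mono (argMin_runs ((hf.var 2 rfl).trans h2) ((hf.var 13 rfl).trans h13)
      hm0 hm) fun s'' hf' hb => ?_)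
    obtain ⟨b, hb, h18, hmin⟩ := hb
    have h13' : s''.var 13 = v := (hf'.var 13 rfl).trans ((hf.var 13 rfl).trans h13)
    have h3 : s''.arr 3 = s'.arr 3 := hf'.arr 3 rfl
    refine Runs.setArr ?_
    have := h.step (σ := 1) (A'' := fun i w => if i = b ∧ w = v then s'.arr 3 b v + 1
      else s'.arr 3 i w) hb (by simp) (by simpa using hmin) (fun _ _ => rfl)
    simp only [Mem.setArr, Expr.eval, h18, h13', h3, Int.toNat_natCast, true_and]
    rw [Nat.cast_succ, ← add_assoc]
    exact this

theorem lowerColumn_runs (h2 : s.var 2 = m) (h13 : s.var 13 = v) (hm0 : 0 < m) (hm : m ≤ X)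
    (hX : (s.var 14 - s.arr 6 0 v).toNat ≤ X) (hbal : Balanced m fun i => s.arr 3 i v) :
    Runs X lowerColumn (fun s' => ColumnChange m v (s.var 14 - s.arr 6 0 v).toNat
      (∑ i ∈ Finset.range m, s.arr 3 i v - (s.var 14 - s.arr 6 0 v).toNat)
      (s.arr 3) (s'.arr 3)) s := by
  refine Runs.seq (Runs.setVar ?_)
  refine Runs.forTo (fun c s' => ColumnChange m v c (∑ i ∈ Finset.range m, s.arr 3 i v - c)
      (s.arr 3) (s'.arr 3)) _ hX rfl
    (fun _ _ _ h => h) (fun i s' _ hf _ _ => ?_) ?_ (fun c s' hc hf h16 h => ?_)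
    (fun s' _ _ h => h)
  · have := hf.var 15 rfl
    simp only [Expr.eval, this]
    simp [h13]
  · exact ⟨fun _ _ _ => rfl, hbal, by simp, by simp⟩
  · refine Runs.seq (Runs.mono (argMax_runs ((hf.var 2 rfl).trans h2) ((hf.var 13 rfl).trans h13)
      hm0 hm) fun s'' hf' hb => ?_)
    obtain ⟨b, hb, h18, hmax⟩ := hb
    have h13' : s''.var 13 = v := (hf'.var 13 rfl).trans ((hf.var 13 rfl).trans h13)
    have h3 : s''.arr 3 = s'.arr 3 := hf'.arr 3 rfl
    refine Runs.setArr ?_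
    have := h.step (σ := -1) (A'' := fun i w => if i = b ∧ w = v then s'.arr 3 b v - 1
      else s'.arr 3 i w) hb (by simp) (by simpa using hmax) (fun _ _ => rfl)
    simp only [Mem.setArr, Expr.eval, h18, h13', h3, Int.toNat_natCast, true_and]
    rw [Nat.cast_succ, ← sub_sub]
    exact this

/-- The column `v` has been changed as little as possible to a balanced one with sum `t`. -/
structure Filled (m v : ℕ) (t : ℤ) (A A' : ℕ → ℕ → ℤ) : Prop where
  balanced : Balanced m fun i => A' i v
  sum : ∑ i ∈ Finset.range m, A' i v = t
  change : ∑ i ∈ Finset.range m, |A' i v - A i v| ≤ |t - ∑ i ∈ Finset.range m, A i v|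

theorem fillColumn_runs (h2 : s.var 2 = m) (h13 : s.var 13 = v) (hm0 : 0 < m) (hm : m ≤ X)
    (hX : |s.arr 6 0 v - ∑ i ∈ Finset.range m, s.arr 3 i v| ≤ X)
    (hbal : Balanced m fun i => s.arr 3 i v) :
    Runs X fillColumn (fun s' => (∀ i w, w ≠ v → s'.arr 3 i w = s.arr 3 i w) ∧
      Filled m v (s.arr 6 0 v) (s.arr 3) (s'.arr 3)) s := by
  have hX' := abs_le.1 hX
  refine Runs.seq (Runs.mono (colSum_runs h2 h13 hm) fun s1 f1 h14 => ?_)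
  have e3 : s1.arr 3 = s.arr 3 := f1.arr 3 rfl
  have e6 : s1.arr 6 = s.arr 6 := f1.arr 6 rfl
  refine Runs.seq (Runs.mono (raiseColumn_runs ((f1.var 2 rfl).trans h2)
    ((f1.var 13 rfl).trans h13) hm0 hm (by rw [h14, e6]; omega) (by rwa [e3])) fun s2 f2 hc => ?_)
  have e14 : s2.var 14 = ∑ i ∈ Finset.range m, s.arr 3 i v := (f2.var 14 rfl).trans h14
  have e6' : s2.arr 6 = s.arr 6 := (f2.arr 6 rfl).trans e6
  rw [h14, e6, e3] at hc
  refine Runs.mono (lowerColumn_runs ((f2.var 2 rfl).trans ((f1.var 2 rfl).trans h2))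
    ((f2.var 13 rfl).trans ((f1.var 13 rfl).trans h13)) hm0 hm (by rw [e14, e6']; omega)
    hc.balanced) fun s3 f3 hd => ?_
  rw [e14, e6'] at hd
  refine ⟨fun i w hw => (hd.other i w hw).trans (hc.other i w hw), hd.balanced, ?_, ?_⟩
  · rw [hd.sum, hc.sum]
    omega
  · have h1 : ∑ i ∈ Finset.range m, |s3.arr 3 i v - s.arr 3 i v| ≤
        ∑ i ∈ Finset.range m, |s3.arr 3 i v - s2.arr 3 i v| +
        ∑ i ∈ Finset.range m, |s2.arr 3 i v - s.arr 3 i v| := by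
      rw [← Finset.sum_add_distrib]
      exact Finset.sum_le_sum fun i _ => abs_sub_le _ _ _
    have h2 := hc.change
    have h3 := hd.change
    refine h1.trans ((add_le_add h3 h2).trans ?_)
    rcases abs_cases (s.arr 6 0 v - ∑ i ∈ Finset.range m, s.arr 3 i v) with h | h <;> omega

end Specs

/-- The memory describes the tree `g` on `n` nodes with root `r`, and `m` configurations. -/
structure TreeMem (n m r : ℕ) (g : ℕ → ℕ) (s : Mem) : Prop where
  rows : s.var 2 = m
  root : s.var 3 = r
  nodes : s.var 6 = n
  parent : ∀ v < n, s.arr 4 0 v = g v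

theorem TreeMem.frame {n m r : ℕ} {g : ℕ → ℕ} {c : Prog} {s s' : Mem} (h : TreeMem n m r g s)
    (hf : Frame c s s') (h2 : c.writesVar 2 = false) (h3 : c.writesVar 3 = false)
    (h6 : c.writesVar 6 = false) (h4 : c.writesArr 4 = false) : TreeMem n m r g s' :=
  ⟨(hf.var 2 h2).trans h.rows, (hf.var 3 h3).trans h.root, (hf.var 6 h6).trans h.nodes,
    fun v hv => by rw [hf.arr 4 h4]; exact h.parent v hv⟩

section Specs

variable {X n m r p : ℕ} {g : ℕ → ℕ} {s : Mem}

theorem isKid_holds {v : ℕ} (h : TreeMem n m r g s) (h12 : s.var 12 = p) (h13 : s.var 13 = v)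
    (hv : v < n) : isKid.holds s ↔ v ∈ kids n r g p := by
  simp only [isKid, Test.holds, Expr.eval, h12, h13, h.root, Int.toNat_natCast, Int.toNat_zero,
    h.parent v hv, mem_kids, hv, true_and, Nat.cast_inj]

theorem fillColumns_runs (h : TreeMem n m r g s) (h12 : s.var 12 = p) (hm0 : 0 < m) (hm : m ≤ X)
    (hn : n ≤ X)
    (hX : ∀ v ∈ kids n r g p, |s.arr 6 0 v - ∑ i ∈ Finset.range m, s.arr 3 i v| ≤ X)
    (hbal : ∀ v ∈ kids n r g p, Balanced m fun i => s.arr 3 i v) :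
    Runs X fillColumns (fun s' => (∀ i w, w ∉ kids n r g p → s'.arr 3 i w = s.arr 3 i w) ∧
      ∀ v ∈ kids n r g p, Filled m v (s.arr 6 0 v) (s.arr 3) (s'.arr 3)) s := by
  refine Runs.forTo (fun v s' => (∀ i w, ¬ (w ∈ kids n r g p ∧ w < v) →
      s'.arr 3 i w = s.arr 3 i w) ∧ ∀ w ∈ kids n r g p, w < v →
        Filled m w (s.arr 6 0 w) (s.arr 3) (s'.arr 3)) n hn rfl
    (fun _ _ _ h => h) (fun i s' _ hf _ _ => ?_) ⟨fun _ _ _ => rfl, by simp⟩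
    (fun v s' hv hf h13 hI => ?_) (fun s' _ _ hI => ?_)
  · simp [Expr.eval, hf.var 6 rfl, h.nodes]
  · have h' := h.frame hf rfl rfl rfl rfl
    have h6 : s'.arr 6 = s.arr 6 := hf.arr 6 rfl
    have e : ∀ i, s'.arr 3 i v = s.arr 3 i v := fun i => hI.1 i v (by simp)
    refine Runs.ite (fun hk => ?_) (fun hk => Runs.skip ?_) <;>
      rw [isKid_holds h' ((hf.var 12 rfl).trans h12) h13 hv] at hk
    · refine Runs.mono (fillColumn_runs h'.rows h13 hm0 hm (by simp only [e, h6]; exact hX v hk)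
        (by simp only [e]; exact hbal v hk)) fun s'' _ ⟨ho, hF⟩ => ⟨fun i w hw => ?_,
          fun w hw hwv => ?_⟩
      · rw [ho i w (by rintro rfl; exact hw ⟨hk, Nat.lt_succ_self _⟩),
          hI.1 i w fun h => hw ⟨h.1, h.2.trans (Nat.lt_succ_self v)⟩]
      · rcases Nat.lt_succ_iff_lt_or_eq.1 hwv with hlt | rfl
        · have hF' := hI.2 w hw hlt
          have e' : ∀ i, s''.arr 3 i w = s'.arr 3 i w := fun i => ho i w hlt.ne
          exact ⟨by simpa only [e'] using hF'.balanced, by simpa only [e'] using hF'.sum,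
            by simpa only [e'] using hF'.change⟩
        · have hc := hF.change
          rw [h6] at hF hc
          simp only [e] at hc
          exact ⟨hF.balanced, hF.sum, hc⟩
    · refine ⟨fun i w hw => hI.1 i w fun h => hw ⟨h.1, h.2.trans (Nat.lt_succ_self v)⟩,
        fun w hw hwv => hI.2 w hw ?_⟩
      rcases Nat.lt_succ_iff_lt_or_eq.1 hwv with hlt | rfl
      · exact hlt
      · exact absurd hw hk
  · exact ⟨fun i w hw => hI.1 i w fun h => hw h.1, fun v hv => hI.2 v hv (mem_kids.1 hv).1⟩

theorem rowSums_runs (h : TreeMem n m r g s) (h12 : s.var 12 = p) (hm : m ≤ X) (hn : n ≤ X) :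
    Runs X rowSums (fun s' => ∀ i < m, s'.arr 5 0 i = ∑ v ∈ kids n r g p, s.arr 3 i v) s := by
  refine Runs.forTo (fun i s' => ∀ j < i, s'.arr 5 0 j = ∑ v ∈ kids n r g p, s.arr 3 j v) m hm rfl
    (fun _ _ _ h => h) (fun i s' _ hf _ _ => ?_) (by simp)
    (fun i s' hi hf h19 hI => ?_) (fun s' _ _ hI => hI)
  · simp [Expr.eval, hf.var 2 rfl, h.rows]
  · refine Runs.seq (Runs.setArr ?_)
    have e0 : (Expr.eval s' (.var 19)).toNat = i := by simp [Expr.eval, h19]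
    rw [e0]
    have h' := h.frame hf rfl rfl rfl rfl
    refine Runs.forTo (fun v s'' => (∀ j < i, s''.arr 5 0 j = ∑ v ∈ kids n r g p, s.arr 3 j v) ∧
        s''.arr 5 0 i = ∑ w ∈ (kids n r g p).filter (· < v), s.arr 3 i w) n hn rfl
      (fun _ _ _ h => h) (fun v s'' _ hf' _ _ => ?_) ⟨fun j hj => ?_, ?_⟩
      (fun v s'' hv hf' h13 hJ => ?_) (fun s'' _ _ hJ j hj => ?_)
    · have := hf'.var 6 rfl
      simp only [Expr.eval, this]
      simp [h'.nodes]
    · simp only [Mem.setArr, Expr.eval]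
      rw [if_neg (by rintro ⟨-, -, h⟩; omega)]
      exact hI j hj
    · simp [Mem.setArr, Expr.eval]
    · have h0 : TreeMem n m r g (s'.setArr 5 (Expr.eval s' (.const 0)).toNat i
          (Expr.eval s' (.const 0))) :=
        ⟨h'.rows, h'.root, h'.nodes, fun v hv => by simpa [Mem.setArr] using h'.parent v hv⟩
      have h'' : TreeMem n m r g s'' := h0.frame hf' rfl rfl rfl rfl
      have k12 : s''.var 12 = p := (hf'.var 12 rfl).trans ((hf.var 12 rfl).trans h12)
      have k19 : s''.var 19 = i := (hf'.var 19 rfl).trans h19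
      have k3 : s''.arr 3 = s.arr 3 := (hf'.arr 3 rfl).trans (hf.arr 3 rfl)
      have hfil : (kids n r g p).filter (· < v + 1) = (kids n r g p).filter (· < v) ∪
          (kids n r g p).filter (· = v) := by
        rw [← Finset.filter_or]
        exact Finset.filter_congr fun w _ => Nat.lt_succ_iff_lt_or_eq
      have hdis : Disjoint ((kids n r g p).filter (· < v)) ((kids n r g p).filter (· = v)) :=
        Finset.disjoint_filter.2 fun w _ h1 h2 => h1.ne h2
      refine Runs.ite (fun hk => Runs.setArr ⟨fun j hj => ?_, ?_⟩) (fun hk => Runs.skip ⟨hJ.1, ?_⟩)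
        <;> rw [isKid_holds h'' k12 h13 hv] at hk
      · simp only [Mem.setArr, Expr.eval, k19, Int.toNat_natCast]
        rw [if_neg (by rintro ⟨-, -, h⟩; omega)]
        exact hJ.1 j hj
      · rw [hfil, Finset.sum_union hdis, Finset.filter_eq', if_pos hk, Finset.sum_singleton]
        simp [Mem.setArr, Expr.eval, k19, k3, h13, hJ.2]
      · rw [hfil, Finset.sum_union hdis, Finset.filter_eq', if_neg hk, Finset.sum_empty, add_zero]
        exact hJ.2
    · rcases Nat.lt_succ_iff_lt_or_eq.1 hj with hj | rfl
      · exact hJ.1 j hj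
      · rw [hJ.2, Finset.filter_true_of_mem fun w hw => (mem_kids.1 hw).1]

/-- The state of the loops that exchange units between rows; the pairs of rows in `D` need no
more exchange. -/
structure Exchanging (m : ℕ) (K : Finset ℕ) (p : ℕ) (t : ℕ → ℤ) (A₀ : ℕ → ℕ → ℤ) (E : ℤ)
    (D : ℕ → ℕ → Prop) (s : Mem) : Prop where
  exchange : Exchange m K t (fun i => A₀ i p) A₀ E (s.arr 3) (s.arr 5 0)
  done : ∀ i i', D i i' → s.arr 5 0 i ≤ A₀ i p ∨ A₀ i' p ≤ s.arr 5 0 i'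

theorem exchangeUnit_runs {K : Finset ℕ} {t : ℕ → ℤ} {A₀ : ℕ → ℕ → ℤ} {E : ℤ}
    {D : ℕ → ℕ → Prop} {a b v : ℕ} (h : Exchanging m K p t A₀ E D s) (h19 : s.var 19 = a)
    (h20 : s.var 20 = b) (h13 : s.var 13 = v) (ha : a < m) (hb : b < m) (hv : v ∈ K)
    (hSa : A₀ a p < s.arr 5 0 a) (hSb : s.arr 5 0 b < A₀ b p)
    (hA : s.arr 3 b v < s.arr 3 a v) :
    Runs X exchangeUnit (fun s' => Exchanging m K p t A₀ E D s' ∧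
      (∀ i w, w ≠ v → s'.arr 3 i w = s.arr 3 i w) ∧ s'.arr 3 a v ≤ s'.arr 3 b v) s := by
  have hab : a ≠ b := by rintro rfl; omega
  have hbal := h.exchange.balanced v hv a ha b hb
  simp only at hbal
  refine Runs.seq (Runs.setArr (Runs.seq (Runs.setArr (Runs.seq (Runs.setArr (Runs.setArr ?_))))))
  simp only [Expr.eval, Mem.setArr_var, h19, h20, h13, Int.toNat_natCast, Int.toNat_zero]
  have e3 : ∀ i w, (if (3 = 3) ∧ i = b ∧ w = v then
      (if (3 = 3) ∧ b = a ∧ v = v then s.arr 3 a v - 1 else s.arr 3 b v) + 1 else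
      if (3 = 3) ∧ i = a ∧ w = v then s.arr 3 a v - 1 else s.arr 3 i w) = s.arr 3 i w +
        if w = v then (if i = b then 1 else 0) - (if i = a then 1 else 0) else 0 := by
    intro i w
    by_cases hw : w = v
    · subst hw
      by_cases hib : i = b
      · subst hib
        simp [hab.symm]
      · by_cases hia : i = a
        · subst hia
          simp [hab, sub_eq_add_neg]
        · simp [hib, hia]
    · simp [hw]
  have e5 : ∀ i, (if (5 = 5) ∧ 0 = 0 ∧ i = b then
      (if (5 = 5) ∧ 0 = 0 ∧ b = a then s.arr 5 0 a - 1 else s.arr 5 0 b) + 1 else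
      if (5 = 5) ∧ 0 = 0 ∧ i = a then s.arr 5 0 a - 1 else s.arr 5 0 i) = s.arr 5 0 i +
        ((if i = b then 1 else 0) - (if i = a then 1 else 0)) := by
    intro i
    by_cases hib : i = b
    · subst hib
      simp [hab.symm]
    · by_cases hia : i = a
      · subst hia
        simp [hab, sub_eq_add_neg]
      · simp [hib, hia]
  refine ⟨⟨h.exchange.step ha hb hv hSa hSb hA (A' := fun i w => s.arr 3 i w +
      if w = v then (if i = b then 1 else 0) - (if i = a then 1 else 0) else 0)
      (S' := fun i => s.arr 5 0 i + ((if i = b then 1 else 0) - (if i = a then 1 else 0)))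
      (fun _ _ => rfl) (fun _ => rfl) |> fun h' => ?_, fun i i' hD => ?_⟩, fun i w hw => ?_, ?_⟩
  · convert h' using 1
    · funext i w
      rw [← e3 i w]
      simp [Mem.setArr]
    · funext i
      rw [← e5 i]
      simp [Mem.setArr]
  · have := h.done i i' hD
    have k : ∀ i, ((((s.setArr 3 a v (s.arr 3 a v - 1)).setArr 3 b v
        ((s.setArr 3 a v (s.arr 3 a v - 1)).arr 3 b v + 1)).setArr 5 0 a
        ((((s.setArr 3 a v (s.arr 3 a v - 1)).setArr 3 b v
        ((s.setArr 3 a v (s.arr 3 a v - 1)).arr 3 b v + 1))).arr 5 0 a - 1)).setArr 5 0 b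
        (((((s.setArr 3 a v (s.arr 3 a v - 1)).setArr 3 b v
        ((s.setArr 3 a v (s.arr 3 a v - 1)).arr 3 b v + 1)).setArr 5 0 a
        ((((s.setArr 3 a v (s.arr 3 a v - 1)).setArr 3 b v
        ((s.setArr 3 a v (s.arr 3 a v - 1)).arr 3 b v + 1))).arr 5 0 a - 1))).arr 5 0 b + 1)).arr
          5 0 i = s.arr 5 0 i + ((if i = b then 1 else 0) - (if i = a then 1 else 0)) := by
      intro i
      rw [← e5 i]
      simp [Mem.setArr]
    rw [k, k]
    rcases this with h1 | h1
    · left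
      have : i ≠ a := by rintro rfl; omega
      rw [if_neg this]
      split_ifs with hib
      · subst hib; omega
      · omega
    · right
      have : i' ≠ b := by rintro rfl; omega
      rw [if_neg this]
      split_ifs with hia
      · subst hia; omega
      · omega
  · simp [Mem.setArr, hw]
  · simp [Mem.setArr, hab, hab.symm]
    omega

theorem exchangeUnits_runs {A₀ : ℕ → ℕ → ℤ} {t : ℕ → ℤ} {E : ℤ} (h : TreeMem n m r g s)
    (h12 : s.var 12 = p) (hm : m ≤ X) (hn : n ≤ X) (hp : p ∉ kids n r g p)
    (hB : Balanced m fun i => A₀ i p)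
    (hE : Exchange m (kids n r g p) t (fun i => A₀ i p) A₀ E (s.arr 3) (s.arr 5 0)) :
    Runs X exchangeUnits (Exchanging m (kids n r g p) p t A₀ E fun i i' => i < m ∧ i' < m) s := by
  refine Runs.forTo (fun i => Exchanging m (kids n r g p) p t A₀ E fun j j' => j < i ∧ j' < m)
    m hm rfl (fun _ _ _ h => ⟨h.1, h.2⟩) (fun i s' _ hf _ _ => ?_) ⟨hE, by simp⟩
    (fun a s1 ha f1 h19 hI => ?_) (fun _ _ _ hI => hI)
  · simp [Expr.eval, hf.var 2 rfl, h.rows]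
  have t1 := h.frame f1 rfl rfl rfl rfl
  refine Runs.forTo (fun b => Exchanging m (kids n r g p) p t A₀ E fun j j' =>
      (j < a ∧ j' < m) ∨ (j = a ∧ j' < b))
    m hm rfl (fun _ _ _ h => ⟨h.1, h.2⟩) (fun i s' _ hf _ _ => ?_)
    ⟨hI.exchange, fun i i' hD => hI.done i i' (by simpa using hD)⟩
    (fun b s2 hb f2 h20 hI => ?_) (fun _ _ _ hI => ⟨hI.exchange, fun i i' hD => hI.done i i' (by omega)⟩)
  · simp [Expr.eval, hf.var 2 rfl, t1.rows]
  have t2 := t1.frame f2 rfl rfl rfl rfl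
  refine Runs.forTo (fun v s' => Exchanging m (kids n r g p) p t A₀ E (fun j j' =>
      (j < a ∧ j' < m) ∨ (j = a ∧ j' < b)) s' ∧ ∀ w ∈ kids n r g p, w < v →
        s'.arr 5 0 a ≤ A₀ a p ∨ A₀ b p ≤ s'.arr 5 0 b ∨ s'.arr 3 a w ≤ s'.arr 3 b w)
    n hn rfl (fun _ _ _ h => ⟨⟨h.1.1, h.1.2⟩, h.2⟩) (fun i s' _ hf _ _ => ?_)
    ⟨hI, by simp⟩ (fun v s3 hv f3 h13 hJ => ?_) (fun s3 _ _ hJ => ?_)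
  · simp [Expr.eval, hf.var 6 rfl, t2.nodes]
  · have t3 := t2.frame f3 rfl rfl rfl rfl
    have k12 : s3.var 12 = p :=
      (f3.var 12 rfl).trans ((f2.var 12 rfl).trans ((f1.var 12 rfl).trans h12))
    have k19 : s3.var 19 = a := (f3.var 19 rfl).trans ((f2.var 19 rfl).trans h19)
    have k20 : s3.var 20 = b := (f3.var 20 rfl).trans h20
    have hAp : ∀ i, s3.arr 3 i p = A₀ i p := fun i => hJ.1.exchange.other i p hp
    have hkid := isKid_holds t3 k12 h13 hv
    have hcan : canExchange.holds s3 ↔ v ∈ kids n r g p ∧ A₀ a p < s3.arr 5 0 a ∧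
        s3.arr 5 0 b < A₀ b p ∧ s3.arr 3 b v < s3.arr 3 a v := by
      simp only [canExchange, Test.holds, hkid, Expr.eval, k12, k19, k20, h13, Int.toNat_natCast,
        Int.toNat_zero, hAp, not_le]
    refine Runs.ite (fun hk => ?_) (fun hk => Runs.skip ?_) <;> rw [hcan] at hk
    · obtain ⟨k1, k2, k3, k4⟩ := hk
      set D := fun j j' => (j < a ∧ j' < m) ∨ (j = a ∧ j' < b) with hD
      have hJ' : Exchanging m (kids n r g p) p t A₀ E (fun j j' => D j j' ∨
          (j = a ∧ j' = b ∧ (s3.arr 5 0 a ≤ A₀ a p ∨ A₀ b p ≤ s3.arr 5 0 b))) s3 :=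
        ⟨hJ.1.exchange, fun i i' h => h.elim (hJ.1.done i i') (by rintro ⟨rfl, rfl, h⟩; exact h)⟩
      refine Runs.mono (exchangeUnit_runs hJ' k19 k20 h13 ha hb k1 k2 k3 k4)
        fun s4 f4 ⟨h1, h2, h3⟩ => ⟨⟨h1.exchange, fun i i' h => h1.done i i' (Or.inl h)⟩,
          fun w hw hwv => ?_⟩
      rcases Nat.lt_succ_iff_lt_or_eq.1 hwv with hlt | rfl
      · rcases hJ.2 w hw hlt with h4 | h4 | h4
        · omega
        · omega
        · right; right
          rwa [h2 a w hlt.ne, h2 b w hlt.ne]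
      · exact Or.inr (Or.inr h3)
    · refine ⟨hJ.1, fun w hw hwv => ?_⟩
      rcases Nat.lt_succ_iff_lt_or_eq.1 hwv with hlt | rfl
      · exact hJ.2 w hw hlt
      · by_contra hc
        push Not at hc
        exact hk ⟨hw, hc⟩
  · refine ⟨hJ.1.exchange, fun i i' hD => ?_⟩
    by_cases hab : i = a ∧ i' = b
    · obtain ⟨rfl, rfl⟩ := hab
      by_contra hc
      push Not at hc
      have h1 : ∑ w ∈ kids n r g p, s3.arr 3 i w ≤ ∑ w ∈ kids n r g p, s3.arr 3 i' w := by
        refine Finset.sum_le_sum fun w hw => ?_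
        rcases hJ.2 w hw (mem_kids.1 hw).1 with h4 | h4 | h4
        · omega
        · omega
        · exact h4
      rw [← hJ.1.exchange.row i ha, ← hJ.1.exchange.row i' hb] at h1
      have := hB i' hb i ha
      simp only at this
      omega
    · exact hJ.1.done i i' (by omega)

/-- The result `A'` of rebalancing the children of `p` in `A`, with new masses `t`. -/
structure Rebalanced (m : ℕ) (K : Finset ℕ) (p : ℕ) (t : ℕ → ℤ) (A A' : ℕ → ℕ → ℤ) : Prop where
  other : ∀ i, ∀ v, v ∉ K → A' i v = A i v
  balanced : ∀ v ∈ K, Balanced m fun i => A' i v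
  sum : ∀ v ∈ K, ∑ i ∈ Finset.range m, A' i v = t v
  row : ∀ i < m, ∀ i' < m, ∑ v ∈ K, A' i v ≤ A i p ∨ A i' p ≤ ∑ v ∈ K, A' i' v
  change : ∑ v ∈ K, ∑ i ∈ Finset.range m, |A' i v - A i v| ≤
    ∑ i ∈ Finset.range m, |∑ v ∈ K, A i v - A i p| +
      2 * ∑ v ∈ K, |t v - ∑ i ∈ Finset.range m, A i v|

theorem rebalance_runs (h : TreeMem n m r g s) (h12 : s.var 12 = p) (hm0 : 0 < m) (hm : m ≤ X)
    (hn : n ≤ X) (hp : p ∉ kids n r g p)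
    (hX : ∀ v ∈ kids n r g p, |s.arr 6 0 v - ∑ i ∈ Finset.range m, s.arr 3 i v| ≤ X)
    (hbal : ∀ v ∈ kids n r g p, Balanced m fun i => s.arr 3 i v)
    (hB : Balanced m fun i => s.arr 3 i p) :
    Runs X rebalance (fun s' =>
      Rebalanced m (kids n r g p) p (s.arr 6 0) (s.arr 3) (s'.arr 3)) s := by
  refine Runs.seq (Runs.mono (fillColumns_runs h h12 hm0 hm hn hX hbal) fun s1 f1 ⟨ho, hF⟩ => ?_)
  have t1 := h.frame f1 rfl rfl rfl rfl
  have k12 : s1.var 12 = p := (f1.var 12 rfl).trans h12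
  refine Runs.seq (Runs.mono (rowSums_runs t1 k12 hm hn) fun s2 f2 hS => ?_)
  have t2 := t1.frame f2 rfl rfl rfl rfl
  have e3 : s2.arr 3 = s1.arr 3 := f2.arr 3 rfl
  have hE : Exchange m (kids n r g p) (s.arr 6 0) (fun i => s.arr 3 i p) (s.arr 3)
      (∑ i ∈ Finset.range m, |∑ v ∈ kids n r g p, s.arr 3 i v - s.arr 3 i p| +
        2 * ∑ v ∈ kids n r g p, |s.arr 6 0 v - ∑ i ∈ Finset.range m, s.arr 3 i v|)
      (s2.arr 3) (s2.arr 5 0) := by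
    rw [e3]
    refine ⟨ho, fun v hv => (hF v hv).balanced, fun v hv => (hF v hv).sum, hS, ?_⟩
    have h1 := Finset.sum_le_sum fun v hv => (hF v hv).change
    have h2 : ∑ i ∈ Finset.range m, |s2.arr 5 0 i - s.arr 3 i p| ≤
        ∑ i ∈ Finset.range m, |∑ v ∈ kids n r g p, s.arr 3 i v - s.arr 3 i p| +
        ∑ v ∈ kids n r g p, ∑ i ∈ Finset.range m, |s1.arr 3 i v - s.arr 3 i v| := by
      rw [Finset.sum_comm, ← Finset.sum_add_distrib]
      refine Finset.sum_le_sum fun i hi => ?_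
      rw [hS i (Finset.mem_range.1 hi), add_comm]
      refine (abs_sub_le _ (∑ v ∈ kids n r g p, s.arr 3 i v) _).trans (add_le_add_left ?_ _)
      rw [← Finset.sum_sub_distrib]
      exact Finset.abs_sum_le_sum_abs _ _
    linarith
  refine Runs.mono (exchangeUnits_runs t2 ((f2.var 12 rfl).trans k12) hm hn hp hB hE)
    fun s3 f3 hD => ⟨hD.exchange.other, hD.exchange.balanced, hD.exchange.sum,
      fun i hi i' hi' => ?_, ?_⟩
  · rw [← hD.exchange.row i hi, ← hD.exchange.row i' hi']
    exact hD.done i i' ⟨hi, hi'⟩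
  · have h1 := hD.exchange.change
    have h2 : 0 ≤ ∑ i ∈ Finset.range m, |s3.arr 5 0 i - s.arr 3 i p| :=
      Finset.sum_nonneg fun _ _ => abs_nonneg _
    linarith

end Specs

/-! ### One activation of the program for trees -/

section Programs

open Prog

/-- Add the mass at the node in register `12` to the masses below all its ancestors. -/
def addMass : Prog :=
  seq (setVar 21 (.var 12)) (seq (setVar 23 (.const 0))
    (seq (forTo 24 (.var 6) (ite (.eq (.var 21) (.var 3)) skip
      (seq (setArr 6 (.const 0) (.var 21)
          (.add (.get 6 (.const 0) (.var 21)) (.get 1 (.const 0) (.var 12))))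
        (seq (setVar 21 (.get 4 (.const 0) (.var 21))) (setVar 23 (.add (.var 23) (.const 1)))))))
      (seq (setArr 6 (.const 0) (.var 3)
          (.add (.get 6 (.const 0) (.var 3)) (.get 1 (.const 0) (.var 12))))
        (setArr 7 (.const 0) (.var 12) (.var 23)))))

def masses : Prog :=
  seq (forTo 12 (.var 6) (setArr 6 (.const 0) (.var 12) (.const 0))) (forTo 12 (.var 6) addMass)

def setRoot : Prog := forTo 19 (.var 2) (setArr 3 (.var 19) (.var 3) (.var 1))

def rebalanceAll : Prog :=
  forTo 11 (.var 6) (forTo 12 (.var 6)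
    (ite (.eq (.get 7 (.const 0) (.var 12)) (.var 11)) rebalance skip))

def output : Prog :=
  forTo 19 (.var 2) (seq (setVar 14 (.const 0)) (forTo 12 (.var 0)
    (ite (.le (.const 1) (.get 1 (.const 0) (.var 12)))
      (forTo 16 (.get 3 (.var 19) (.var 12))
        (seq (setArr 2 (.var 19) (.var 14) (.var 12)) (setVar 14 (.add (.var 14) (.const 1)))))
      skip)))

def update : Prog := seq masses (seq setRoot (seq rebalanceAll output))

end Programs

section Specs

variable {X n m r : ℕ} {g : ℕ → ℕ} {s : Mem} {y : ℕ → ℤ}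

open Classical in
theorem addMass_runs (h : TreeMem n m r g s) (hg : IsTree n r g) (hn : n ≤ X)
    (hy : ∀ u < n, s.arr 1 0 u = y u) {u : ℕ} (hu : u < n) (h12 : s.var 12 = u) :
    Runs X addMass (fun s' =>
      (∀ x < n, s'.arr 6 0 x = s.arr 6 0 x + if ∃ i, g^[i] u = x then y u else 0) ∧
      ∀ w, s'.arr 7 0 w = if w = u then (level r g u : ℤ) else s.arr 7 0 w) s := by
  refine Runs.seq (Runs.setVar (Runs.seq (Runs.setVar (Runs.seq ?_))))
  refine Runs.forTo (fun c s' => s'.var 21 = (g^[c] u : ℕ) ∧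
      s'.var 23 = (min c (level r g u) : ℕ) ∧ ∀ x < n, s'.arr 6 0 x = s.arr 6 0 x +
        if (∃ i, g^[i] u = x) ∧ ¬ ∃ i, g^[i] (g^[c] u) = x then y u else 0) n hn rfl
    (fun _ _ _ h => h) (fun i s' _ hf _ _ => ?_) ⟨?_, ?_, ?_⟩
    (fun c s1 hc f1 _ ⟨i1, i2, i3⟩ => ?_) (fun s1 f1 _ ⟨i1, i2, i3⟩ => ?_)
  · have := hf.var 6 rfl
    simp only [Expr.eval, this]
    simp [Mem.setVar, h.nodes]
  · simp [Expr.eval, Mem.setVar, h12]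
  · simp [Expr.eval, Mem.setVar]
  · intro x hx
    simp
  · have k3 : s1.var 3 = r := (f1.var 3 rfl).trans h.root
    have k12 : s1.var 12 = u := (f1.var 12 rfl).trans h12
    have k1 : s1.arr 1 0 u = y u := by rw [f1.arr 1 rfl]; exact hy u hu
    have k4 : ∀ v < n, s1.arr 4 0 v = g v := fun v hv => by
      rw [f1.arr 4 rfl]; exact h.parent v hv
    have hlt := hg.iterate_lt hu c
    have hlev := hg.level_iterate hu c
    refine Runs.ite (fun ht => Runs.skip ⟨?_, ?_, ?_⟩) (fun ht => ?_) <;>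
      simp only [Test.holds, Expr.eval, i1, k3, Nat.cast_inj] at ht
    · rw [Function.iterate_succ_apply', ht, hg.map_root, i1, ht]
    · rw [i2]
      rw [ht, level_root] at hlev
      congr 1
      omega
    · intro x hx
      rw [Function.iterate_succ_apply', ht, hg.map_root, i3 x hx, ht]
    · refine Runs.seq (Runs.setArr (Runs.seq (Runs.setVar (Runs.setVar ⟨?_, ?_, ?_⟩))))
      · simp only [Mem.setVar, Mem.setArr, Expr.eval, i1]
        norm_num
        rw [← Function.iterate_succ_apply g c u, Function.iterate_succ_apply', k4 _ hlt]
      · have := hg.level_pos hlt ht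
        simp only [Mem.setVar, Mem.setArr, Expr.eval, i2]
        norm_num
        omega
      · intro x hx
        simp only [Mem.setVar, Mem.setArr, Expr.eval, i1, k12]
        norm_num
        rw [k1, ← Function.iterate_succ_apply g c u, Function.iterate_succ_apply']
        have hself : ¬ ∃ i, g^[i] (g (g^[c] u)) = g^[c] u := by
          rintro ⟨i, hi⟩
          have h1 := hg.level_iterate (hg.map_lt _ hlt) i
          rw [hi, hg.level_succ hlt ht] at h1
          omega
        by_cases hxc : x = g^[c] u
        · subst hxc
          rw [if_pos rfl, i3 _ hx, if_neg (fun h => h.2 ⟨0, rfl⟩),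
            if_pos ⟨⟨c, rfl⟩, not_exists.1 hself⟩, add_zero]
        · rw [if_neg hxc, i3 x hx]
          have : (∃ i, g^[i] (g^[c] u) = x) ↔ ∃ i, g^[i] (g (g^[c] u)) = x := by
            constructor
            · rintro ⟨i, hi⟩
              cases i with
              | zero => exact absurd hi.symm hxc
              | succ i => exact ⟨i, by rwa [← Function.iterate_succ_apply]⟩
            · rintro ⟨i, hi⟩
              exact ⟨i + 1, by rwa [Function.iterate_succ_apply]⟩
          simp only [this, not_exists]
  · have hroot : g^[n] u = r := hg.iterate_eq_root hu (hg.level_lt hu).le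
    have k3 : s1.var 3 = r := (f1.var 3 rfl).trans h.root
    have k12 : s1.var 12 = u := (f1.var 12 rfl).trans h12
    have k1 : s1.arr 1 0 u = y u := by rw [f1.arr 1 rfl]; exact hy u hu
    have k7 : s1.arr 7 = s.arr 7 := f1.arr 7 rfl
    rw [min_eq_right (hg.level_lt hu).le] at i2
    rw [hroot] at i3
    refine Runs.seq (Runs.setArr (Runs.setArr ⟨fun x hx => ?_, fun w => ?_⟩))
    · simp only [Mem.setArr, Expr.eval, k3, k12]
      norm_num
      rw [k1]
      have hb : (∃ i, g^[i] r = x) ↔ x = r := by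
        simp only [hg.iterate_root, exists_const, eq_comm]
      have hb' := hg.reaches u hu
      by_cases hxr : x = r
      · subst hxr
        rw [if_pos rfl, i3 _ hx, if_neg (fun h => h.2 (hb.2 rfl)), if_pos hb', add_zero]
      · rw [if_neg hxr, i3 x hx]
        simp only [hb, hxr, not_false_iff, and_true]
    · simp only [Mem.setArr, Expr.eval, k12, i2]
      norm_num
      rw [k7]

theorem masses_runs (h : TreeMem n m r g s) (hg : IsTree n r g) (hn : n ≤ X)
    (hy : ∀ u < n, s.arr 1 0 u = y u) :
    Runs X masses (fun s' => (∀ x < n, s'.arr 6 0 x = mass n g y x) ∧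
      ∀ w < n, s'.arr 7 0 w = level r g w) s := by
  classical
  refine Runs.seq (Runs.forTo (fun u s' => ∀ x < u, s'.arr 6 0 x = 0) n hn rfl
    (fun _ _ _ h => h) (fun i s' _ hf _ _ => ?_) (by simp) (fun u s1 hu f1 h12 hI => ?_)
    (fun s1 f1 _ h0 => ?_))
  · simp [Expr.eval, hf.var 6 rfl, h.nodes]
  · refine Runs.setArr fun x hx => ?_
    simp only [Mem.setArr, Expr.eval, h12]
    norm_num
    intro hxu
    exact hI x (by omega)
  have t1 := h.frame f1 rfl rfl rfl rfl
  have hy1 : ∀ u < n, s1.arr 1 0 u = y u := fun u hu => by rw [f1.arr 1 rfl]; exact hy u hu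
  refine Runs.forTo (fun u s' => (∀ x < n, s'.arr 6 0 x = ∑ w ∈ Finset.range u,
      if ∃ i, g^[i] w = x then y w else 0) ∧ ∀ w < u, s'.arr 7 0 w = level r g w) n hn rfl
    (fun _ _ _ h => h) (fun i s' _ hf _ _ => ?_) ⟨fun x hx => by simpa using h0 x hx, by simp⟩
    (fun u s2 hu f2 h12 hI => ?_) (fun s2 _ _ hI => ⟨fun x hx => ?_, hI.2⟩)
  · simp [Expr.eval, hf.var 6 rfl, t1.nodes]
  · refine Runs.mono (addMass_runs (y := y) (t1.frame f2 rfl rfl rfl rfl) hg hn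
      (fun u hu => by rw [f2.arr 1 rfl]; exact hy1 u hu) hu h12)
      fun s3 f3 ⟨h1, h2⟩ => ⟨fun x hx => ?_, fun w hw => ?_⟩
    · rw [h1 x hx, hI.1 x hx, Finset.sum_range_succ]
    · rw [h2]
      split_ifs with hwu
      · rw [hwu]
      · exact hI.2 w (by omega)
  · rw [hI.1 x hx, mass]

theorem setRoot_runs {k : ℕ} (h : TreeMem n m r g s) (h1 : s.var 1 = k) (hm : m ≤ X) :
    Runs X setRoot (fun s' => (∀ i < m, s'.arr 3 i r = k) ∧
      ∀ i w, w ≠ r → s'.arr 3 i w = s.arr 3 i w) s := by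
  refine Runs.forTo (fun i s' => (∀ j < i, s'.arr 3 j r = k) ∧
      ∀ i w, w ≠ r → s'.arr 3 i w = s.arr 3 i w) m hm rfl
    (fun _ _ _ h => h) (fun i s' _ hf _ _ => ?_) (by simp) (fun i s1 hi f1 h19 hI => ?_)
    (fun s1 f1 _ h0 => h0)
  · simp [Expr.eval, hf.var 2 rfl, h.rows]
  · refine Runs.setArr ⟨fun j hj => ?_, fun j w hw => ?_⟩ <;>
      simp only [Mem.setArr, Expr.eval, h19, f1.var 3 rfl, h.root, f1.var 1 rfl, h1] <;> norm_num
    · intro hji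
      exact hI.1 j (by omega)
    · rw [if_neg fun h => hw h.2]
      exact hI.2 j w hw

/-- The children of `p` in `A'` are balanced, with masses `t`, and the number of changes from `A`
is bounded. -/
structure NodeDone (m : ℕ) (K : Finset ℕ) (p : ℕ) (t : ℕ → ℤ) (A A' : ℕ → ℕ → ℤ) : Prop where
  balanced : ∀ v ∈ K, Balanced m fun i => A' i v
  sum : ∀ v ∈ K, ∑ i ∈ Finset.range m, A' i v = t v
  row : ∀ i < m, ∀ i' < m, ∑ v ∈ K, A' i v ≤ A' i p ∨ A' i' p ≤ ∑ v ∈ K, A' i' v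
  change : ∑ v ∈ K, ∑ i ∈ Finset.range m, |A' i v - A i v| ≤
    ∑ i ∈ Finset.range m, |∑ v ∈ K, A i v - A' i p| +
      2 * ∑ v ∈ K, |t v - ∑ i ∈ Finset.range m, A i v|

theorem NodeDone.congr {K : Finset ℕ} {p : ℕ} {t : ℕ → ℤ} {A A' A'' : ℕ → ℕ → ℤ}
    (h : NodeDone m K p t A A') (hK : ∀ i, ∀ v ∈ K, A'' i v = A' i v)
    (hp : ∀ i, A'' i p = A' i p) : NodeDone m K p t A A'' := by
  refine ⟨fun v hv => ?_, fun v hv => ?_, fun i hi i' hi' => ?_, ?_⟩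
  · simp only [hK _ v hv]
    exact h.balanced v hv
  · simp only [hK _ v hv]
    exact h.sum v hv
  · rw [Finset.sum_congr rfl (hK i), Finset.sum_congr rfl (hK i'), hp, hp]
    exact h.row i hi i' hi'
  · simp only [hp]
    refine le_trans (le_of_eq ?_) h.change
    exact Finset.sum_congr rfl fun v hv => Finset.sum_congr rfl fun i _ => by rw [hK i v hv]

/-- In the loops over the levels and the nodes of each level, the nodes already treated are done and
the others still have their old children. -/
structure Processed (n m r : ℕ) (g : ℕ → ℕ) (t : ℕ → ℤ) (A : ℕ → ℕ → ℤ) (D : ℕ → Prop)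
    (A' : ℕ → ℕ → ℤ) : Prop where
  done : ∀ p < n, D p → NodeDone m (kids n r g p) p t A A'
  rest : ∀ p < n, ¬ D p → ∀ i, ∀ v ∈ kids n r g p, A' i v = A i v
  root : ∀ i, A' i r = A i r

theorem rebalanceAll_runs {t : ℕ → ℤ} (h : TreeMem n m r g s) (hg : IsTree n r g) (hm0 : 0 < m)
    (hm : m ≤ X) (hn : n ≤ X) (h6 : ∀ v < n, s.arr 6 0 v = t v)
    (h7 : ∀ v < n, s.arr 7 0 v = level r g v)
    (hX : ∀ v < n, v ≠ r → |t v - ∑ i ∈ Finset.range m, s.arr 3 i v| ≤ X)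
    (hbal : ∀ v < n, Balanced m fun i => s.arr 3 i v) :
    Runs X rebalanceAll (fun s' => Processed n m r g t (s.arr 3) (fun _ => True) (s'.arr 3)) s := by
  refine Runs.forTo (fun d s' => Processed n m r g t (s.arr 3) (fun p => level r g p < d)
      (s'.arr 3)) n hn rfl (fun _ _ _ h => h) (fun i s' _ hf _ _ => ?_)
    ⟨by simp, fun _ _ _ _ _ _ => rfl, fun _ => rfl⟩ (fun d s1 hd f1 h11 hI => ?_)
    (fun s1 f1 _ hI => ⟨fun p hp _ => hI.done p hp (hg.level_lt hp), by simp, hI.root⟩)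
  · simp [Expr.eval, hf.var 6 rfl, h.nodes]
  have t1 := h.frame f1 rfl rfl rfl rfl
  have congrD : ∀ {D D' : ℕ → Prop} {A' : ℕ → ℕ → ℤ}, (∀ p < n, (D p ↔ D' p)) →
      Processed n m r g t (s.arr 3) D A' → Processed n m r g t (s.arr 3) D' A' :=
    fun hD hP => ⟨fun p hp h => hP.done p hp ((hD p hp).2 h),
      fun p hp h => hP.rest p hp fun h' => h ((hD p hp).1 h'), hP.root⟩
  refine Runs.forTo (fun u s' => Processed n m r g t (s.arr 3)
      (fun p => level r g p < d ∨ (level r g p = d ∧ p < u)) (s'.arr 3)) n hn rfl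
    (fun _ _ _ h => h) (fun i s' _ hf _ _ => ?_) (congrD (fun p _ => by simp) hI)
    (fun u s2 hu f2 h12 hJ => ?_) (fun s2 _ _ hJ => congrD (fun p hp => by omega) hJ)
  · simp [Expr.eval, hf.var 6 rfl, t1.nodes]
  have t2 := t1.frame f2 rfl rfl rfl rfl
  have k11 : s2.var 11 = d := (f2.var 11 rfl).trans h11
  have k7 : ∀ v < n, s2.arr 7 0 v = level r g v := fun v hv => by
    rw [f2.arr 7 rfl, f1.arr 7 rfl]; exact h7 v hv
  have k6 : ∀ v < n, s2.arr 6 0 v = t v := fun v hv => by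
    rw [f2.arr 6 rfl, f1.arr 6 rfl]; exact h6 v hv
  refine Runs.ite (fun ht => ?_) (fun ht => Runs.skip (congrD (fun p hp => ?_) hJ)) <;>
    simp only [Test.holds, Expr.eval, h12, k11, Int.toNat_natCast, Int.toNat_zero, k7 u hu,
      Nat.cast_inj] at ht
  · have hnd : ¬ (level r g u < d ∨ (level r g u = d ∧ u < u)) := by omega
    have hold := hJ.rest u hu hnd
    have hB : Balanced m fun i => s2.arr 3 i u := by
      by_cases hur : u = r
      · simp only [hur, hJ.root]
        exact hbal r hg.root_lt
      · exact (hJ.done (g u) (hg.map_lt u hu) (Or.inl (by rw [← ht, hg.level_succ hu hur]; omega))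
          ).balanced u (mem_kids.2 ⟨hu, hur, rfl⟩)
    refine Runs.mono (rebalance_runs t2 h12 hm0 hm hn hg.not_mem_kids_self (fun v hv => ?_)
      (fun v hv => ?_) hB) fun s3 f3 hR => ⟨fun q hq hD => ?_, fun q hq hD i v hv => ?_, fun i => ?_⟩
    · simp only [hold _ v hv, k6 v (mem_kids.1 hv).1]
      exact hX v (mem_kids.1 hv).1 (mem_kids.1 hv).2.1
    · simp only [hold _ v hv]
      exact hbal v (mem_kids.1 hv).1
    · by_cases hqu : q = u
      · subst hqu
        have hother := fun i => hR.other i q hg.not_mem_kids_self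
        refine ⟨hR.balanced, fun v hv => ?_, fun i hi i' hi' => ?_, ?_⟩
        · rw [hR.sum v hv, k6 v (mem_kids.1 hv).1]
        · rw [hother, hother]
          exact hR.row i hi i' hi'
        · have e1 : ∀ i, ∑ v ∈ kids n r g q, s2.arr 3 i v = ∑ v ∈ kids n r g q, s.arr 3 i v :=
            fun i => Finset.sum_congr rfl fun v hv => hold i v hv
          have e2 : ∑ v ∈ kids n r g q, |s2.arr 6 0 v - ∑ i ∈ Finset.range m, s2.arr 3 i v| =
              ∑ v ∈ kids n r g q, |t v - ∑ i ∈ Finset.range m, s.arr 3 i v| :=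
            Finset.sum_congr rfl fun v hv => by simp only [hold _ v hv, k6 v (mem_kids.1 hv).1]
          have e3 : ∑ v ∈ kids n r g q, ∑ i ∈ Finset.range m, |s3.arr 3 i v - s2.arr 3 i v| =
              ∑ v ∈ kids n r g q, ∑ i ∈ Finset.range m, |s3.arr 3 i v - s.arr 3 i v| :=
            Finset.sum_congr rfl fun v hv => by simp only [hold _ v hv]
          have := hR.change
          rw [e2, e3] at this
          simp only [e1] at this
          simpa only [hother] using this
      · refine (hJ.done q hq (by omega)).congr (fun i v hv => hR.other i v fun hv' => hqu ?_)
          (fun i => hR.other i q fun hq' => ?_)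
        · exact (mem_kids.1 hv).2.2.symm.trans (mem_kids.1 hv').2.2
        · have := hg.level_kid hq'
          omega
    · have hqu : q ≠ u := by rintro rfl; exact hD (by omega)
      rw [hR.other i v fun hv' => hqu ((mem_kids.1 hv).2.2.symm.trans (mem_kids.1 hv').2.2)]
      exact hJ.rest q hq (by omega) i v hv
    · rw [hR.other i r fun hr => (mem_kids.1 hr).2.1 rfl]
      exact hJ.root i
  · constructor
    · omega
    · rintro (h | ⟨h, h'⟩)
      · exact Or.inl h
      · rcases Nat.lt_succ_iff_lt_or_eq.1 h' with h' | rfl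
        · exact Or.inr ⟨h, h'⟩
        · exact absurd h ht

/-- The number of servers at `p` in a configuration with counts `a`, when the masses are `y`. -/
def outputCount (y a : ℕ → ℤ) (p : ℕ) : ℕ := if 1 ≤ y p then (a p).toNat else 0

theorem output_runs {N : ℕ} (h2 : s.var 2 = m) (h0 : s.var 0 = N) (hm : m ≤ X) (hN : N ≤ X)
    (hy : ∀ u < N, s.arr 1 0 u = y u) (hX : ∀ i < m, ∀ p < N, (s.arr 3 i p).toNat ≤ X) :
    Runs X output (fun s' => ∀ i < m, Lists N (outputCount y (s.arr 3 i)) (s'.arr 2 i)) s := by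
  refine Runs.forTo (fun i s' => ∀ j < i, Lists N (outputCount y (s.arr 3 j)) (s'.arr 2 j))
    m hm rfl (fun _ _ _ h => h) (fun i s' _ hf _ _ => ?_) (by simp)
    (fun i s1 hi f1 h19 hI => ?_) (fun _ _ _ h => h)
  · simp [Expr.eval, hf.var 2 rfl, h2]
  refine Runs.seq (Runs.setVar ?_)
  set a := outputCount y (s.arr 3 i) with ha
  let J : ℕ → Mem → Prop := fun L s' => s'.var 14 = L ∧
    (∀ j < i, Lists N (outputCount y (s.arr 3 j)) (s'.arr 2 j)) ∧
    ∀ q < N, ∀ l, ∑ p ∈ Finset.range q, a p ≤ l → l < ∑ p ∈ Finset.range (q + 1), a p → l < L →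
      s'.arr 2 i l = q
  refine Runs.forTo (fun p => J (∑ q ∈ Finset.range p, a q)) N hN rfl
    (fun _ _ _ h => h) (fun p s' _ hf _ _ => ?_) ⟨by simp [Expr.eval], hI, by simp⟩
    (fun p s2 hp f2 h12 hJ => ?_) (fun s2 _ _ hJ j hj => ?_)
  · have := hf.var 0 rfl
    simp only [Expr.eval, this]
    simp [Mem.setVar, f1.var 0 rfl, h0]
  · have k19 : s2.var 19 = i := (f2.var 19 rfl).trans h19
    have k3 : s2.arr 3 = s.arr 3 := (f2.arr 3 rfl).trans (f1.arr 3 rfl)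
    have k1 : s2.arr 1 0 p = y p := by
      rw [f2.arr 1 rfl]
      exact (congrFun (congrFun (f1.arr 1 rfl) 0) p).trans (hy p hp)
    refine Runs.ite (fun ht => ?_) (fun ht => Runs.skip ?_) <;>
      simp only [Test.holds, Expr.eval, h12, Int.toNat_natCast, Int.toNat_zero, k1] at ht
    · have hap : a p = (s.arr 3 i p).toNat := by simp only [ha, outputCount, if_pos ht]
      refine Runs.forTo (fun c => J (∑ q ∈ Finset.range p, a q + c)) (a p)
        (by rw [hap]; exact hX i hi p hp) rfl
        (fun _ _ _ h => h) (fun c s' _ hf _ _ => ?_) hJ (fun c s3 hc f3 _ hJ' => ?_)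
        (fun s3 _ _ hJ' => ?_)
      · simp [Expr.eval, hf.var 19 rfl, hf.var 12 rfl, hf.arr 3 rfl, h12, k19, k3, hap]
      · obtain ⟨j1, j2, j3⟩ := hJ'
        have k19' : s3.var 19 = i := (f3.var 19 rfl).trans k19
        have k12' : s3.var 12 = p := (f3.var 12 rfl).trans h12
        refine Runs.seq (Runs.setArr (Runs.setVar ⟨?_, fun j hj => ?_, fun q hq l l1 l2 l3 => ?_⟩))
        · simp [Expr.eval, j1]
          ring
        · intro q hq l l1 l2
          simp only [Mem.setVar_arr, Mem.setArr, Expr.eval, k19', Int.toNat_natCast]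
          rw [if_neg (by rintro ⟨-, h, -⟩; omega)]
          exact j2 j hj q hq l l1 l2
        · simp only [Mem.setVar_arr, Mem.setArr, Expr.eval, k19', k12', j1, Int.toNat_natCast,
            true_and]
          by_cases hl : l = ∑ q ∈ Finset.range p, a q + c
          · rw [if_pos hl]
            subst hl
            have hc' : ∑ q ∈ Finset.range p, a q + c < ∑ q ∈ Finset.range (p + 1), a q := by
              rw [Finset.sum_range_succ]
              exact Nat.add_lt_add_left hc _
            rw [block_unique l1 l2 (Nat.le_add_right _ _) hc']
          · rw [if_neg hl]
            exact j3 q hq l l1 l2 (by omega)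
      · rwa [Finset.sum_range_succ]
    · have hap : a p = 0 := by simp only [ha, outputCount, if_neg ht]
      rw [Finset.sum_range_succ, hap, add_zero]
      exact hJ
  · rcases Nat.lt_succ_iff_lt_or_eq.1 hj with hj | rfl
    · exact hJ.2.1 j hj
    · exact fun q hq l l1 l2 => hJ.2.2 q hq l l1 l2 (l2.trans_le (prefix_mono a
        (show q + 1 ≤ N from hq)))

end Specs

/-! ### Building the refined tree -/

/-- The classes of the heaviest children of the root have been formed; the last of them has the
node `prev`, and the remaining children still hang below the root. -/
structure Grouping {N : ℕ} (T : WTree N) (g : ℕ → ℕ) (prev : ℕ) : Prop where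
  map_root : g T.root = T.root
  inner : ∀ v : Fin N, v ≠ T.root → T.parent v ≠ T.root → g v = T.parent v
  top : ∀ v : Fin N, T.IsChild v T.root → g v = T.root ∨ ∃ h : Fin N, T.IsChild h T.root ∧
    g v = N + h ∧ g h = N + h ∧ T.weight v ≤ T.weight h ∧ T.weight h ≤ 2 * T.weight v
  virt : ∀ h : Fin N, g (N + h) = T.root ∨ ∃ h' : Fin N, T.IsChild h' T.root ∧
    g (N + h) = N + h' ∧ g h' = N + h' ∧ 2 * T.weight h < T.weight h'
  uniq : ∀ h h' : Fin N, g h = N + h → g h' = N + h' → g (N + h) = g (N + h') → h = h'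
  newest : (prev = T.root ∧ ∀ h : Fin N, g h ≠ N + h) ∨ ∃ p : Fin N, prev = N + p ∧ g p = N + p ∧
    T.IsChild p T.root ∧
    ∀ v : Fin N, T.IsChild v T.root → g v = T.root → 2 * T.weight v < T.weight p
  last : ∀ h : Fin N, g h = N + h → g (N + h) ≠ prev

/-- The children of the root that are not in a class yet. -/
def free {N : ℕ} (T : WTree N) (g : ℕ → ℕ) : Finset (Fin N) :=
  Finset.univ.filter fun v => v ≠ T.root ∧ g v = T.root

theorem mem_free {N : ℕ} {T : WTree N} {g : ℕ → ℕ} {v : Fin N} :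
    v ∈ free T g ↔ v ≠ T.root ∧ g v = T.root := by simp [free]

namespace Grouping

variable {N : ℕ} {T : WTree N} {g : ℕ → ℕ} {prev : ℕ}

theorem refines (h : Grouping T g prev) (hf : free T g = ∅) : Refines T g := by
  refine ⟨h.map_root, h.inner, fun v hv => (h.top v hv).resolve_left fun hv' => ?_, h.virt, h.uniq⟩
  have : v ∈ free T g := mem_free.2 ⟨hv.1, hv'⟩
  rw [hf] at this
  exact absurd this (Finset.notMem_empty v)

theorem isChild_of_mem_free (h : Grouping T g prev) {v : Fin N} (hv : v ∈ free T g) :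
    T.IsChild v T.root := by
  obtain ⟨h1, h2⟩ := mem_free.1 hv
  refine ⟨h1, by_contra fun h3 => h3 ?_⟩
  rw [h.inner v h1 h3] at h2
  exact Fin.ext h2

theorem start (hN : ∀ v : Fin N, g v = T.parent v) (hN' : ∀ v : Fin N, g (N + v) = T.root) :
    Grouping T g T.root := by
  refine ⟨by rw [hN, T.parent_root], fun v _ _ => hN v, fun v hv => Or.inl (by rw [hN, hv.2]),
    fun h => Or.inl (hN' h), fun h h' hh => ?_, Or.inl ⟨rfl, fun h hh => ?_⟩, fun h hh => ?_⟩ <;>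
  · rw [hN] at hh
    omega

theorem step (hG : Grouping T g prev) {h : Fin N} (hh : h ∈ free T g)
    (hmax : ∀ v ∈ free T g, T.weight v ≤ T.weight h) {g' : ℕ → ℕ}
    (hg' : ∀ v : Fin N, g' v =
      if v ∈ free T g ∧ T.weight h ≤ 2 * T.weight v then N + h else g v)
    (hgv' : ∀ q : Fin N, g' (N + q) = if q = h then prev else g (N + q)) :
    Grouping T g' (N + h) ∧ (free T g').card < (free T g).card := by
  have hch := hG.isChild_of_mem_free hh
  have hgh := (mem_free.1 hh).2
  have hused : ∀ q : Fin N, g q = N + q → g' q = N + q := fun q hq => by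
    rw [hg', if_neg, hq]
    rintro ⟨h1, -⟩
    have := (mem_free.1 h1).2
    omega
  have hused' : ∀ q : Fin N, g' q = N + q → q = h ∨ g q = N + q := fun q hq => by
    rw [hg'] at hq
    split_ifs at hq
    · left
      exact Fin.ext (by omega)
    · exact Or.inr hq
  have hnh : g h ≠ N + h := by omega
  have hh' : g' h = N + h := by rw [hg', if_pos ⟨hh, by omega⟩]
  have hnf : ∀ v : Fin N, v ∉ free T g → g' v = g v := fun v hv => by
    rw [hg', if_neg fun h => hv h.1]
  have hfree : ∀ v, v ∈ free T g' → v ∈ free T g ∧ 2 * T.weight v < T.weight h := by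
    intro v hv
    obtain ⟨h1, h2⟩ := mem_free.1 hv
    rw [hg'] at h2
    split_ifs at h2 with h3
    · omega
    · have : v ∈ free T g := mem_free.2 ⟨h1, h2⟩
      exact ⟨this, by by_contra hc; exact h3 ⟨this, by omega⟩⟩
  refine ⟨⟨?_, fun v hv hp => ?_, fun v hv => ?_, fun q => ?_, fun q q' hq hq' hqq => ?_,
    Or.inr ⟨h, rfl, hh', hch, fun v hv hv' => (hfree v (mem_free.2 ⟨hv.1, hv'⟩)).2⟩,
    fun q hq => ?_⟩, ?_⟩
  · rw [hnf _ fun h => (mem_free.1 h).1 rfl, hG.map_root]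
  · rw [hnf v fun h => hp (hG.isChild_of_mem_free h).2, hG.inner v hv hp]
  · by_cases hcl : v ∈ free T g ∧ T.weight h ≤ 2 * T.weight v
    · exact Or.inr ⟨h, hch, by rw [hg', if_pos hcl], hh', hmax v hcl.1, hcl.2⟩
    · rw [hg', if_neg hcl]
      rcases hG.top v hv with h1 | ⟨h0, h1, h2, h3, h4⟩
      · exact Or.inl h1
      · exact Or.inr ⟨h0, h1, h2, hused h0 h3, h4⟩
  · rw [hgv']
    split_ifs with hqh
    · subst hqh
      rcases hG.newest with ⟨h1, -⟩ | ⟨p, h1, h2, h3, h4⟩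
      · exact Or.inl h1
      · exact Or.inr ⟨p, h3, h1, hused p h2, h4 q hch hgh⟩
    · rcases hG.virt q with h1 | ⟨h0, h1, h2, h3, h4⟩
      · exact Or.inl h1
      · exact Or.inr ⟨h0, h1, h2, hused h0 h3, h4⟩
  · rw [hgv', hgv'] at hqq
    rcases hused' q hq with rfl | h1 <;> rcases hused' q' hq' with rfl | h2
    · rfl
    · rw [if_pos rfl, if_neg (by rintro rfl; exact hnh h2)] at hqq
      exact absurd hqq.symm (hG.last q' h2)
    · rw [if_pos rfl, if_neg (by rintro rfl; exact hnh h1)] at hqq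
      exact absurd hqq (hG.last q h1)
    · rw [if_neg (by rintro rfl; exact hnh h1), if_neg (by rintro rfl; exact hnh h2)] at hqq
      exact hG.uniq q q' h1 h2 hqq
  · rw [hgv']
    rcases hused' q hq with rfl | h1
    · rw [if_pos rfl]
      rcases hG.newest with ⟨h1, -⟩ | ⟨p, h1, h2, -⟩
      · omega
      · intro h3
        have : p = q := Fin.ext (by omega)
        rw [this] at h2
        exact hnh h2
    · rw [if_neg (by rintro rfl; exact hnh h1)]
      intro h2
      rcases hG.virt q with h3 | ⟨h0, -, h3, h4, -⟩
      · omega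
      · have : h0 = h := Fin.ext (by omega)
        rw [this] at h4
        exact hnh h4
  · refine Finset.card_lt_card (Finset.ssubset_iff_of_subset (fun v hv => (hfree v hv).1) |>.2
      ⟨h, hh, fun h1 => ?_⟩)
    have := (hfree h h1).2
    omega

end Grouping

section Programs

open Prog

def copyParents : Prog :=
  forTo 10 (.var 0) (seq (setArr 4 (.const 0) (.var 10) (.get 0 (.const 0) (.var 10)))
    (setArr 4 (.const 0) (.add (.var 0) (.var 10)) (.var 3)))

def isFree : Test :=
  .and (.not (.eq (.var 10) (.var 3))) (.eq (.get 4 (.const 0) (.var 10)) (.var 3))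

def findHeaviest : Prog :=
  seq (setVar 9 (.const (-1))) (forTo 10 (.var 0)
    (ite (.and isFree (.not (.and (.le (.const 0) (.var 9))
        (.le (.get 0 (.const 1) (.var 10)) (.get 0 (.const 1) (.var 9))))))
      (setVar 9 (.var 10)) skip))

def makeClass : Prog :=
  seq (forTo 10 (.var 0) (ite (.and isFree (.le (.get 0 (.const 1) (.var 9))
      (.add (.get 0 (.const 1) (.var 10)) (.get 0 (.const 1) (.var 10)))))
    (setArr 4 (.const 0) (.var 10) (.add (.var 0) (.var 9))) skip))
  (seq (setArr 4 (.const 0) (.add (.var 0) (.var 9)) (.var 7))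
    (setVar 7 (.add (.var 0) (.var 9))))

def buildTree : Prog :=
  seq copyParents (seq (setVar 7 (.var 3))
    (seq (forTo 8 (.var 0) (seq findHeaviest (ite (.le (.const 0) (.var 9)) makeClass skip)))
      (setVar 5 (.const 1))))

end Programs

/-- The memory contains the input tree. -/
structure InputTree {N : ℕ} (T : WTree N) (s : Mem) : Prop where
  nodes : s.var 0 = N
  root : s.var 3 = ((T.root : ℕ) : ℤ)
  parent : ∀ v : Fin N, s.arr 0 0 v = ((T.parent v : ℕ) : ℤ)
  weight : ∀ v : Fin N, s.arr 0 1 v = T.weight v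

theorem InputTree.frame {N : ℕ} {T : WTree N} {c : Prog} {s s' : Mem} (h : InputTree T s)
    (hf : Frame c s s') (h0 : c.writesVar 0 = false) (h3 : c.writesVar 3 = false)
    (ha : c.writesArr 0 = false) : InputTree T s' :=
  ⟨(hf.var 0 h0).trans h.nodes, (hf.var 3 h3).trans h.root,
    fun v => by rw [hf.arr 0 ha]; exact h.parent v, fun v => by rw [hf.arr 0 ha]; exact h.weight v⟩

section Specs

variable {X N : ℕ} {T : WTree N} {s : Mem} {g : ℕ → ℕ} {prev : ℕ}

theorem copyParents_runs (h : InputTree T s) (hN : N ≤ X) :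
    Runs X copyParents (fun s' => (∀ v : Fin N, s'.arr 4 0 v = ((T.parent v : ℕ) : ℤ)) ∧
      ∀ v : Fin N, s'.arr 4 0 (N + v) = ((T.root : ℕ) : ℤ)) s := by
  refine Runs.forTo (fun i s' => (∀ v : Fin N, v < i → s'.arr 4 0 v = ((T.parent v : ℕ) : ℤ)) ∧
      ∀ v : Fin N, v < i → s'.arr 4 0 (N + v) = ((T.root : ℕ) : ℤ)) N hN rfl
    (fun _ _ _ h => h) (fun i s' _ hf _ _ => ?_) ⟨by simp, by simp⟩ (fun i s1 hi f1 h10 hI => ?_)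
    (fun s1 _ _ hI => ⟨fun v => hI.1 v v.2, fun v => hI.2 v v.2⟩)
  · simp [Expr.eval, hf.var 0 rfl, h.nodes]
  have t1 := h.frame f1 rfl rfl rfl
  have hp := t1.parent ⟨i, hi⟩
  simp only at hp
  have hcast : ((N : ℤ) + (i : ℤ)).toNat = N + i := by omega
  refine Runs.seq (Runs.setArr (Runs.setArr ⟨fun v hv => ?_, fun v hv => ?_⟩)) <;>
    simp only [Mem.setArr, Expr.eval, h10, t1.nodes, t1.root, hcast, hp, Int.toNat_natCast,
      Int.toNat_zero, true_and]
  · rw [if_neg (by omega)]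
    split_ifs with hvi
    · have : v = ⟨i, hi⟩ := Fin.ext hvi
      rw [this]
    · exact hI.1 v (by omega)
  · split_ifs with h1 h2
    · rfl
    · omega
    · exact hI.2 v (by omega)

theorem isFree_holds (h : InputTree T s) (hg : ∀ v < 2 * N, s.arr 4 0 v = g v) {v : Fin N}
    (h10 : s.var 10 = ((v : ℕ) : ℤ)) : isFree.holds s ↔ v ∈ free T g := by
  simp only [isFree, Test.holds, Expr.eval, h10, h.root, Int.toNat_natCast, Int.toNat_zero,
    hg v (by omega), mem_free, Nat.cast_inj, ne_eq, Fin.ext_iff]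

theorem findHeaviest_runs (h : InputTree T s) (hN : N ≤ X) (hg : ∀ v < 2 * N, s.arr 4 0 v = g v) :
    Runs X findHeaviest (fun s' => (s'.var 9 = -1 ∧ free T g = ∅) ∨ ∃ h : Fin N,
      s'.var 9 = ((h : ℕ) : ℤ) ∧ h ∈ free T g ∧ ∀ v ∈ free T g, T.weight v ≤ T.weight h) s := by
  refine Runs.seq (Runs.setVar ?_)
  refine Runs.forTo (fun i s' => (s'.var 9 = -1 ∧ ∀ v ∈ free T g, ¬ v.val < i) ∨ ∃ h : Fin N,
      s'.var 9 = ((h : ℕ) : ℤ) ∧ h ∈ free T g ∧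
        ∀ v ∈ free T g, v.val < i → T.weight v ≤ T.weight h) N hN rfl
    (fun _ _ _ h => h) (fun i s' _ hf _ _ => ?_) (Or.inl ⟨by simp [Expr.eval], by simp⟩)
    (fun i s1 hi f1 h10 hI => ?_) (fun s1 _ _ hI => ?_)
  · have := hf.var 0 rfl
    simp only [Expr.eval, this]
    simp [Mem.setVar, h.nodes]
  · have t0 : InputTree T (s.setVar 9 (Expr.eval s (.const (-1)))) :=
      ⟨h.nodes, h.root, h.parent, h.weight⟩
    have t1 := t0.frame f1 rfl rfl rfl
    have hg1 : ∀ v < 2 * N, s1.arr 4 0 v = g v := fun v hv => by rw [f1.arr 4 rfl]; exact hg v hv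
    have hw := t1.weight ⟨i, hi⟩
    simp only at hw
    have hfr := isFree_holds (v := ⟨i, hi⟩) t1 hg1 h10
    refine Runs.ite (fun ht => Runs.setVar (Or.inr ⟨⟨i, hi⟩, ?_⟩)) (fun ht => Runs.skip ?_) <;>
      simp only [Test.holds, hfr, Expr.eval, h10, Int.toNat_natCast, Int.toNat_one, hw] at ht
    · refine ⟨by simp [Expr.eval, h10], ht.1, fun v hv hvi => ?_⟩
      rcases Nat.lt_succ_iff_lt_or_eq.1 hvi with hvi | hvi
      · rcases hI with ⟨-, h2⟩ | ⟨h', h1, -, h3⟩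
        · exact absurd hvi (h2 v hv)
        · rw [h1, Int.toNat_natCast, t1.weight h'] at ht
          have := h3 v hv hvi
          have h4 := ht.2
          push Not at h4
          have := h4 (Int.natCast_nonneg _)
          omega
      · have : v = ⟨i, hi⟩ := Fin.ext hvi
        rw [this]
    · rcases hI with ⟨h1, h2⟩ | ⟨h', h1, h2, h3⟩
      · refine Or.inl ⟨h1, fun v hv hvi => ?_⟩
        rcases Nat.lt_succ_iff_lt_or_eq.1 hvi with hvi | hvi
        · exact h2 v hv hvi
        · have : v = ⟨i, hi⟩ := Fin.ext hvi
          subst this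
          refine ht ⟨hv, ?_⟩
          rw [h1]
          simp
      · refine Or.inr ⟨h', h1, h2, fun v hv hvi => ?_⟩
        rcases Nat.lt_succ_iff_lt_or_eq.1 hvi with hvi | hvi
        · exact h3 v hv hvi
        · have : v = ⟨i, hi⟩ := Fin.ext hvi
          subst this
          by_contra hc
          refine ht ⟨hv, ?_⟩
          rw [h1, Int.toNat_natCast, t1.weight h']
          omega
  · rcases hI with ⟨h1, h2⟩ | ⟨h', h1, h2, h3⟩
    · exact Or.inl ⟨h1, Finset.eq_empty_of_forall_notMem fun v hv => h2 v hv v.2⟩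
    · exact Or.inr ⟨h', h1, h2, fun v hv => h3 v hv v.2⟩

theorem makeClass_runs (h : InputTree T s) (hN : N ≤ X) (hg : ∀ v < 2 * N, s.arr 4 0 v = g v)
    {q : Fin N} (h9 : s.var 9 = ((q : ℕ) : ℤ)) (h7 : s.var 7 = prev) :
    Runs X makeClass (fun s' => s'.var 7 = ((N + q : ℕ) : ℤ) ∧
      (∀ v : Fin N, s'.arr 4 0 v = ((if v ∈ free T g ∧ T.weight q ≤ 2 * T.weight v
        then N + q else g v : ℕ) : ℤ)) ∧
      ∀ v : Fin N, s'.arr 4 0 (N + v) = ((if v = q then prev else g (N + v) : ℕ) : ℤ)) s := by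
  have hcast : ∀ v : ℕ, ((N : ℤ) + (v : ℤ)).toNat = N + v := fun v => by omega
  refine Runs.seq (Runs.forTo (fun i s' => (∀ v : Fin N, s'.arr 4 0 v =
      ((if v.val < i ∧ v ∈ free T g ∧ T.weight q ≤ 2 * T.weight v then N + q else g v : ℕ) : ℤ)) ∧
      ∀ v : Fin N, s'.arr 4 0 (N + v) = ((g (N + v) : ℕ) : ℤ)) N hN rfl
    (fun _ _ _ h => h) (fun i s' _ hf _ _ => ?_) ⟨fun v => ?_, fun v => hg _ (by omega)⟩
    (fun i s1 hi f1 h10 hI => ?_) (fun s1 f1 _ hI => ?_))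
  · simp [Expr.eval, hf.var 0 rfl, h.nodes]
  · rw [if_neg (by omega)]
    exact hg v (by omega)
  · have t1 := h.frame f1 rfl rfl rfl
    have k9 : s1.var 9 = ((q : ℕ) : ℤ) := (f1.var 9 rfl).trans h9
    have hw := t1.weight ⟨i, hi⟩
    have hgi := hI.1 ⟨i, hi⟩
    simp only [lt_irrefl, false_and, if_false] at hw hgi
    have hcond : (Test.and isFree (.le (.get 0 (.const 1) (.var 9))
        (.add (.get 0 (.const 1) (.var 10)) (.get 0 (.const 1) (.var 10))))).holds s1 ↔
        (⟨i, hi⟩ : Fin N) ∈ free T g ∧ T.weight q ≤ 2 * T.weight ⟨i, hi⟩ := by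
      simp only [isFree, Test.holds, Expr.eval, h10, k9, t1.root, Int.toNat_natCast,
        Int.toNat_zero, Int.toNat_one, hgi, hw, t1.weight q, mem_free, Nat.cast_inj, ne_eq,
        Fin.ext_iff]
      omega
    have hne : ∀ v : Fin N, (v : ℕ) ≠ i → ((v : ℕ) < i + 1 ↔ (v : ℕ) < i) := fun v hv => by omega
    refine Runs.ite (fun ht => Runs.setArr ⟨fun v => ?_, fun v => ?_⟩)
      (fun ht => Runs.skip ⟨fun v => ?_, hI.2⟩) <;> rw [hcond] at ht
    · simp only [Mem.setArr, Expr.eval, h10, k9, t1.nodes, Int.toNat_natCast, Int.toNat_zero,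
        true_and]
      by_cases hvi : (v : ℕ) = i
      · have : v = ⟨i, hi⟩ := Fin.ext hvi
        subst this
        rw [if_pos rfl, if_pos ⟨Nat.lt_succ_self _, ht⟩]
        push_cast
        rfl
      · rw [if_neg hvi, hI.1 v]
        simp only [hne v hvi]
    · simp only [Mem.setArr, Expr.eval, h10, Int.toNat_natCast, Int.toNat_zero, true_and]
      rw [if_neg (by omega)]
      exact hI.2 v
    · by_cases hvi : (v : ℕ) = i
      · have : v = ⟨i, hi⟩ := Fin.ext hvi
        subst this
        rw [if_neg fun h => ht h.2]
        exact hgi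
      · rw [hI.1 v]
        simp only [hne v hvi]
  · have t1 := h.frame f1 rfl rfl rfl
    have k9 : s1.var 9 = ((q : ℕ) : ℤ) := (f1.var 9 rfl).trans h9
    have k7 : s1.var 7 = prev := (f1.var 7 rfl).trans h7
    refine Runs.seq (Runs.setArr (Runs.setVar ⟨?_, fun v => ?_, fun v => ?_⟩))
    · simp [Expr.eval, t1.nodes, k9]
    · simp only [Mem.setVar_arr, Mem.setArr, Expr.eval, t1.nodes, k9, k7, hcast, Int.toNat_zero,
        true_and]
      rw [if_neg (by omega), hI.1 v]
      simp only [v.2, true_and]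
    · simp only [Mem.setVar_arr, Mem.setArr, Expr.eval, t1.nodes, k9, k7, hcast, Int.toNat_zero,
        true_and, hI.2 v, Nat.add_left_cancel_iff, Fin.val_inj]
      split_ifs <;> rfl

theorem buildTree_runs (h : InputTree T s) (hN : N ≤ X) :
    Runs X buildTree (fun s' => s'.var 5 = 1 ∧
      ∃ g, Refines T g ∧ ∀ v < 2 * N, s'.arr 4 0 v = g v) s := by
  refine Runs.seq (Runs.mono (copyParents_runs h hN) fun s1 f1 ⟨h1, h2⟩ => ?_)
  have t1 := h.frame f1 rfl rfl rfl
  refine Runs.seq (Runs.setVar (Runs.seq ?_))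
  have split : ∀ {P : ℕ → Prop}, (∀ v : Fin N, P v) → (∀ v : Fin N, P (N + v)) →
      ∀ v < 2 * N, P v := by
    intro P h1 h2 v hv
    rcases lt_or_ge v N with h | h
    · exact h1 ⟨v, h⟩
    · have := h2 ⟨v - N, by omega⟩
      rwa [Nat.add_sub_cancel' h] at this
  refine Runs.forTo (fun c s' => ∃ g prev, Grouping T g prev ∧ (∀ v < 2 * N, s'.arr 4 0 v = g v) ∧
      s'.var 7 = prev ∧ ((free T g).card + c ≤ N ∨ free T g = ∅)) N hN rfl
    (fun _ _ _ h => h) (fun i s' _ hf _ _ => ?_) ?_ (fun c s2 hc f2 _ hI => ?_)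
    (fun s2 f2 _ hI => ?_)
  · have := hf.var 0 rfl
    simp only [Expr.eval, this]
    simp [Mem.setVar, t1.nodes]
  · refine ⟨fun v => if hv : v < N then T.parent ⟨v, hv⟩ else T.root, T.root,
      Grouping.start (fun v => by simp) (fun v => by simp),
      split (fun v => by simpa using h1 v) (fun v => by simpa using h2 v),
      by simp [Expr.eval, t1.root], Or.inl ?_⟩
    rw [add_zero]
    exact (Finset.card_le_univ _).trans_eq (Fintype.card_fin N)
  · obtain ⟨g, prev, hG, hg, h7, hcard⟩ := hI
    have t2' : InputTree T (s1.setVar 7 (Expr.eval s1 (.var 3))) :=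
      ⟨t1.nodes, t1.root, t1.parent, t1.weight⟩
    have t2 := t2'.frame f2 rfl rfl rfl
    refine Runs.seq (Runs.mono (findHeaviest_runs t2 hN hg) fun s3 f3 hh => ?_)
    have t3 := t2.frame f3 rfl rfl rfl
    have hg3 : ∀ v < 2 * N, s3.arr 4 0 v = g v := fun v hv => by rw [f3.arr 4 rfl]; exact hg v hv
    have k7 : s3.var 7 = prev := (f3.var 7 rfl).trans h7
    refine Runs.ite (fun ht => ?_) (fun ht => Runs.skip ?_) <;>
      simp only [Test.holds, Expr.eval] at ht <;> rcases hh with ⟨h9, hf⟩ | ⟨q, h9, hq, hmax⟩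
    · omega
    · refine Runs.mono (makeClass_runs t3 hN hg3 h9 k7) fun s4 _ ⟨h1, h2, h3⟩ => ?_
      let g' : ℕ → ℕ := fun j => if hj : j < N then
          (if (⟨j, hj⟩ : Fin N) ∈ free T g ∧ T.weight q ≤ 2 * T.weight ⟨j, hj⟩ then N + q else g j)
        else if j = N + q then prev else g j
      have e1 : ∀ v : Fin N, g' v =
          if v ∈ free T g ∧ T.weight q ≤ 2 * T.weight v then N + q else g v := fun v => by simp [g']
      have e2 : ∀ v : Fin N, g' (N + v) = if v = q then prev else g (N + v) := fun v => by
        simp [g', Fin.ext_iff]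
      obtain ⟨hG', hlt⟩ := hG.step hq hmax e1 e2
      refine ⟨g', N + q, hG', split (fun v => by rw [h2 v, e1]) (fun v => by rw [h3 v, e2]), h1, ?_⟩
      left
      rcases hcard with hcard | hcard
      · omega
      · rw [hcard] at hlt
        simp at hlt
    · exact ⟨g, prev, hG, hg3, k7, Or.inr hf⟩
    · omega
  · obtain ⟨g, prev, hG, hg, -, hcard⟩ := hI
    have hempty : free T g = ∅ := by
      rcases hcard with hcard | hcard
      · exact Finset.card_eq_zero.1 (by omega)
      · exact hcard
    exact Runs.setVar ⟨by simp [Expr.eval], g, hG.refines hempty, hg⟩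

end Specs

/-! ### Online conversion on trees -/

theorem Balanced.ge {m : ℕ} {a : ℕ → ℤ} {c : ℤ} (h : Balanced m a)
    (hs : m * c ≤ ∑ i ∈ Finset.range m, a i) {i : ℕ} (hi : i < m) : c ≤ a i := by
  by_contra hc
  have : ∑ j ∈ Finset.range m, a j < ∑ j ∈ Finset.range m, c := by
    refine Finset.sum_lt_sum (fun j hj => ?_) ⟨i, Finset.mem_range.2 hi, not_le.1 hc⟩
    have := h j (Finset.mem_range.1 hj) i hi
    omega
  simp only [Finset.sum_const, Finset.card_range, nsmul_eq_mul] at this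
  omega

theorem Balanced.le {m : ℕ} {a : ℕ → ℤ} {c : ℤ} (h : Balanced m a)
    (hs : ∑ i ∈ Finset.range m, a i ≤ m * c) {i : ℕ} (hi : i < m) : a i ≤ c := by
  by_contra hc
  have : ∑ j ∈ Finset.range m, c < ∑ j ∈ Finset.range m, a j := by
    refine Finset.sum_lt_sum (fun j hj => ?_) ⟨i, Finset.mem_range.2 hi, not_le.1 hc⟩
    have := h i hi j (Finset.mem_range.1 hj)
    omega
  simp only [Finset.sum_const, Finset.card_range, nsmul_eq_mul] at this
  omega

/-- The numbers `A i p` of servers of the `i`-th configuration below the node `p` are balanced and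
fit the masses `y`. -/
structure Servers (n m r k : ℕ) (g : ℕ → ℕ) (y : ℕ → ℤ) (A : ℕ → ℕ → ℤ) : Prop where
  root : ∀ i < m, A i r = k
  balanced : ∀ v < n, Balanced m fun i => A i v
  sum : ∀ v < n, ∑ i ∈ Finset.range m, A i v = mass n g y v
  row : ∀ p < n, ∀ i < m, A i p = (if y p = 0 then 0 else A i p) + ∑ v ∈ kids n r g p, A i v

theorem mass_nonneg {n : ℕ} {g : ℕ → ℕ} {y : ℕ → ℤ} (hy : ∀ u < n, 0 ≤ y u) (p : ℕ) :
    0 ≤ mass n g y p :=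
  Finset.sum_nonneg fun u hu => by
    split_ifs
    · exact hy u (Finset.mem_range.1 hu)
    · exact le_rfl

theorem mass_le_sum {n : ℕ} {g : ℕ → ℕ} {y : ℕ → ℤ} (hy : ∀ u < n, 0 ≤ y u) (p : ℕ) :
    mass n g y p ≤ ∑ u ∈ Finset.range n, y u :=
  Finset.sum_le_sum fun u hu => by
    split_ifs
    · exact le_rfl
    · exact hy u (Finset.mem_range.1 hu)

/-- A column of change bounds, as produced by rebalancing all nodes. -/
def ChangeBound (n m r : ℕ) (g : ℕ → ℕ) (y : ℕ → ℤ) (A A' : ℕ → ℕ → ℤ) : Prop :=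
  ∀ p < n, ∑ v ∈ kids n r g p, ∑ i ∈ Finset.range m, |A' i v - A i v| ≤
    ∑ i ∈ Finset.range m, |∑ v ∈ kids n r g p, A i v - A' i p| +
      2 * ∑ v ∈ kids n r g p, |mass n g y v - ∑ i ∈ Finset.range m, A i v|

theorem update_runs {X n m r k N : ℕ} {g : ℕ → ℕ} {y : ℕ → ℤ} {s : Mem}
    (h : TreeMem n m r g s) (hg : IsTree n r g) (h0 : s.var 0 = N) (h1 : s.var 1 = k)
    (hm0 : 0 < m) (hm : m ≤ X) (hn : n ≤ X) (hN : N ≤ n) (hmk : m * k ≤ X)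
    (hy : ∀ u < n, s.arr 1 0 u = y u) (hy0 : ∀ u < n, 0 ≤ y u)
    (hsum : ∑ u ∈ Finset.range n, y u = m * k)
    (hleaf : ∀ p < n, y p ≠ 0 → ∀ v ∈ kids n r g p, mass n g y v = 0)
    (hbal : ∀ v < n, Balanced m fun i => s.arr 3 i v)
    (hold : ∀ v < n, 0 ≤ ∑ i ∈ Finset.range m, s.arr 3 i v ∧
      ∑ i ∈ Finset.range m, s.arr 3 i v ≤ m * k) :
    Runs X update (fun s' => Servers n m r k g y (s'.arr 3) ∧
      ChangeBound n m r g y (s.arr 3) (s'.arr 3) ∧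
      ∀ i < m, Lists N (outputCount y (s'.arr 3 i)) (s'.arr 2 i)) s := by
  refine Runs.seq (Runs.mono (masses_runs h hg hn hy) fun s1 f1 ⟨k6, k7⟩ => ?_)
  have t1 := h.frame f1 rfl rfl rfl rfl
  refine Runs.seq (Runs.mono (setRoot_runs t1 ((f1.var 1 rfl).trans h1) hm)
    fun s2 f2 ⟨hroot, hother⟩ => ?_)
  have t2 := t1.frame f2 rfl rfl rfl rfl
  have hother' : ∀ i v, v ≠ r → s2.arr 3 i v = s.arr 3 i v := fun i v hv => by
    rw [hother i v hv, f1.arr 3 rfl]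
  have hkid : ∀ {p v : ℕ}, v ∈ kids n r g p → ∀ i, s2.arr 3 i v = s.arr 3 i v := fun hv i =>
    hother' i _ (mem_kids.1 hv).2.1
  have hmass0 := fun v => mass_nonneg (g := g) hy0 v
  have hmassle := fun v => mass_le_sum (g := g) hy0 v
  rw [hsum] at hmassle
  have hbal2 : ∀ v < n, Balanced m fun i => s2.arr 3 i v := by
    intro v hv
    by_cases hvr : v = r
    · subst hvr
      intro i hi i' hi'
      simp only [hroot i hi, hroot i' hi']
      omega
    · simp only [hother' _ v hvr]
      exact hbal v hv
  refine Runs.seq (Runs.mono (rebalanceAll_runs (t := mass n g y) t2 hg hm0 hm hn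
    (fun v hv => by rw [f2.arr 6 rfl]; exact k6 v hv)
    (fun v hv => by rw [f2.arr 7 rfl]; exact k7 v hv) (fun v hv hvr => ?_) hbal2)
    fun s3 f3 hP => ?_)
  · simp only [hother' _ v hvr]
    have h2 := hold v hv
    have h3 := hmass0 v
    have h4 := hmassle v
    have h5 : ((m * k : ℕ) : ℤ) ≤ X := by exact_mod_cast hmk
    push_cast at h5
    rw [abs_le]
    constructor <;> linarith
  have hD := fun p hp => hP.done p hp trivial
  have hroot3 : ∀ i < m, s3.arr 3 i r = k := fun i hi => by rw [hP.root, hroot i hi]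
  have hcol : ∀ v < n, v ≠ r → v ∈ kids n r g (g v) := fun v hv hvr => mem_kids.2 ⟨hv, hvr, rfl⟩
  have hbal3 : ∀ v < n, Balanced m fun i => s3.arr 3 i v := by
    intro v hv
    by_cases hvr : v = r
    · simp only [hvr, hP.root]
      exact hbal2 r hg.root_lt
    · exact (hD _ (hg.map_lt v hv)).balanced v (hcol v hv hvr)
  have hsum3 : ∀ v < n, ∑ i ∈ Finset.range m, s3.arr 3 i v = mass n g y v := by
    intro v hv
    by_cases hvr : v = r
    · rw [hvr, hg.mass_root, hsum, Finset.sum_congr rfl fun i hi => hroot3 i (Finset.mem_range.1 hi)]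
      simp
    · exact (hD _ (hg.map_lt v hv)).sum v (hcol v hv hvr)
  have hS : Servers n m r k g y (s3.arr 3) := by
    refine ⟨hroot3, hbal3, hsum3, fun p hp i hi => ?_⟩
    by_cases hyp : y p = 0
    · rw [if_pos hyp, zero_add]
      have htot : ∑ i ∈ Finset.range m, ∑ v ∈ kids n r g p, s3.arr 3 i v =
          ∑ i ∈ Finset.range m, s3.arr 3 i p := by
        rw [Finset.sum_comm, hsum3 p hp, hg.mass_eq y hp, hyp, zero_add]
        exact Finset.sum_congr rfl fun v hv => hsum3 v (mem_kids.1 hv).1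
      have hle : ∀ i ∈ Finset.range m, ∑ v ∈ kids n r g p, s3.arr 3 i v ≤ s3.arr 3 i p := by
        intro i hi
        by_contra hc
        refine htot.not_gt (Finset.sum_lt_sum (fun i' hi' => ?_) ⟨i, hi, not_le.1 hc⟩)
        exact ((hD p hp).row i (Finset.mem_range.1 hi) i' (Finset.mem_range.1 hi')).resolve_left hc
      exact ((Finset.sum_eq_sum_iff_of_le hle).1 htot i (Finset.mem_range.2 hi)).symm
    · rw [if_neg hyp, Finset.sum_eq_zero, add_zero]
      intro v hv
      have hv' := (mem_kids.1 hv).1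
      have h2 := hsum3 v hv'
      rw [hleaf p hp hyp v hv] at h2
      exact le_antisymm ((hbal3 v hv').le (by rw [h2]; simp) hi)
        ((hbal3 v hv').ge (by rw [h2]; simp) hi)
  refine Runs.mono (output_runs (N := N) (y := y)
    ((f3.var 2 rfl).trans t2.rows)
    ((f3.var 0 rfl).trans ((f2.var 0 rfl).trans ((f1.var 0 rfl).trans h0))) hm (hN.trans hn)
    (fun u hu => by rw [f3.arr 1 rfl, f2.arr 1 rfl, f1.arr 1 rfl]; exact hy u (hu.trans_le hN))
    (fun i hi p hp => ?_)) fun s4 f4 hO => ?_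
  · have h2 := (hbal3 p (hp.trans_le hN)).le (c := k)
      (by rw [hsum3 p (hp.trans_le hN)]; exact hmassle p) hi
    have h3 : k ≤ m * k := Nat.le_mul_of_pos_left k hm0
    omega
  · have e3 : s4.arr 3 = s3.arr 3 := f4.arr 3 rfl
    rw [e3]
    refine ⟨hS, fun p hp => ?_, hO⟩
    have h2 := (hD p hp).change
    have e1 : ∀ i, ∑ v ∈ kids n r g p, s2.arr 3 i v = ∑ v ∈ kids n r g p, s.arr 3 i v :=
      fun i => Finset.sum_congr rfl fun v hv => hkid hv i
    have e2 : ∑ v ∈ kids n r g p, |mass n g y v - ∑ i ∈ Finset.range m, s2.arr 3 i v| =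
        ∑ v ∈ kids n r g p, |mass n g y v - ∑ i ∈ Finset.range m, s.arr 3 i v| :=
      Finset.sum_congr rfl fun v hv => by simp only [hkid hv]
    have e4 : ∑ v ∈ kids n r g p, ∑ i ∈ Finset.range m, |s3.arr 3 i v - s2.arr 3 i v| =
        ∑ v ∈ kids n r g p, ∑ i ∈ Finset.range m, |s3.arr 3 i v - s.arr 3 i v| :=
      Finset.sum_congr rfl fun v hv => by simp only [hkid hv]
    rw [e2, e4] at h2
    simpa only [e1] using h2

/-- Relative to matching servers, the change at the children is bounded by that at the parent. -/
theorem ChangeBound.le {n m r k : ℕ} {g : ℕ → ℕ} {y y' : ℕ → ℤ} {A A' : ℕ → ℕ → ℤ}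
    (h : ChangeBound n m r g y' A A') (hA : Servers n m r k g y A) {p : ℕ} (hp : p < n)
    (hyp : y p = 0 ∨ kids n r g p = ∅) :
    ∑ v ∈ kids n r g p, ∑ i ∈ Finset.range m, |A' i v - A i v| ≤
      ∑ i ∈ Finset.range m, |A' i p - A i p| +
        2 * ∑ v ∈ kids n r g p, |mass n g y' v - mass n g y v| := by
  rcases hyp with hyp | hyp
  · refine (h p hp).trans (le_of_eq ?_)
    congr 1
    · refine Finset.sum_congr rfl fun i hi => ?_
      have := hA.row p hp i (Finset.mem_range.1 hi)
      rw [if_pos hyp, zero_add] at this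
      rw [← this, abs_sub_comm]
    · rw [Finset.sum_congr rfl fun v hv => by rw [hA.sum v (mem_kids.1 hv).1]]
  · rw [hyp]
    simpa using Finset.sum_nonneg fun i _ => abs_nonneg (A' i p - A i p)

theorem Servers.eq_mass {n m r k : ℕ} {g : ℕ → ℕ} {y : ℕ → ℤ} {A : ℕ → ℕ → ℤ}
    (h : Servers n m r k g y A) (hg : IsTree n r g) {i p : ℕ} (hi : i < m) (hp : p < n) :
    A i p = mass n g (fun q => if y q = 0 then 0 else A i q) p :=
  hg.eq_mass (φ := A i) (fun p hp => h.row p hp i hi) hp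

theorem Servers.nonneg {n m r k : ℕ} {g : ℕ → ℕ} {y : ℕ → ℤ} {A : ℕ → ℕ → ℤ}
    (h : Servers n m r k g y A) (hy : ∀ u < n, 0 ≤ y u) {i p : ℕ} (hi : i < m) (hp : p < n) :
    0 ≤ A i p :=
  (h.balanced p hp).ge (by rw [h.sum p hp, mul_zero]; exact mass_nonneg hy p) hi

theorem Servers.outputCount_eq {n m r k : ℕ} {g : ℕ → ℕ} {y : ℕ → ℤ} {A : ℕ → ℕ → ℤ}
    (h : Servers n m r k g y A) (hy : ∀ u < n, 0 ≤ y u) {i p : ℕ} (hi : i < m) (hp : p < n) :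
    (outputCount y (A i) p : ℤ) = if y p = 0 then 0 else A i p := by
  have h1 := h.nonneg hy hi hp
  have h2 := hy p hp
  unfold outputCount
  split_ifs <;> omega

theorem Servers.sum_outputCount {n m r k N : ℕ} {g : ℕ → ℕ} {y : ℕ → ℤ} {A : ℕ → ℕ → ℤ}
    (h : Servers n m r k g y A) (hg : IsTree n r g) (hy : ∀ u < n, 0 ≤ y u) (hN : N ≤ n)
    (hyN : ∀ u, N ≤ u → y u = 0) {i : ℕ} (hi : i < m) :
    ∑ q ∈ Finset.range N, outputCount y (A i) q = k := by
  have h1 : ∑ q ∈ Finset.range N, outputCount y (A i) q =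
      ∑ q ∈ Finset.range n, outputCount y (A i) q := by
    refine Finset.sum_subset (Finset.range_mono hN) fun q _ hq => ?_
    have := hyN q (by simpa using hq)
    simp [outputCount, this]
  have h2 := h.eq_mass hg hi hg.root_lt
  rw [hg.mass_root, h.root i hi] at h2
  rw [h1]
  zify
  rw [h2]
  exact Finset.sum_congr rfl fun q hq => h.outputCount_eq hy hi (Finset.mem_range.1 hq)

namespace Refines

variable {N : ℕ} {T : WTree N} {g : ℕ → ℕ} {k m : ℕ} {f : T.Leaf → ℤ} {A : ℕ → ℕ → ℤ}

theorem eq_root_of_isLeaf_root (hroot : T.IsLeaf T.root) (u : Fin N) : u = T.root := by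
  obtain ⟨i, hi⟩ := T.reaches_root u
  induction i generalizing u with
  | zero => exact hi
  | succ i ih =>
    have := ih (T.parent u) (by rwa [← Function.iterate_succ_apply])
    by_contra hu
    exact hroot u ⟨hu, this⟩

theorem mass_kid_eq_zero (hR : Refines T g) {p v : ℕ} (hp : leafMass T f p ≠ 0)
    (hv : v ∈ kids (2 * N) T.root g p) : mass (2 * N) g (leafMass T f) v = 0 := by
  obtain ⟨a, rfl⟩ : ∃ a : T.Leaf, (a.1 : ℕ) = p := by
    by_contra hc
    push Not at hc
    exact hp (leafMass_eq_zero f hc)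
  by_cases har : a.1 = T.root
  · refine Finset.sum_eq_zero fun w _ => ?_
    split_ifs with hw
    · refine leafMass_eq_zero f fun b hb => ?_
      have hbr := eq_root_of_isLeaf_root (har ▸ a.2) b.1
      obtain ⟨i, hi⟩ := hw
      rw [← hb, hbr, hR.isTree.iterate_root] at hi
      exact (mem_kids.1 hv).2.1 hi.symm
    · rfl
  · rw [hR.kids_leaf a.2 har] at hv
    exact absurd hv (Finset.notMem_empty v)

theorem mass_leaf (hR : Refines T g) (a : T.Leaf) (ha : f a ≠ 0) :
    mass (2 * N) g (leafMass T f) a.1 = f a := by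
  have h := leafMass_leaf f a
  rw [hR.isTree.mass_eq _ (by omega), h, Finset.sum_eq_zero, add_zero]
  exact fun v hv => hR.mass_kid_eq_zero (by rwa [h]) hv

theorem leafMass_nonneg (hf : ∀ a, 0 ≤ f a) (u : ℕ) : 0 ≤ leafMass T f u :=
  Finset.sum_nonneg fun a _ => by
    split_ifs
    · exact hf a
    · exact le_rfl

/-- The servers of a configuration in the subtree of `u` are as many as recorded. -/
theorem count_eq (hR : Refines T g)
    (hS : Servers (2 * N) m T.root k g (leafMass T f) A) (hf : ∀ a, 0 ≤ f a) {i : ℕ} (hi : i < m)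
    {x : ℕ → ℤ} (hx : Lists N (outputCount (leafMass T f) (A i)) x) (B : Config T.Leaf k)
    (hB : ∀ j : Fin k, x j = ((B j).1 : ℕ)) {u : Fin N} (hu : u ≠ T.root) :
    (T.count B u : ℤ) = A i u := by
  classical
  have hy : ∀ u < 2 * N, 0 ≤ leafMass T f u := fun u _ => leafMass_nonneg hf u
  have hk := hS.sum_outputCount hR.isTree hy (by omega) (N := N)
    (fun u hu => leafMass_eq_zero f fun a => by omega) hi
  have hlm : (fun q => if leafMass T f q = 0 then 0 else A i q) =
      leafMass T fun a : T.Leaf => if leafMass T f a.1 = 0 then 0 else A i a.1 := by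
    funext q
    by_cases hq : ∃ a : T.Leaf, (a.1 : ℕ) = q
    · obtain ⟨a, rfl⟩ := hq
      rw [leafMass_leaf (fun a : T.Leaf => if leafMass T f a.1 = 0 then (0 : ℤ) else A i a.1) a]
    · push Not at hq
      rw [leafMass_eq_zero f hq, if_pos rfl, leafMass_eq_zero _ hq]
  rw [hS.eq_mass hR.isTree hi (by omega), hlm, hR.mass_leafMass _ hu, WTree.count,
    Finset.card_filter]
  push_cast
  have h1 : ∀ j, (if T.Below (B j).1 u then (1 : ℤ) else 0) =
      ∑ a : T.Leaf, if B j = a then (if T.Below a.1 u then 1 else 0) else 0 := fun j => by simp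
  simp_rw [h1]
  rw [Finset.sum_comm]
  refine Finset.sum_congr rfl fun a _ => ?_
  have h2 := hx.card_eq hk a.1.2
  have h3 : (Finset.univ.filter fun j : Fin k => x j = ((a.1 : ℕ) : ℤ)) =
      Finset.univ.filter fun j => B j = a := by
    refine Finset.filter_congr fun j _ => ?_
    rw [hB, Nat.cast_inj, Fin.val_inj, Subtype.ext_iff]
  rw [← hS.outputCount_eq hy hi (by omega), ← h2, h3, ← Finset.sum_filter]
  split_ifs <;> simp

end Refines

theorem mass_leafMass_sub {N : ℕ} {T : WTree N} (n : ℕ) (g : ℕ → ℕ) (f f' : T.Leaf → ℤ) (v : ℕ) :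
    ((mass n g (leafMass T f') v - mass n g (leafMass T f) v : ℤ) : ℝ) =
      mass n g (leafMass T fun a => (f' a : ℝ) - f a) v := by
  unfold mass leafMass
  rw [← Finset.sum_sub_distrib]
  push_cast
  refine Finset.sum_congr rfl fun u _ => ?_
  split_ifs
  · rw [← Finset.sum_sub_distrib]
    refine Finset.sum_congr rfl fun a _ => ?_
    split_ifs <;> simp
  · simp

open Prog in
/-- Build the refined tree if this is the first activation, and update the configurations. -/
def treeProg : Prog :=
  seq (setVar 6 (.add (.var 0) (.var 0)))
    (seq (ite (.eq (.var 5) (.const 0)) buildTree skip) update)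

/-- The memory after some requests, when the masses at the leaves are `f`. -/
structure TreeState {N : ℕ} (T : WTree N) (k m : ℕ) (f : T.Leaf → ℤ) (g : ℕ → ℕ) (s : Mem) :
    Prop where
  refines : Refines T g
  parent : ∀ v < 2 * N, s.arr 4 0 v = g v
  servers : Servers (2 * N) m T.root k g (leafMass T f) (s.arr 3)
  lists : ∀ i < m, Lists N (outputCount (leafMass T f) (s.arr 3 i)) (s.arr 2 i)

theorem treeProg_runs {X N k m : ℕ} {T : WTree N} {f f' : T.Leaf → ℤ} {s : Mem}
    (hT : InputTree T s) (h1 : s.var 1 = k) (h2 : s.var 2 = m) (hm0 : 0 < m) (hm : m ≤ X)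
    (hN : 2 * N ≤ X) (hmk : m * k ≤ X) (hf : ∀ a, 0 ≤ f a) (hf' : ∀ a, 0 ≤ f' a)
    (hsum : ∑ a, f a = m * k) (hsum' : ∑ a, f' a = m * k) (hy : s.arr 1 0 = leafMass T f')
    (hs : (s.var 5 = 0 ∧ ∀ i v, s.arr 3 i v = 0) ∨ (s.var 5 = 1 ∧ ∃ g, TreeState T k m f g s)) :
    Runs X treeProg (fun s' => s'.var 5 = 1 ∧ ∃ g, TreeState T k m f' g s' ∧
      ((s.var 5 = 1 → TreeState T k m f g s) ∧
        ChangeBound (2 * N) m T.root g (leafMass T f') (s.arr 3) (s'.arr 3))) s := by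
  refine Runs.seq (Runs.setVar (Runs.seq ?_))
  have t0 : InputTree T (s.setVar 6 (Expr.eval s (.add (.var 0) (.var 0)))) :=
    ⟨hT.nodes, hT.root, hT.parent, hT.weight⟩
  have h6 : (s.setVar 6 (Expr.eval s (.add (.var 0) (.var 0)))).var 6 = ((2 * N : ℕ) : ℤ) := by
    simp [Expr.eval, hT.nodes]
    ring
  have main : ∀ s1 g, Frame buildTree (s.setVar 6 (Expr.eval s (.add (.var 0) (.var 0)))) s1 →
      s1.var 5 = 1 → Refines T g → (∀ v < 2 * N, s1.arr 4 0 v = g v) →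
      (s.var 5 = 1 → TreeState T k m f g s) →
      (∀ v < 2 * N, Balanced m fun i => s.arr 3 i v) →
      (∀ v < 2 * N, 0 ≤ ∑ i ∈ Finset.range m, s.arr 3 i v ∧
        ∑ i ∈ Finset.range m, s.arr 3 i v ≤ m * k) →
      Runs X update (fun s' => s'.var 5 = 1 ∧ ∃ g, TreeState T k m f' g s' ∧
      ((s.var 5 = 1 → TreeState T k m f g s) ∧
        ChangeBound (2 * N) m T.root g (leafMass T f') (s.arr 3) (s'.arr 3))) s1 := by
    intro s1 g f1 k5 hR k4 hst hbal hold
    have t1 := t0.frame f1 rfl rfl rfl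
    have tm : TreeMem (2 * N) m T.root g s1 :=
      ⟨(f1.var 2 rfl).trans h2, t1.root, (f1.var 6 rfl).trans h6, k4⟩
    have k3 : s1.arr 3 = s.arr 3 := f1.arr 3 rfl
    have k1 : s1.arr 1 = s.arr 1 := f1.arr 1 rfl
    refine Runs.mono (update_runs (y := leafMass T f') tm hR.isTree t1.nodes
      ((f1.var 1 rfl).trans h1) hm0 hm hN (by omega) hmk (fun u _ => by rw [k1, hy])
      (fun u _ => Refines.leafMass_nonneg hf' u) (by rw [sum_leafMass f' (by omega), hsum'])
      (fun p _ hp v hv => hR.mass_kid_eq_zero hp hv) (by rwa [k3]) (by rwa [k3]))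
      fun s2 f2 ⟨u1, u2, u3⟩ => ?_
    rw [k3] at u2
    exact ⟨(f2.var 5 rfl).trans k5, g, ⟨hR, fun v hv => by rw [f2.arr 4 rfl]; exact k4 v hv, u1, u3⟩,
      hst, u2⟩
  refine Runs.ite (fun ht => ?_) (fun ht => Runs.skip ?_) <;>
    rcases hs with ⟨h5, h3⟩ | ⟨h5, g, hg⟩
  · refine Runs.mono (buildTree_runs t0 (by omega)) fun s1 f1 ⟨k5, g, hR, k4⟩ =>
      main s1 g f1 k5 hR k4 (fun h => by omega) (fun v _ i _ i' _ => by simp [h3])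
        (fun v _ => ⟨by simp [h3], by simp only [h3, Finset.sum_const_zero]; positivity⟩)
  · simp [Test.holds, Expr.eval, Mem.setVar, h5] at ht
  · simp [Test.holds, Expr.eval, Mem.setVar, h5] at ht
  · have hy0 : ∀ u < 2 * N, 0 ≤ leafMass T f u := fun u _ => Refines.leafMass_nonneg hf u
    refine main _ g (Frame.refl _ _) h5 hg.refines hg.parent (fun _ => hg) hg.servers.balanced
      fun v hv => ?_
    rw [hg.servers.sum v hv]
    refine ⟨mass_nonneg hy0 v, (mass_le_sum hy0 v).trans_eq ?_⟩
    rw [sum_leafMass f (by omega), hsum]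

theorem TreeState.configDist_sum_le {N k m : ℕ} {T : WTree N} {τ : ℝ} {f f' : T.Leaf → ℤ}
    {g : ℕ → ℕ} {s s' : Mem} (h : TreeState T k m f g s) (h' : TreeState T k m f' g s')
    (hc : ChangeBound (2 * N) m T.root g (leafMass T f') (s.arr 3) (s'.arr 3))
    (hτ : 2 ≤ τ) (hT : T.IsHST τ) (hf : ∀ a, 0 ≤ f a) (hf' : ∀ a, 0 ≤ f' a)
    (hsum : ∑ a, f a = ∑ a, f' a) {A A' : Fin m → Config T.Leaf k}
    (hA : ∀ (i : Fin m) (j : Fin k), s.arr 2 i j = ((A i j).1 : ℕ))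
    (hA' : ∀ (i : Fin m) (j : Fin k), s'.arr 2 i j = ((A' i j).1 : ℕ)) :
    ∑ i, (configDist T.dist (A i) (A' i) : ℝ) ≤ 24 * T.OT (fun a => f' a) (fun a => f a) := by
  classical
  by_cases hroot : T.IsLeaf T.root
  · have hr := Refines.eq_root_of_isLeaf_root hroot
    have h1 : ∀ i, configDist T.dist (A i) (A' i) = 0 := fun i => by
      refine Nat.le_zero.1 ((configDist_le_sum _ _ _).trans_eq ?_)
      refine Finset.sum_eq_zero fun j _ => Finset.sum_eq_zero fun u _ => ?_
      rw [if_neg fun h => h.1 (hr u)]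
    have h2 : T.OT (fun a => (f' a : ℝ)) (fun a => f a) = 0 :=
      Finset.sum_eq_zero fun u _ => if_neg fun h => h (hr u)
    simp [h1, h2]
  have hR := h.refines
  have h1 : ∀ i : Fin m, (configDist T.dist (A i) (A' i) : ℤ) ≤ ∑ u : Fin N, if u ≠ T.root then
      (T.weight u : ℤ) * |s'.arr 3 i u - s.arr 3 i u| else 0 := by
    intro i
    refine (T.configDist_le (A i) (A' i)).trans (le_of_eq (Finset.sum_congr rfl fun u _ => ?_))
    by_cases hu : u ≠ T.root
    · rw [if_pos hu, if_pos hu, hR.count_eq h.servers hf i.2 (h.lists i i.2) (A i) (hA i) hu,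
        hR.count_eq h'.servers hf' i.2 (h'.lists i i.2) (A' i) (hA' i) hu, abs_sub_comm]
    · rw [if_neg hu, if_neg hu]
  set Δ : ℕ → ℝ := fun p => ((∑ i ∈ Finset.range m, |s'.arr 3 i p - s.arr 3 i p| : ℤ) : ℝ) with hΔ
  have h2 : ∑ i, (configDist T.dist (A i) (A' i) : ℝ) ≤
      ∑ u : Fin N, (if u ≠ T.root then (T.weight u : ℝ) * Δ u else 0) := by
    have h3 : ∑ i : Fin m, (configDist T.dist (A i) (A' i) : ℤ) ≤
        ∑ u : Fin N, if u ≠ T.root then (T.weight u : ℤ) *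
          ∑ i ∈ Finset.range m, |s'.arr 3 i u - s.arr 3 i u| else 0 := by
      refine (Finset.sum_le_sum fun i _ => h1 i).trans (le_of_eq ?_)
      rw [Finset.sum_comm]
      refine Finset.sum_congr rfl fun u _ => ?_
      rw [← Fin.sum_univ_eq_sum_range (fun i => |s'.arr 3 i u - s.arr 3 i u|)]
      split_ifs
      · rw [Finset.mul_sum]
      · simp
    have h4 := (Int.cast_le (R := ℝ)).2 h3
    simp only [hΔ]
    push_cast at h4 ⊢
    exact h4
  set e : T.Leaf → ℝ := fun a => (f' a : ℝ) - f a with he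
  have hsum0 : ∑ a, e a = 0 := by
    rw [he, Finset.sum_sub_distrib, sub_eq_zero]
    exact_mod_cast hsum.symm
  have h5 := hR.sum_weight_change_le hτ hT hroot e hsum0 (Δ := Δ)
    (fun p => by
      rw [hΔ]
      exact Int.cast_nonneg (Finset.sum_nonneg fun i _ => abs_nonneg _))
    (by
      simp only [hΔ]
      rw [Finset.sum_eq_zero, Int.cast_zero]
      intro i hi
      have hi := Finset.mem_range.1 hi
      rw [h.servers.root i hi, h'.servers.root i hi, sub_self, abs_zero])
    (fun p hp => by
      have h6 : leafMass T f p = 0 ∨ kids (2 * N) T.root g p = ∅ := by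
        by_cases hex : ∃ a : T.Leaf, (a.1 : ℕ) = p
        · obtain ⟨a, rfl⟩ := hex
          right
          exact hR.kids_leaf a.2 fun ha => hroot (ha ▸ a.2)
        · push Not at hex
          exact Or.inl (leafMass_eq_zero f hex)
      have h7 := (Int.cast_le (R := ℝ)).2 (hc.le h.servers hp h6)
      simp only [hΔ, he, ← mass_leafMass_sub]
      push_cast at h7 ⊢
      exact h7)
  refine h2.trans (h5.trans (le_of_eq ?_))
  congr 1
  refine Finset.sum_congr rfl fun u _ => ?_
  split_ifs with hu
  · congr 2
    simp only [WTree.massBelow, he]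
    rw [← Finset.sum_sub_distrib]
    refine Finset.sum_congr rfl fun a _ => ?_
    split_ifs <;> simp
  · rfl

theorem WTree.OT_mul {N : ℕ} (T : WTree N) {c : ℝ} (hc : 0 ≤ c) (x y : T.Leaf → ℝ) :
    T.OT (fun a => c * x a) (fun a => c * y a) = c * T.OT x y := by
  have h : ∀ (x : T.Leaf → ℝ) u, T.massBelow (fun a => c * x a) u = c * T.massBelow x u := by
    intro x u
    rw [WTree.massBelow, WTree.massBelow, Finset.mul_sum]
    exact Finset.sum_congr rfl fun a _ => by split_ifs <;> simp
  rw [WTree.OT, WTree.OT, Finset.mul_sum]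
  refine Finset.sum_congr rfl fun u _ => ?_
  split_ifs
  · rw [h, h, ← mul_sub, abs_mul, abs_of_nonneg hc]
    ring
  · simp

theorem outputCount_leafMass {N : ℕ} {T : WTree N} (f : T.Leaf → ℤ) (A : ℕ → ℤ) (a : T.Leaf) :
    outputCount (leafMass T f) A a.1 = if 1 ≤ f a then (A a.1).toNat else 0 := by
  rw [outputCount, leafMass_leaf]

theorem exists_leaf_of_outputCount_pos {N : ℕ} {T : WTree N} {f : T.Leaf → ℤ} {A : ℕ → ℤ} {p : ℕ}
    (h : 0 < outputCount (leafMass T f) A p) : ∃ a : T.Leaf, (a.1 : ℕ) = p := by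
  by_contra hc
  push Not at hc
  simp [outputCount, leafMass_eq_zero f hc] at h

namespace TreeState

variable {N k m : ℕ} {T : WTree N} {f : T.Leaf → ℤ} {g : ℕ → ℕ} {s : Mem}

theorem sum_outputCount (h : TreeState T k m f g s) (hf : ∀ a, 0 ≤ f a) {i : ℕ} (hi : i < m) :
    ∑ q ∈ Finset.range N, outputCount (leafMass T f) (s.arr 3 i) q = k :=
  h.servers.sum_outputCount h.refines.isTree (fun u _ => Refines.leafMass_nonneg hf u) (by omega)
    (fun u hu => leafMass_eq_zero f fun a => by omega) hi

theorem card_eq (h : TreeState T k m f g s) (hf : ∀ a, 0 ≤ f a) (i : Fin m) (a : T.Leaf) :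
    (Finset.univ.filter fun j : Fin k => s.arr 2 i j = ((a.1 : ℕ) : ℤ)).card =
      if 1 ≤ f a then (s.arr 3 i a.1).toNat else 0 := by
  rw [(h.lists i i.2).card_eq (h.sum_outputCount hf i.2) a.1.2, outputCount_leafMass]

theorem exists_leaf (h : TreeState T k m f g s) (hf : ∀ a, 0 ≤ f a) (i : Fin m) (j : Fin k) :
    ∃ a : T.Leaf, s.arr 2 i j = ((a.1 : ℕ) : ℤ) := by
  obtain ⟨p, -, h1, h2⟩ := (h.lists i i.2).exists_eq
    ((h.sum_outputCount hf i.2).symm ▸ j.2 : (j : ℕ) < _)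
  obtain ⟨a, rfl⟩ := exists_leaf_of_outputCount_pos h1
  exact ⟨a, h2⟩

theorem sum_servers (h : TreeState T k m f g s) (a : T.Leaf) (ha : f a ≠ 0) :
    ∑ i ∈ Finset.range m, s.arr 3 i a.1 = f a := by
  rw [h.servers.sum _ (by omega), h.refines.mass_leaf a ha]

theorem exists_serving (h : TreeState T k m f g s) (hf : ∀ a, 0 ≤ f a) (a : T.Leaf)
    (ha : f a = m) (i : Fin m) : ∃ j : Fin k, s.arr 2 i j = ((a.1 : ℕ) : ℤ) := by
  have hm := i.pos
  have h1 : 1 ≤ f a := by omega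
  have h2 := (h.servers.balanced a.1 (by omega)).ge (c := 1)
    (by rw [h.sum_servers a (by omega), ha, mul_one]) i.2
  have h3 := h.card_eq hf i a
  rw [if_pos h1] at h3
  obtain ⟨j, hj⟩ := Finset.card_pos.1 (show 0 < Finset.card _ by rw [h3]; omega)
  exact ⟨j, (Finset.mem_filter.1 hj).2⟩

theorem injective (h : TreeState T k m f g s) (hf : ∀ a, 0 ≤ f a) (hm : ∀ a, f a ≤ m)
    (i : Fin m) : Function.Injective fun j : Fin k => s.arr 2 i j := by
  intro j j' hjj
  obtain ⟨a, ha⟩ := h.exists_leaf hf i j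
  have h3 := h.card_eq hf i a
  have h4 : (Finset.univ.filter fun j : Fin k => s.arr 2 i j = ((a.1 : ℕ) : ℤ)).card ≤ 1 := by
    rw [h3]
    split_ifs with h1
    · have h2 := (h.servers.balanced a.1 (by omega)).le (c := 1)
        (by rw [h.sum_servers a (by omega), mul_one]; exact hm a) i.2
      omega
    · omega
  exact Finset.card_le_one.1 h4 j (by simp [ha]) j' (by simpa [ha] using hjj.symm)

end TreeState

theorem tree_conversion :
    ∃ (c : Prog) (C : ℝ) (e : ℕ),
      ∀ (τ : ℝ), 5 < τ →
      ∀ (N k m : ℕ) (T : WTree N), T.IsHST τ → k ≤ Fintype.card T.Leaf → 0 < m →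
      ∀ z : List T.Leaf → T.Leaf → ℝ, IsFractional k z → IsBarelyFractional m z →
      ∃ R : Fin m → DetAlg T.Leaf k,
        (∀ i, (R i).Serves) ∧
        (∀ ρ, ρ ≠ [] → (∀ p, z ρ p ≤ 1) → ∀ i, Function.Injective (R i ρ)) ∧
        (∀ ρ, barelyRandomCost T.dist R ρ ≤ C * fracCost T.OT z ρ) ∧
        ConvertsOnline c (treeInit k m T) (fun p : T.Leaf => (p.1 : ℕ)) z R
          (e * (N + m + Nat.log 2 (diam T.dist) + 1) ^ e) := by
  obtain ⟨e, he⟩ := treeProg.bound_sq_le_pow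
  refine ⟨treeProg, 24, e, fun τ hτ N k m T hT hk hm z hz hzm => ?_⟩
  set Y := N + m + Nat.log 2 (diam T.dist) + 1 with hY
  have hm' : (0 : ℝ) < m := Nat.cast_pos.2 hm
  have hkN : k ≤ N := hk.trans <| by
    simpa using Fintype.card_le_of_injective (fun a : T.Leaf => a.1) Subtype.val_injective
  have hcode : Function.Injective fun p : T.Leaf => (p.1 : ℕ) := fun a b h =>
    Subtype.ext (Fin.ext h)
  set F : List T.Leaf → T.Leaf → ℤ := fun ρ a => (⌊(m : ℝ) * z ρ a⌋₊ : ℤ) with hF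
  have hu : ∀ ρ, ρ ≠ [] → ∀ a, (F ρ a : ℝ) = m * z ρ a := fun ρ hρ a => by
    rw [← hzm.floor_eq hm hρ, hF]
    simp
  have hF0 : ∀ ρ a, 0 ≤ F ρ a := fun ρ a => Int.natCast_nonneg _
  have hsum : ∀ ρ, ρ ≠ [] → ∑ a, F ρ a = m * k := by
    intro ρ hρ
    have : (∑ a, (F ρ a : ℝ)) = m * k := by
      simp_rw [hu ρ hρ]
      rw [← Finset.mul_sum, hz.mass ρ hρ]
    exact_mod_cast this
  have hone : ∀ ρ r, F (ρ ++ [r]) r = m := fun ρ r => by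
    have := hu (ρ ++ [r]) (by simp) r
    rw [hz.serves, mul_one] at this
    exact_mod_cast this
  have hNY : N ≤ Y := by omega
  have hmY : m ≤ Y := by omega
  have hY1 : 1 ≤ Y := by omega
  have hNX : 2 * N ≤ 2 * Y ^ 2 := by nlinarith
  have hmX : m ≤ 2 * Y ^ 2 := by nlinarith
  have hkX : m * k ≤ 2 * Y ^ 2 := by
    calc m * k ≤ Y * Y := Nat.mul_le_mul hmY (hkN.trans hNY)
      _ ≤ 2 * Y ^ 2 := by nlinarith
  have hne : ∀ (ρ : List T.Leaf) (r : T.Leaf), ρ ++ [r] ≠ [] := fun ρ r => by simp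
  refine exists_barelyRandom T.dist T.OT 24 treeProg (treeInit k m T) _ hcode
    (fun h => Fintype.card_pos_iff.1 (h.trans_le hk)) z _
    (fun ρ s => InputTree T s ∧ s.var 1 = k ∧ s.var 2 = m ∧
      (ρ = [] → s.var 5 = 0 ∧ ∀ i v, s.arr 3 i v = 0) ∧
      (ρ ≠ [] → s.var 5 = 1 ∧ ∃ g, TreeState T k m (F ρ) g s))
    (fun ρ r s s' => ρ ≠ [] → ∃ g, TreeState T k m (F ρ) g s ∧
      TreeState T k m (F (ρ ++ [r])) g s' ∧
      ChangeBound (2 * N) m T.root g (leafMass T (F (ρ ++ [r]))) (s.arr 3) (s'.arr 3))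
    ?_ ?_ ?_ ?_ ?_ ?_
  · refine ⟨⟨rfl, rfl, fun v => ?_, fun v => ?_⟩, rfl, rfl, fun _ => ⟨rfl, fun i v => ?_⟩,
      fun h => absurd rfl h⟩ <;> simp [treeInit]
  · rintro ρ r s ⟨hI, h1, h2, h3, h4⟩
    obtain ⟨f, hfρ, hf0, hf, hs⟩ : ∃ f : T.Leaf → ℤ, (ρ ≠ [] → f = F ρ) ∧ (∀ a, 0 ≤ f a) ∧
        ∑ a, f a = m * k ∧ ((s.var 5 = 0 ∧ ∀ i v, s.arr 3 i v = 0) ∨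
          (s.var 5 = 1 ∧ ∃ g, TreeState T k m f g s)) := by
      by_cases hρ : ρ = []
      · exact ⟨F (ρ ++ [r]), fun h => absurd hρ h, hF0 _, hsum _ (hne ρ r), Or.inl (h3 hρ)⟩
      · exact ⟨F ρ, fun _ => rfl, hF0 _, hsum _ hρ, Or.inr (h4 hρ)⟩
    have hI' : InputTree T (feed (fun p : T.Leaf => (p.1 : ℕ)) m r (z (ρ ++ [r])) s) :=
      ⟨hI.nodes, hI.root, hI.parent, hI.weight⟩
    obtain ⟨t, ht, s', hex, h5, g, hg, h6, h7⟩ := treeProg_runs (f := f) (f' := F (ρ ++ [r]))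
      hI' h1 h2 hm hmX hNX hkX hf0 (hF0 _) hf (hsum _ (hne ρ r)) rfl
      (hs.imp id fun ⟨h5, g, hg⟩ => ⟨h5, g, hg.refines, hg.parent, hg.servers, hg.lists⟩)
    refine ⟨t, ht.trans (he Y hY1), s', hex, ⟨hI'.frame hex.frame rfl rfl rfl,
      (hex.frame.var 1 rfl).trans h1, (hex.frame.var 2 rfl).trans h2,
      fun h => absurd h (hne ρ r), fun _ => ⟨h5, g, hg⟩⟩, fun hρ => ⟨g, ?_, hg, h7⟩⟩
    have h8 := h6 (h4 hρ).1
    exact hfρ hρ ▸ ⟨h8.refines, h8.parent, h8.servers, h8.lists⟩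
  · rintro ρ s hρ ⟨-, -, -, -, h⟩ i j
    obtain ⟨-, g, hg⟩ := h hρ
    exact hg.exists_leaf (hF0 _) i j
  · rintro ρ r s ⟨-, -, -, -, h⟩ i
    obtain ⟨-, g, hg⟩ := h (hne ρ r)
    exact hg.exists_serving (hF0 _) r (hone ρ r) i
  · rintro ρ s hρ ⟨-, -, -, -, h⟩ hz1 i
    obtain ⟨-, g, hg⟩ := h hρ
    refine hg.injective (hF0 _) (fun a => ?_) i
    have h1 : (F ρ a : ℝ) ≤ m := by
      rw [hu ρ hρ]
      exact mul_le_of_le_one_right hm'.le (hz1 a)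
    exact_mod_cast h1
  · rintro ρ r s s' hρ - - hstep A A' hA hA'
    obtain ⟨g, hg, hg', hc⟩ := hstep hρ
    have h := hg.configDist_sum_le hg' hc (by linarith) hT (hF0 _) (hF0 _)
      (by rw [hsum ρ hρ, hsum _ (hne ρ r)]) hA hA'
    simp_rw [hu ρ hρ, hu _ (hne ρ r)] at h
    rw [T.OT_mul hm'.le] at h
    rw [one_div, inv_mul_le_iff₀ hm']
    linarith

end KServer

/-- On line metrics, and on `τ`-HSTs with `τ > 5`, barely fractional `k`-server algorithms are
converted online into barely random ones, with a polynomial additive overhead in running time per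
request and a constant factor in cost. In each part the program `c`, the cost factor `C` and the
exponent `e` are universal. The servers of a configuration are at pairwise distinct points whenever
the fractional algorithm has mass at most `1` on each point. -/
theorem proposition3 :
    (∃ (c : KServer.Prog) (C : ℝ) (e : ℕ),
      ∀ (n k m : ℕ) (pos : Fin n → ℤ), StrictMono pos → k ≤ n → 0 < m →
      ∀ z : List (Fin n) → Fin n → ℝ,
        KServer.IsFractional k z → KServer.IsBarelyFractional m z →
      ∃ R : Fin m → KServer.DetAlg (Fin n) k,
        (∀ i, (R i).Serves) ∧
        (∀ ρ, ρ ≠ [] → (∀ p, z ρ p ≤ 1) → ∀ i, Function.Injective (R i ρ)) ∧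
        (∀ ρ, KServer.barelyRandomCost (KServer.lineDist pos) R ρ
          ≤ C * KServer.fracCost (KServer.lineOT pos) z ρ) ∧
        KServer.ConvertsOnline c (KServer.lineInit k m pos) (fun p : Fin n => (p : ℕ)) z R
          (e * (n + m + Nat.log 2 (KServer.diam (KServer.lineDist pos)) + 1) ^ e)) ∧
    (∃ (c : KServer.Prog) (C : ℝ) (e : ℕ),
      ∀ (τ : ℝ), 5 < τ →
      ∀ (N k m : ℕ) (T : KServer.WTree N), T.IsHST τ → k ≤ Fintype.card T.Leaf → 0 < m →
      ∀ z : List T.Leaf → T.Leaf → ℝ,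
        KServer.IsFractional k z → KServer.IsBarelyFractional m z →
      ∃ R : Fin m → KServer.DetAlg T.Leaf k,
        (∀ i, (R i).Serves) ∧
        (∀ ρ, ρ ≠ [] → (∀ p, z ρ p ≤ 1) → ∀ i, Function.Injective (R i ρ)) ∧
        (∀ ρ, KServer.barelyRandomCost T.dist R ρ ≤ C * KServer.fracCost T.OT z ρ) ∧
        KServer.ConvertsOnline c (KServer.treeInit k m T) (fun p : T.Leaf => (p.1 : ℕ)) z R
          (e * (N + m + Nat.log 2 (KServer.diam T.dist) + 1) ^ e)) :=
  ⟨KServer.line_conversion, KServer.tree_conversion⟩
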